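/- Let $G=(V,E)$ be a finite graph, and consider $n$ unit-demand agents and a finite set $J$ of services. Each service $j\in J$ is an edge of $G$ targeted at one agent; $J_i$ denotes the services targeted at agent $i$ (an edge that several agents want gives one service for each of them). The values $v_j\ge 0$, $j\in J$, are independent with arbitrary known distributions. The seller may allocate a set $S\subseteq J$ (write $S\in\mathcal J$) if each agent gets at most one service, each edge is sold at most once, and the edges sold form a forest in $G$. Let $\mathrm{OPT}$ be the supremum of the expected revenues of all deterministic, dominant-strategy truthful, individually rational mechanisms for this instance, and assume $\mathrm{OPT}<\infty$. An order-oblivious posted pricing (OPM) consists of one price $p_j\ge 0$ for each service and a nonempty downward closed set system $\mathcal J'\subseteq\mathcal J$, both fixed before the values are known. The agents are approached in an arbitrary order; if $A$ has been sold so far, agent $i$ is offered the services $j\in J_i$ with $A\cup\{j\}\in\mathcal J'$ at their prices $p_j$, and buys one that maximizes her utility $v_j-p_j$, provided some offered service has $v_j\ge p_j$. Its order-oblivious revenue is $\mathcal R(p,\mathcal J')=\mathbb E_v\big[\min_S\sum_{j\in S}p_j\big]$, where $S$ ranges over the sets that are maximal among the sets $T\in\mathcal J'$ with $v_j\ge p_j$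 for all $j\in T$. **Theorem.** (1) For every such instance there is an OPM $(p,\mathcal J')$ such that, for every order of the agents, it is a feasible, dominant-strategy truthful and individually rational mechanism with expected revenue at least $\frac{3}{32}\,\mathrm{OPT}$; moreover $\mathcal R(p,\mathcal J')\ge\frac{3}{32}\,\mathrm{OPT}$. That is, it is a $32/3\approx 10.67$ approximation. (2) Such an OPM can be computed in polynomial time: there are one deterministic program for a random access machine with unit-cost exact real arithmetic, and one polynomial $T$, such that on every such instance the program computes, in at most $T(|V|+n+|J|)$ steps, the prices $p$ of an OPM $(p,\mathcal J')$ as in (1), and also decides whether a given set $S\subseteq J$ belongs to $\mathcal J'$. The program has access to the distributions through an oracle only, which returns, for a service $j$: the probability $\Pr[v_j\ge x]$ for a given $x$; the largest $x$ with $\Pr[v_j\ge x]\ge a$ for a given $a\in(0,1]$; and, for given $x\ge0$ and $\varepsilon>0$, a price $y\ge x$ with $(1+\varepsilon)\,y\Pr[v_j\ge y]\ge\sup_{z\ge x}z\Pr[v_j\ge z]$. -/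

import Mathlib

open MeasureTheory
open scoped NNReal ENNReal

namespace PostedPricing

noncomputable section

/-! ### Instances -/

/-- A Bayesian multi-parameter unit-demand instance on a finite graph. A service `j` is the edge
`s(left j, right j)` of the graph targeted at the agent `owner j`; the services of agent `i` are
those with `owner j = i`. An edge which several agents want gives one service for each of them.
The value of `owner j` for service `j` has law `dist j`, independently over all services. -/
structure GraphInstance where
  numVertices : ℕ
  numAgents : ℕ
  numServices : ℕ
  graph : SimpleGraph (Fin numVertices)
  owner : Fin numServices → Fin numAgents
  left : Fin numServices → Fin numVertices
  right : Fin numServices → Fin numVertices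
  adj : ∀ j, graph.Adj (left j) (right j)
  dist : Fin numServices → Measure ℝ≥0
  isProb : ∀ j, IsProbabilityMeasure (dist j)

namespace GraphInstance

variable (I : GraphInstance)

/-- Profiles of values, one value for each service. -/
abbrev Values : Type := Fin I.numServices → ℝ≥0

/-- The edge sold by service `j`. -/
def edge (j : Fin I.numServices) : Sym2 (Fin I.numVertices) := s(I.left j, I.right j)

/-- The joint law of the values: the product of the laws of the single values. -/
def law : Measure I.Values := Measure.pi I.dist

/-- A set of services can be allocated if every agent gets at most one service, every edge is
sold at most once, and the edges sold form a forest. -/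
def Feasible (S : Finset (Fin I.numServices)) : Prop :=
  Set.InjOn I.owner S ∧ Set.InjOn I.edge S ∧
    (SimpleGraph.fromEdgeSet (I.edge '' (S : Set (Fin I.numServices)))).IsAcyclic

/-! ### Deterministic mechanisms -/

/-- A deterministic mechanism maps bids to a set of allocated services and payments. -/
structure Mechanism where
  alloc : I.Values → Finset (Fin I.numServices)
  pay : I.Values → Fin I.numAgents → ℝ

variable {I}

/-- The services among `S` that go to agent `i`. -/
def bundle (S : Finset (Fin I.numServices)) (i : Fin I.numAgents) : Finset (Fin I.numServices) :=
  {j ∈ S | I.owner j = i}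

namespace Mechanism

variable (M : I.Mechanism)

/-- Utility of agent `i` when the true values are `v` and the bids are `w`. -/
def utility (v w : I.Values) (i : Fin I.numAgents) : ℝ :=
  (∑ j ∈ bundle (M.alloc w) i, (v j : ℝ)) - M.pay w i

/-- Truthful bidding is a dominant strategy. -/
def Truthful : Prop :=
  ∀ (i : Fin I.numAgents) (v w : I.Values), (∀ j, I.owner j ≠ i → w j = v j) →
    M.utility v w i ≤ M.utility v v i

/-- A served agent pays at most her value, an agent who is not served pays nothing. -/
def IndividuallyRational : Prop :=
  ∀ (v : I.Values) (i : Fin I.numAgents),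
    0 ≤ M.utility v v i ∧ (bundle (M.alloc v) i = ∅ → M.pay v i = 0)

/-- A measurable, feasible, truthful and individually rational mechanism. -/
structure Admissible : Prop where
  feasible : ∀ v, I.Feasible (M.alloc v)
  measurable_alloc : ∀ j, MeasurableSet {v | j ∈ M.alloc v}
  measurable_pay : ∀ i, Measurable fun v => M.pay v i
  truthful : M.Truthful
  rational : M.IndividuallyRational

/-- Expected revenue under truthful bidding. (Where the total payment is negative, it is counted
as `0`; it is never negative for mechanisms without payments to the agents.) -/
def revenue : ℝ≥0∞ := ∫⁻ v, ENNReal.ofReal (∑ i, M.pay v i) ∂I.law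

end Mechanism

variable (I)

/-- The optimal revenue: the supremum of the expected revenues of all deterministic, truthful,
individually rational mechanisms. -/
def optRevenue : ℝ≥0∞ := ⨆ (M : I.Mechanism) (_ : M.Admissible), M.revenue

/-! ### Order-oblivious posted pricings -/

/-- `R` is a restriction of the feasibility constraint: a nonempty downward closed system of
feasible sets. -/
structure IsRestriction (R : Finset (Fin I.numServices) → Prop) : Prop where
  feasible : ∀ S, R S → I.Feasible S
  empty : R ∅
  mono : ∀ S T, S ⊆ T → R T → R S

section Posted

variable (p : Fin I.numServices → ℝ≥0) (R : Finset (Fin I.numServices) → Prop)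

open Classical in
/-- The services of agent `i` that can be sold in addition to the services in `A`. -/
def menu (A : Finset (Fin I.numServices)) (i : Fin I.numAgents) : Finset (Fin I.numServices) :=
  {j | I.owner j = i ∧ R (insert j A)}

open Classical in
/-- What an agent with values `v` takes from the menu `D` at prices `p`: a service of maximal
utility (the first one, in case of ties) if some service in `D` is worth its price, else nothing.
The set has at most one element. -/
def purchase (v : I.Values) (D : Finset (Fin I.numServices)) : Finset (Fin I.numServices) :=
  {j ∈ D | p j ≤ v j ∧ ∀ k ∈ D,
    (v k : ℝ) - p k < (v j : ℝ) - p j ∨ ((v k : ℝ) - p k = (v j : ℝ) - p j ∧ j ≤ k)}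

/-- The services sold when the agents in the list are approached one after the other. -/
def sold (agents : List (Fin I.numAgents)) (v : I.Values) : Finset (Fin I.numServices) :=
  agents.foldl (fun A i => A ∪ I.purchase p v (I.menu R A i)) ∅

/-- The posted price mechanism with prices `p` and feasibility constraint `R` that approaches
the agents in the order `σ`. -/
def postedPrice (σ : Equiv.Perm (Fin I.numAgents)) : I.Mechanism where
  alloc v := I.sold p R (List.ofFn σ) v
  pay v i := ∑ j ∈ bundle (I.sold p R (List.ofFn σ) v) i, (p j : ℝ)

/-- `S` is a maximal `R`-feasible set of services that are desired at values `v`. -/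
def MaximalDesired (v : I.Values) (S : Finset (Fin I.numServices)) : Prop :=
  Maximal (fun T => R T ∧ ∀ j ∈ T, p j ≤ v j) S

/-- The order-oblivious revenue: the expectation of the least total price of a maximal feasible
set of desired services. -/
def oblRevenue : ℝ≥0∞ :=
  ∫⁻ v, ⨅ (S : Finset (Fin I.numServices)) (_ : I.MaximalDesired p R v S),
    ∑ j ∈ S, (p j : ℝ≥0∞) ∂I.law

/-- The prices `p` with the restricted constraint `R` form a truthful order-oblivious posted
pricing that is an `α`-approximation to the optimal revenue. -/
structure IsApproxOPM (α : ℝ≥0∞) : Prop where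
  restriction : I.IsRestriction R
  admissible : ∀ σ, (I.postedPrice p R σ).Admissible
  revenue : ∀ σ, I.optRevenue ≤ α * (I.postedPrice p R σ).revenue
  oblivious : I.optRevenue ≤ α * I.oblRevenue p R

end Posted

/-! ### Access to the distributions -/

/-- The probability that service `j` is desired at price `x`. -/
def acceptProb (j : Fin I.numServices) (x : ℝ) : ℝ :=
  (I.dist j).real {y : ℝ≥0 | x ≤ (y : ℝ)}

end GraphInstance

/-- Answers to the three kinds of oracle queries. The first argument is the index of a service. -/
structure Oracle where
  accept : ℕ → ℝ → ℝ
  quantile : ℕ → ℝ → ℝ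
  bestPrice : ℕ → ℝ → ℝ → ℝ

/-- The oracle is correct for `I`: it evaluates distribution functions and their inverses, and
finds a price in `[x, ∞)` whose expected revenue from a single service, sold on its own, is best
possible up to a factor `1 + ε`. -/
structure Oracle.Correct (O : Oracle) (I : GraphInstance) : Prop where
  accept : ∀ (j : Fin I.numServices) (x : ℝ), O.accept j x = I.acceptProb j x
  quantile : ∀ (j : Fin I.numServices) (a : ℝ), 0 < a → a ≤ 1 →
    IsGreatest {x : ℝ | a ≤ I.acceptProb j x} (O.quantile j a)
  bestPrice : ∀ (j : Fin I.numServices) (x ε : ℝ), 0 ≤ x → 0 < ε →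
    x ≤ O.bestPrice j x ε ∧ ∀ y, x ≤ y → y * I.acceptProb j y ≤
      (1 + ε) * (O.bestPrice j x ε * I.acceptProb j (O.bestPrice j x ε))

/-! ### A real random access machine with oracles

Programs are finite and work on arrays (with two subscripts) of natural numbers and of real
numbers. There is no rounding of reals and no multiplication of natural numbers. -/

/-- The memory: `nat a i k` and `real a i k` are the entries `i, k` of the `a`-th arrays. -/
structure Memory where
  nat : ℕ → ℕ → ℕ → ℕ
  real : ℕ → ℕ → ℕ → ℝ

/-- Expressions for natural numbers; `sub` is truncated. -/
inductive NatExpr where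
  | const (c : ℕ)
  | get (a : ℕ) (i k : NatExpr)
  | add (x y : NatExpr)
  | sub (x y : NatExpr)

/-- Expressions for real numbers. -/
inductive RealExpr where
  | ofNat (x : NatExpr)
  | get (a : ℕ) (i k : NatExpr)
  | add (x y : RealExpr)
  | sub (x y : RealExpr)
  | mul (x y : RealExpr)
  | div (x y : RealExpr)
  | accept (j : NatExpr) (x : RealExpr)
  | quantile (j : NatExpr) (x : RealExpr)
  | bestPrice (j : NatExpr) (x y : RealExpr)

/-- Tests. -/
inductive Test where
  | natLt (x y : NatExpr)
  | realLt (x y : RealExpr)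
  | not (b : Test)
  | and (b c : Test)

/-- Programs. -/
inductive Program where
  | skip
  | setNat (a : ℕ) (i k : NatExpr) (x : NatExpr)
  | setReal (a : ℕ) (i k : NatExpr) (x : RealExpr)
  | seq (P Q : Program)
  | ite (b : Test) (P Q : Program)
  | loop (b : Test) (P : Program)

def NatExpr.eval (s : Memory) : NatExpr → ℕ
  | const c => c
  | get a i k => s.nat a (i.eval s) (k.eval s)
  | add x y => x.eval s + y.eval s
  | sub x y => x.eval s - y.eval s

def RealExpr.eval (O : Oracle) (s : Memory) : RealExpr → ℝ
  | ofNat x => (x.eval s : ℝ)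
  | get a i k => s.real a (i.eval s) (k.eval s)
  | add x y => x.eval O s + y.eval O s
  | sub x y => x.eval O s - y.eval O s
  | mul x y => x.eval O s * y.eval O s
  | div x y => x.eval O s / y.eval O s
  | accept j x => O.accept (j.eval s) (x.eval O s)
  | quantile j x => O.quantile (j.eval s) (x.eval O s)
  | bestPrice j x y => O.bestPrice (j.eval s) (x.eval O s) (y.eval O s)

def Test.Holds (O : Oracle) (s : Memory) : Test → Prop
  | natLt x y => x.eval s < y.eval s
  | realLt x y => x.eval O s < y.eval O s
  | not b => ¬ b.Holds O s
  | and b c => b.Holds O s ∧ c.Holds O s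

def Memory.setNat (s : Memory) (a i k x : ℕ) : Memory where
  nat a' i' k' := if a' = a ∧ i' = i ∧ k' = k then x else s.nat a' i' k'
  real := s.real

def Memory.setReal (s : Memory) (a i k : ℕ) (x : ℝ) : Memory where
  nat := s.nat
  real a' i' k' := if a' = a ∧ i' = i ∧ k' = k then x else s.real a' i' k'

/-- `Runs O P s s' t`: started in memory `s`, the program `P` halts in memory `s'` after `t`
steps. Every assignment and every evaluation of a test is one step; it involves a number of
elementary operations and oracle queries that is bounded in terms of the program alone. -/
inductive Runs (O : Oracle) : Program → Memory → Memory → ℕ → Prop where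
  | skip (s : Memory) : Runs O .skip s s 1
  | setNat (a : ℕ) (i k x : NatExpr) (s : Memory) :
      Runs O (.setNat a i k x) s (s.setNat a (i.eval s) (k.eval s) (x.eval s)) 1
  | setReal (a : ℕ) (i k : NatExpr) (x : RealExpr) (s : Memory) :
      Runs O (.setReal a i k x) s (s.setReal a (i.eval s) (k.eval s) (x.eval O s)) 1
  | seq {P Q : Program} {s s' s'' : Memory} {t t' : ℕ} :
      Runs O P s s' t → Runs O Q s' s'' t' → Runs O (.seq P Q) s s'' (t + t')
  | ite_true {b : Test} {P Q : Program} {s s' : Memory} {t : ℕ} :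
      b.Holds O s → Runs O P s s' t → Runs O (.ite b P Q) s s' (t + 1)
  | ite_false {b : Test} {P Q : Program} {s s' : Memory} {t : ℕ} :
      ¬ b.Holds O s → Runs O Q s s' t → Runs O (.ite b P Q) s s' (t + 1)
  | loop_done {b : Test} {P : Program} {s : Memory} :
      ¬ b.Holds O s → Runs O (.loop b P) s s 1
  | loop_step {b : Test} {P : Program} {s s' s'' : Memory} {t t' : ℕ} :
      b.Holds O s → Runs O P s s' t → Runs O (.loop b P) s' s'' t' →
        Runs O (.loop b P) s s'' (t + t' + 1)

namespace GraphInstance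

variable (I : GraphInstance)

/-- The size of an instance. -/
def size : ℕ := I.numVertices + I.numAgents + I.numServices

/-- A function on `Fin n`, extended by `0`. -/
def table {n : ℕ} (f : Fin n → ℕ) (i : ℕ) : ℕ := if h : i < n then f ⟨i, h⟩ else 0

/-- The input: the three sizes, the owners and end points of the services, and a set `S` of
services; the distributions are accessible through the oracle only. -/
def input (S : Finset (Fin I.numServices)) : Memory where
  nat a i k :=
    if k ≠ 0 then 0 else
      match a with
      | 0 => if i = 0 then I.numVertices else if i = 1 then I.numAgents else
          if i = 2 then I.numServices else 0
      | 1 => table (fun j => (I.owner j : ℕ)) i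
      | 2 => table (fun j => (I.left j : ℕ)) i
      | 3 => table (fun j => (I.right j : ℕ)) i
      | 4 => table (fun j => if j ∈ S then 1 else 0) i
      | _ => 0
  real _ _ _ := 0

/-- On `I` with oracle `O`, the program halts after at most `T` steps; it writes the prices `p`
into the real array `0`, and into entry `0, 0` of the natural array `0` whether the set of
services that it was given belongs to `R`. -/
def Computes (O : Oracle) (P : Program) (T : ℕ) (p : Fin I.numServices → ℝ≥0)
    (R : Finset (Fin I.numServices) → Prop) : Prop :=
  ∀ S : Finset (Fin I.numServices), ∃ (s : Memory) (t : ℕ),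
    Runs O P (I.input S) s t ∧ t ≤ T ∧ (∀ j : Fin I.numServices, s.real 0 j 0 = p j) ∧
      (R S → s.nat 0 0 0 = 1) ∧ (¬ R S → s.nat 0 0 0 = 0)

end GraphInstance

end

end PostedPricing

namespace PostedPricing
namespace GraphInstance

/-! ### Forests -/

/-! The proof compares the optimum with a linear program and rounds a nearly optimal solution of
that program to posted prices.

Upper bound. In a truthful mechanism, once all values except that of `j` are fixed, `j` is sold at
one fixed price, to values not below that price. Moreover, the edges of a forest have distinct
representatives among their end points (`exists_injOn_endpoint`). Hence nonnegative prices on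
agents, vertices and services that satisfy the constraint of `optRevenue_le_ofReal` for every posted
price bound the optimum. This is weak duality for a packing program whose columns are triples of a
service, a price and an end point charged for the sale. A column loads the rows of the agent and of
the end point with the sale probability, and the row of the service with one unit. Finitely many
candidate prices suffice up to a factor `(201/200)^2` (`optRevenue_le_of_cand`), and multiplicative
weights solve the finite program up to a factor `125/128` (`PackInv.final`).

Lower bound. The solution charges every edge to one of its end points, with load at most `M` per
vertex, so within any set of vertices some vertex has degree at most `2 * M`
(`PackInv.exists_degree_le`). Peeling off such vertices orders them so that the services with a
given first end point have total probability at most `2 * M`. Sets of services with distinct first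
end points are forests (`isAcyclic_of_injOn_firstEnd`), so at most one service per agent and per
first end point is a legitimate restriction. There a service is surely sold if it is desired and no
rival is, which gives the bound `ofReal_sum_le_oblRevenue`. After scaling by `1 / (5 * M)`, the
rivals at the agent have total probability at most `1/5` and those at the vertex at most `2/5`, so
the guarantee is `1/5 * (4/5) * (3/5) * (125/128) = 3/32` of the optimum.

The scaled solution is a random choice of prices. The bound is affine in the pair of revenue and
probability of each single service (`bound_upd_affine`), so the method of conditional expectations
fixes one candidate after the other without loss.

All of this is carried out by an explicit program that is verified with a small calculus of
specifications (`Spec`). Pure existence follows by running it with any correct oracle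
(`exists_correct_oracle`). -/

/-- The edges of a forest have distinct representatives among their end points. -/
theorem exists_injOn_endpoint {V : Type*} {G : SimpleGraph V} (hG : G.IsAcyclic) :
    ∃ f : Sym2 V → V, (∀ e ∈ G.edgeSet, f e ∈ e) ∧ Set.InjOn f G.edgeSet := by
  classical
  -- Root every component. An edge is represented by its end point farther from the root; the other
  -- end point is then the parent of the representative.
  let root : V → V := fun v => (G.connectedComponentMk v).out
  have hroot : ∀ v, G.Reachable (root v) v := fun v =>
    SimpleGraph.ConnectedComponent.exact (Quot.out_eq (G.connectedComponentMk v))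
  have hadj : ∀ {u v}, G.Adj u v → root u = root v := fun {u v} h => by
    have : G.connectedComponentMk u = G.connectedComponentMk v :=
      SimpleGraph.ConnectedComponent.sound h.reachable
    simp only [root, this]
  let d : V → ℕ := fun v => G.dist (root v) v
  have hex : ∀ e : Sym2 V, ∃ v, e ∈ G.edgeSet → ∃ u, e = s(u, v) ∧ d v = d u + 1 := by
    intro e
    induction e with | _ u v =>
    by_cases h : G.Adj u v
    · have hr : root u = root v := hadj h
      rcases hG.dist_eq_dist_add_one_of_adj_of_reachable (root u) h (hroot u) with h1 | h1
      · exact ⟨u, fun _ => ⟨v, Sym2.eq_swap, by simp only [d, ← hr]; exact h1⟩⟩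
      · exact ⟨v, fun _ => ⟨u, rfl, by simp only [d, ← hr]; exact h1⟩⟩
    · exact ⟨u, fun h' => absurd h' h⟩
  choose f hf using hex
  refine ⟨f, fun e he => ?_, fun e he e' he' hee => ?_⟩
  · obtain ⟨u, h1, -⟩ := hf e he
    rw [h1]
    have : f s(u, f e) = f e := by rw [← h1]
    simp [this]
  · obtain ⟨u, h1, h2⟩ := hf e he
    obtain ⟨u', h1', h2'⟩ := hf e' he'
    rw [← hee] at h1' h2'
    -- The parent is unique. A shortest path from the root to `u` misses the deeper vertex `f e`;
    -- prolonged by the edge it is a path to `f e`, and a forest has only one.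
    have key : ∀ u, G.Adj u (f e) → d (f e) = d u + 1 →
        ∀ p : G.Walk (root (f e)) (f e), p.IsPath → u = p.penultimate := by
      intro u hu hd p hp
      obtain ⟨q, hq, hq'⟩ := (hroot u).exists_path_of_dist
      have hr := hadj hu
      have hnot : f e ∉ q.support := by
        intro hmem
        have h3 := G.dist_le (q.takeUntil _ hmem)
        have h4 := q.length_takeUntil_le_length hmem
        have : d (f e) ≤ d u := by
          simp only [d]; rw [← hr]; omega
        omega
      have hq2 := hq.concat hnot hu
      have : ∀ (r : V) (hr : r = root (f e)) (q2 : G.Walk r (f e)), q2.IsPath →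
          q2.penultimate = p.penultimate := by
        rintro r rfl q2 h2
        have := (SimpleGraph.isAcyclic_iff_subsingleton_path.1 hG _ _).elim ⟨q2, h2⟩ ⟨p, hp⟩
        rw [Subtype.mk.inj this]
      have h5 := this _ hr _ hq2
      rw [← h5, SimpleGraph.Walk.penultimate_concat]
    obtain ⟨p, hp, -⟩ := (hroot (f e)).exists_path_of_dist
    have ha : G.Adj u (f e) := by rw [h1] at he; exact he
    have ha' : G.Adj u' (f e) := by rw [h1'] at he'; exact he'
    rw [h1, h1', key u ha h2 p hp, key u' ha' h2' p hp]

/-! ### Forests obtained from an order of the vertices -/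

variable (I : GraphInstance)

/-- The end point of `j` that comes first in a linear order of the vertices. -/
def firstEnd (ord : Fin I.numVertices → ℕ) (j : Fin I.numServices) : Fin I.numVertices :=
  if ord (I.left j) < ord (I.right j) then I.left j else I.right j

/-- The lowest vertex of a cycle would be the first end point of both cycle edges at it. By
injectivity these edges coincide, whereas the two neighbours of a vertex on a cycle differ. -/
theorem isAcyclic_of_injOn_firstEnd {ord : Fin I.numVertices → ℕ} (hord : ord.Injective)
    {S : Set (Fin I.numServices)} (hS : Set.InjOn (I.firstEnd ord) S) :
    (SimpleGraph.fromEdgeSet (I.edge '' S)).IsAcyclic := by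
  intro v c hc
  obtain ⟨u, hu, hmin⟩ := Finset.exists_min_image c.support.toFinset ord
    ⟨v, by simp⟩
  have hu' : u ∈ c.support := by simpa using hu
  have hcyc := hc.rotate hu'
  set c' := c.rotate u hu' with hc'
  have hmem : ∀ w ∈ c'.support, ord u ≤ ord w := by
    intro w hw
    have := (c.mem_support_rotate_iff u hu').1 hw
    exact hmin w (by simpa using this)
  have hadj1 := c'.adj_snd hcyc.not_nil
  have hadj2 := (c'.adj_penultimate hcyc.not_nil).symm
  have key : ∀ w, (SimpleGraph.fromEdgeSet (I.edge '' S)).Adj u w → w ∈ c'.support →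
      ∃ j ∈ S, I.edge j = s(u, w) ∧ I.firstEnd ord j = u := by
    intro w hw hws
    rw [SimpleGraph.fromEdgeSet_adj] at hw
    obtain ⟨⟨j, hj, hje⟩, hne⟩ := hw
    refine ⟨j, hj, hje, ?_⟩
    have hlt : ord u < ord w := lt_of_le_of_ne (hmem w hws) fun h => hne (hord h)
    rw [edge, Sym2.eq_iff] at hje
    rcases hje with ⟨h1, h2⟩ | ⟨h1, h2⟩
    · simp [firstEnd, h1, h2, hlt]
    · simp [firstEnd, h1, h2, hlt.not_gt]
  obtain ⟨j, hj, hje, hjg⟩ := key _ hadj1 (by simp [SimpleGraph.Walk.snd, SimpleGraph.Walk.getVert_mem_support])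
  obtain ⟨k, hk, hke, hkg⟩ := key _ hadj2 (by simp [SimpleGraph.Walk.penultimate, SimpleGraph.Walk.getVert_mem_support])
  have hjk := hS hj hk (hjg.trans hkg.symm)
  rw [hjk, hke] at hje
  exact hcyc.snd_ne_penultimate (by
    rw [Sym2.eq_iff] at hje
    rcases hje with ⟨-, h⟩ | ⟨h1, h2⟩
    · exact h.symm
    · exact (h1 ▸ h2.symm ▸ rfl))

/-- Among the active services, every agent gets at most one and every vertex is the first end
point of at most one. -/
def partitionSystem (act : Fin I.numServices → Prop) (ord : Fin I.numVertices → ℕ)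
    (S : Finset (Fin I.numServices)) : Prop :=
  (∀ j ∈ S, act j) ∧ Set.InjOn I.owner S ∧ Set.InjOn (I.firstEnd ord) S

theorem isRestriction_partitionSystem (act : Fin I.numServices → Prop)
    {ord : Fin I.numVertices → ℕ} (hord : ord.Injective) :
    I.IsRestriction (I.partitionSystem act ord) where
  feasible S hS := ⟨hS.2.1, fun j hj k hk hjk => hS.2.2 hj hk (by
      rw [edge, edge, Sym2.eq_iff] at hjk
      rcases hjk with ⟨h1, h2⟩ | ⟨h1, h2⟩
      · simp [firstEnd, h1, h2]
      -- The same edge with its end points in opposite roles: since `ord` has no ties, the first end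
      -- point does not depend on the roles.
      · have hne : ord (I.left k) ≠ ord (I.right k) := fun h => (I.adj k).ne (hord h)
        simp only [firstEnd, h1, h2]
        split_ifs <;> first | rfl | omega),
    I.isAcyclic_of_injOn_firstEnd hord hS.2.2⟩
  empty := ⟨by simp, by simp, by simp⟩
  mono S T hST hT := ⟨fun j hj => hT.1 j (hST hj), hT.2.1.mono (by exact_mod_cast hST),
    hT.2.2.mono (by exact_mod_cast hST)⟩

end GraphInstance
end PostedPricing

namespace PostedPricing
namespace GraphInstance

variable (I : GraphInstance)

/-! ### Posted prices -/

section Posted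

variable {I} {p : Fin I.numServices → ℝ≥0} {R : Finset (Fin I.numServices) → Prop}

theorem mem_menu {A : Finset (Fin I.numServices)} {i : Fin I.numAgents} {j : Fin I.numServices} :
    j ∈ I.menu R A i ↔ I.owner j = i ∧ R (insert j A) := by
  simp [menu]

theorem mem_purchase {v : I.Values} {D : Finset (Fin I.numServices)} {j : Fin I.numServices} :
    j ∈ I.purchase p v D ↔ j ∈ D ∧ p j ≤ v j ∧ ∀ k ∈ D,
      (v k : ℝ) - p k < (v j : ℝ) - p j ∨ ((v k : ℝ) - p k = (v j : ℝ) - p j ∧ j ≤ k) := by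
  simp [purchase]

theorem purchase_eq_of_mem {v : I.Values} {D : Finset (Fin I.numServices)}
    {j k : Fin I.numServices} (hj : j ∈ I.purchase p v D) (hk : k ∈ I.purchase p v D) : j = k := by
  rw [mem_purchase] at hj hk
  rcases hj.2.2 k hk.1 with h | ⟨h, h'⟩ <;> rcases hk.2.2 j hj.1 with h1 | ⟨h1, h1'⟩
  · linarith
  · linarith
  · linarith
  · exact le_antisymm h' h1'

theorem purchase_nonempty {v : I.Values} {D : Finset (Fin I.numServices)} {k : Fin I.numServices}
    (hk : k ∈ D) (hkv : p k ≤ v k) : ∃ j, j ∈ I.purchase p v D := by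
  classical
  obtain ⟨j, hj, hmax⟩ := Finset.exists_max_image D (fun j => (v j : ℝ) - p j) ⟨k, hk⟩
  let D' := D.filter fun l => (v l : ℝ) - p l = (v j : ℝ) - p j
  have hne : D'.Nonempty := ⟨j, by simp [D', hj]⟩
  have hm := D'.min'_mem hne
  simp only [D', Finset.mem_filter] at hm
  refine ⟨D'.min' hne, mem_purchase.2 ⟨hm.1, ?_, fun l hl => ?_⟩⟩
  · have h1 := hmax k hk
    have h2 : (p k : ℝ) ≤ v k := by exact_mod_cast hkv
    have h3 : (p (D'.min' hne) : ℝ) ≤ v (D'.min' hne) := by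
      have := hm.2
      linarith
    exact_mod_cast h3
  · rcases (hmax l hl).lt_or_eq with h | h
    · left; rw [hm.2]; exact h
    · right
      exact ⟨by rw [hm.2]; exact h, D'.min'_le l (by simp [D', hl, h])⟩

theorem utility_le_of_mem_purchase {v : I.Values} {D : Finset (Fin I.numServices)}
    {j k : Fin I.numServices} (hj : j ∈ I.purchase p v D) (hk : k ∈ D) :
    (v k : ℝ) - p k ≤ (v j : ℝ) - p j := by
  rw [mem_purchase] at hj
  rcases hj.2.2 k hk with h | h
  · exact h.le
  · exact h.1.le

/-- The services sold, starting from the services in `A`. -/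
noncomputable def soldFrom (I : GraphInstance) (p : Fin I.numServices → ℝ≥0)
    (R : Finset (Fin I.numServices) → Prop) (A : Finset (Fin I.numServices))
    (l : List (Fin I.numAgents)) (v : I.Values) : Finset (Fin I.numServices) :=
  l.foldl (fun A i => A ∪ I.purchase p v (I.menu R A i)) A

theorem soldFrom_cons (A : Finset (Fin I.numServices)) (i : Fin I.numAgents)
    (l : List (Fin I.numAgents)) (v : I.Values) :
    I.soldFrom p R A (i :: l) v
      = I.soldFrom p R (A ∪ I.purchase p v (I.menu R A i)) l v := rfl

theorem soldFrom_append (A : Finset (Fin I.numServices)) (l l' : List (Fin I.numAgents))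
    (v : I.Values) :
    I.soldFrom p R A (l ++ l') v = I.soldFrom p R (I.soldFrom p R A l v) l' v :=
  List.foldl_append

theorem subset_soldFrom (A : Finset (Fin I.numServices)) (l : List (Fin I.numAgents))
    (v : I.Values) : A ⊆ I.soldFrom p R A l v := by
  induction l generalizing A with
  | nil => exact subset_rfl
  | cons i l ih => exact Finset.subset_union_left.trans (ih _)

theorem soldFrom_restricted {A : Finset (Fin I.numServices)} (hA : R A)
    (l : List (Fin I.numAgents)) (v : I.Values) : R (I.soldFrom p R A l v) := by
  induction l generalizing A with
  | nil => exact hA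
  | cons i l ih =>
    rw [soldFrom_cons]
    apply ih
    rcases (I.purchase p v (I.menu R A i)).eq_empty_or_nonempty with h | ⟨j, hj⟩
    · simpa [h] using hA
    · have : I.purchase p v (I.menu R A i) = {j} :=
        Finset.eq_singleton_iff_unique_mem.2 ⟨hj, fun k hk => purchase_eq_of_mem hk hj⟩
      rw [this, Finset.union_comm, ← Finset.insert_eq]
      exact (mem_menu.1 (mem_purchase.1 hj).1).2

theorem soldFrom_desired {A : Finset (Fin I.numServices)} {v : I.Values}
    (hA : ∀ j ∈ A, p j ≤ v j) (l : List (Fin I.numAgents)) :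
    ∀ j ∈ I.soldFrom p R A l v, p j ≤ v j := by
  induction l generalizing A with
  | nil => exact hA
  | cons i l ih =>
    rw [soldFrom_cons]
    apply ih
    intro j hj
    rcases Finset.mem_union.1 hj with h | h
    · exact hA j h
    · exact (mem_purchase.1 h).2.1

/-- The sold services of agents outside the list were there from the start. -/
theorem mem_of_mem_soldFrom {A : Finset (Fin I.numServices)} {v : I.Values}
    {l : List (Fin I.numAgents)} {j : Fin I.numServices} (hj : j ∈ I.soldFrom p R A l v)
    (hl : I.owner j ∉ l) : j ∈ A := by
  induction l generalizing A with
  | nil => exact hj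
  | cons i l ih =>
    rw [soldFrom_cons] at hj
    have := ih hj fun h => hl (List.mem_cons_of_mem _ h)
    rcases Finset.mem_union.1 this with h | h
    · exact h
    · exact absurd ((mem_menu.1 (mem_purchase.1 h).1).1 ▸ List.mem_cons_self) hl

/-- The outcome for agents in the list depends on their values only. -/
theorem soldFrom_congr {A : Finset (Fin I.numServices)} {v w : I.Values}
    {l : List (Fin I.numAgents)} (h : ∀ j, I.owner j ∈ l → v j = w j) :
    I.soldFrom p R A l v = I.soldFrom p R A l w := by
  induction l generalizing A with
  | nil => rfl
  | cons i l ih =>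
    rw [soldFrom_cons, soldFrom_cons]
    have : I.purchase p v (I.menu R A i) = I.purchase p w (I.menu R A i) := by
      ext j
      rw [mem_purchase, mem_purchase]
      have hval : ∀ k ∈ I.menu R A i, v k = w k := fun k hk =>
        h k (by rw [(mem_menu.1 hk).1]; exact List.mem_cons_self)
      constructor
      · rintro ⟨h1, h2, h3⟩
        refine ⟨h1, hval j h1 ▸ h2, fun k hk => ?_⟩
        rw [← hval j h1, ← hval k hk]; exact h3 k hk
      · rintro ⟨h1, h2, h3⟩
        refine ⟨h1, (hval j h1).symm ▸ h2, fun k hk => ?_⟩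
        rw [hval j h1, hval k hk]; exact h3 k hk
    rw [this]
    exact ih fun j hj => h j (List.mem_cons_of_mem _ hj)

theorem exists_split (σ : Equiv.Perm (Fin I.numAgents)) (i : Fin I.numAgents) :
    ∃ l l', List.ofFn σ = l ++ i :: l' ∧ i ∉ l ∧ i ∉ l' := by
  have hmem : i ∈ List.ofFn σ := by
    rw [List.mem_ofFn]; exact ⟨σ.symm i, by simp⟩
  obtain ⟨l, l', h⟩ := List.append_of_mem hmem
  have hnd : (List.ofFn σ).Nodup := List.nodup_ofFn.2 σ.injective
  rw [h, List.nodup_append, List.nodup_cons] at hnd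
  exact ⟨l, l', h, fun hi => hnd.2.2 i hi i List.mem_cons_self rfl, hnd.2.1.1⟩

/-- What agent `i` gets is her purchase from the menu that the agents before her leave. -/
theorem bundle_sold {σ : Equiv.Perm (Fin I.numAgents)} {i : Fin I.numAgents}
    {l l' : List (Fin I.numAgents)} (hσ : List.ofFn σ = l ++ i :: l') (hl : i ∉ l) (hl' : i ∉ l')
    (v : I.Values) :
    bundle (I.sold p R (List.ofFn σ) v) i
      = I.purchase p v (I.menu R (I.soldFrom p R ∅ l v) i) := by
  have hs : I.sold p R (List.ofFn σ) v = I.soldFrom p R (I.soldFrom p R ∅ l v ∪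
      I.purchase p v (I.menu R (I.soldFrom p R ∅ l v) i)) l' v := by
    rw [hσ, ← soldFrom_cons, ← soldFrom_append]; rfl
  ext j
  simp only [bundle, Finset.mem_filter]
  constructor
  · rintro ⟨h1, rfl⟩
    rw [hs] at h1
    rcases Finset.mem_union.1 (mem_of_mem_soldFrom h1 hl') with h | h
    · simpa using mem_of_mem_soldFrom h hl
    · exact h
  · intro h
    refine ⟨?_, (mem_menu.1 (mem_purchase.1 h).1).1⟩
    rw [hs]
    exact subset_soldFrom _ _ _ (Finset.mem_union_right _ h)

/-- Suppose a larger feasible set of desired services contains `j`. When the owner of `j` was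
approached, `j` was on her menu, because the system is downward closed. So she bought something, and
as she has only one service in the larger set, she bought `j`. -/
theorem maximalDesired_sold (hR : I.IsRestriction R) (σ : Equiv.Perm (Fin I.numAgents))
    (v : I.Values) : I.MaximalDesired p R v (I.sold p R (List.ofFn σ) v) := by
  have hs : R (I.sold p R (List.ofFn σ) v) := soldFrom_restricted hR.empty _ v
  refine ⟨⟨hs, soldFrom_desired (by simp) _⟩, fun T hT hST j hj => ?_⟩
  obtain ⟨l, l', hσ, hl, hl'⟩ := exists_split σ (I.owner j)
  have hb := bundle_sold (p := p) (R := R) hσ hl hl' v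
  have hpre : I.soldFrom p R ∅ l v ⊆ I.sold p R (List.ofFn σ) v := by
    change _ ⊆ I.soldFrom p R ∅ _ v
    rw [hσ, soldFrom_append]
    exact subset_soldFrom _ _ _
  have hjm : j ∈ I.menu R (I.soldFrom p R ∅ l v) (I.owner j) :=
    mem_menu.2 ⟨rfl, hR.mono _ T (Finset.insert_subset hj (hpre.trans hST)) hT.1⟩
  obtain ⟨k, hk⟩ := purchase_nonempty hjm (hT.2 j hj)
  rw [← hb] at hk
  simp only [bundle, Finset.mem_filter] at hk
  have := (hR.feasible T hT.1).1 (hST hk.1) hj hk.2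
  exact this ▸ hk.1

theorem sum_bundle (S : Finset (Fin I.numServices)) (f : Fin I.numServices → ℝ) :
    ∑ i, ∑ j ∈ bundle S i, f j = ∑ j ∈ S, f j :=
  Finset.sum_fiberwise S I.owner f

theorem oblRevenue_le_revenue (hR : I.IsRestriction R) (σ : Equiv.Perm (Fin I.numAgents)) :
    I.oblRevenue p R ≤ (I.postedPrice p R σ).revenue := by
  refine lintegral_mono fun v => ?_
  refine (iInf₂_le _ (maximalDesired_sold hR σ v)).trans_eq ?_
  change _ = ENNReal.ofReal (∑ i, ∑ j ∈ bundle (I.sold p R (List.ofFn σ) v) i, (p j : ℝ))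
  rw [sum_bundle, ENNReal.ofReal_sum_of_nonneg fun _ _ => NNReal.coe_nonneg _]
  simp

theorem measurableSet_purchase (D : Finset (Fin I.numServices)) (j : Fin I.numServices) :
    MeasurableSet {v : I.Values | j ∈ I.purchase p v D} := by
  simp only [mem_purchase, Set.ofPred_and]
  refine .inter (.const _) (.inter (measurableSet_le measurable_const (measurable_pi_apply j)) ?_)
  have : ∀ k : Fin I.numServices, Measurable fun v : I.Values => (v k : ℝ) - p k := fun k =>
    ((measurable_pi_apply k).coe_nnreal_real).sub_const _
  simp only [Set.ofPred_forall, Set.ofPred_or, Set.ofPred_and]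
  refine .iInter fun k => .iInter fun _ => .union (measurableSet_lt (this k) (this j)) ?_
  exact .inter (measurableSet_eq_fun (this k) (this j)) (.const _)

theorem measurableSet_finset_eq {Ω : Type*} [MeasurableSpace Ω] {ι : Type*} [Fintype ι]
    {f : Ω → Finset ι} (hf : ∀ j, MeasurableSet {v | j ∈ f v}) (B : Finset ι) :
    MeasurableSet {v | f v = B} := by
  simp only [Finset.ext_iff, Set.ofPred_forall]
  refine .iInter fun j => ?_
  by_cases h : j ∈ B
  · simpa [h] using hf j
  · simpa [h, Set.compl_ofPred] using (hf j).compl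

/-- The first agent has finitely many possible purchases `B`; on each piece where her purchase is
`B`, the rest of the run starts from a constant set. -/
theorem measurableSet_soldFrom (A : Finset (Fin I.numServices)) (l : List (Fin I.numAgents))
    (j : Fin I.numServices) : MeasurableSet {v : I.Values | j ∈ I.soldFrom p R A l v} := by
  induction l generalizing A with
  | nil => exact MeasurableSet.const (j ∈ A)
  | cons i l ih =>
    have : {v : I.Values | j ∈ I.soldFrom p R A (i :: l) v} =
        ⋃ B : Finset (Fin I.numServices), {v | I.purchase p v (I.menu R A i) = B} ∩
          {v | j ∈ I.soldFrom p R (A ∪ B) l v} := by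
      ext v
      simp [soldFrom_cons]
    rw [this]
    exact .iUnion fun B => .inter
      (measurableSet_finset_eq (fun k => measurableSet_purchase _ k) B) (ih _)

/-- Truthfulness holds because the menu of an agent is determined by the agents before her, and the
mechanism picks for her a best item of that menu at fixed prices. -/
theorem admissible_postedPrice (hR : I.IsRestriction R) (σ : Equiv.Perm (Fin I.numAgents)) :
    (I.postedPrice p R σ).Admissible where
  feasible v := hR.feasible _ (soldFrom_restricted hR.empty _ v)
  measurable_alloc j := measurableSet_soldFrom ∅ _ j
  measurable_pay i := by
    have : (fun v => (I.postedPrice p R σ).pay v i) = fun v =>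
        ∑ j, Set.indicator {v | j ∈ I.soldFrom p R ∅ (List.ofFn σ) v}
          (fun _ => if I.owner j = i then (p j : ℝ) else 0) v := by
      ext v
      change ∑ j ∈ bundle (I.sold p R (List.ofFn σ) v) i, (p j : ℝ) = _
      simp only [bundle, Finset.sum_filter, Set.indicator, Set.mem_ofPred_eq]
      rw [Finset.sum_ite_mem, Finset.univ_inter]
      rfl
    rw [this]
    exact Finset.measurable_sum _ fun j _ =>
      measurable_const.indicator (measurableSet_soldFrom ∅ _ j)
  truthful i v w h := by
    obtain ⟨l, l', hσ, hl, hl'⟩ := exists_split σ i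
    simp only [Mechanism.utility, postedPrice, bundle_sold hσ hl hl', ← Finset.sum_sub_distrib]
    -- The agents before `i` bid the same in `v` and `w`, so `i` faces one and the same menu.
    rw [soldFrom_congr (v := w) (w := v) fun j hj => h j fun hji => hl (hji ▸ hj)]
    set D := I.menu R (I.soldFrom p R ∅ l v) i
    have hsum : ∀ w : I.Values, ∑ j ∈ I.purchase p w D, ((v j : ℝ) - p j) = 0 ∨
        ∃ j ∈ I.purchase p w D, ∑ j ∈ I.purchase p w D, ((v j : ℝ) - p j) = (v j : ℝ) - p j := by
      intro w
      rcases (I.purchase p w D).eq_empty_or_nonempty with h | ⟨j, hj⟩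
      · left; simp [h]
      · right
        refine ⟨j, hj, ?_⟩
        rw [Finset.eq_singleton_iff_unique_mem.2 ⟨hj, fun k hk => purchase_eq_of_mem hk hj⟩]
        simp
    have h0 : 0 ≤ ∑ j ∈ I.purchase p v D, ((v j : ℝ) - p j) :=
      Finset.sum_nonneg fun j hj => sub_nonneg.2 (by exact_mod_cast (mem_purchase.1 hj).2.1)
    rcases hsum w with h1 | ⟨j, hj, h1⟩
    · rw [h1]; exact h0
    · rw [h1]
      have hjD := (mem_purchase.1 hj).1
      rcases hsum v with h2 | ⟨k, hk, h2⟩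
      · by_contra! hlt
        have : (p j : ℝ) ≤ v j := by linarith
        obtain ⟨k, hk⟩ := purchase_nonempty (v := v) hjD (by exact_mod_cast this)
        have h3 := utility_le_of_mem_purchase hk hjD
        rw [Finset.eq_singleton_iff_unique_mem.2 ⟨hk, fun k' hk' => purchase_eq_of_mem hk' hk⟩,
          Finset.sum_singleton] at hlt
        linarith
      · rw [h2]; exact utility_le_of_mem_purchase hk hjD
  rational v i := by
    refine ⟨?_, fun h => ?_⟩
    · simp only [Mechanism.utility, postedPrice, ← Finset.sum_sub_distrib]
      refine Finset.sum_nonneg fun j hj => sub_nonneg.2 ?_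
      have := soldFrom_desired (p := p) (R := R) (A := ∅) (v := v) (by simp) (List.ofFn σ) j
        (Finset.mem_filter.1 hj).1
      exact_mod_cast this
    · change ∑ j ∈ bundle ((I.postedPrice p R σ).alloc v) i, (p j : ℝ) = 0
      rw [h]; simp

/-- For every order the outcome is one of the maximal sets in the definition of `oblRevenue`, so a
single inequality covers all orders. -/
theorem isApproxOPM_of_oblRevenue {α : ℝ≥0∞} (hR : I.IsRestriction R)
    (h : I.optRevenue ≤ α * I.oblRevenue p R) : I.IsApproxOPM p R α where
  restriction := hR
  admissible := admissible_postedPrice hR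
  revenue σ := h.trans (mul_le_mul_right (oblRevenue_le_revenue hR σ) α)
  oblivious := h

end Posted

end GraphInstance
end PostedPricing

namespace PostedPricing
namespace GraphInstance

variable (I : GraphInstance)

/-! ### A lower bound on the order-oblivious revenue -/

/-- The services that compete with `j` for the same agent or the same first end point. -/
def rivals (ord : Fin I.numVertices → ℕ) (j : Fin I.numServices) : Finset (Fin I.numServices) :=
  {k | k ≠ j ∧ (I.owner k = I.owner j ∨ I.firstEnd ord k = I.firstEnd ord j)}

theorem acceptProb_coe (j : Fin I.numServices) (x : ℝ≥0) :
    I.acceptProb j x = (I.dist j).real (Set.Ici x) := by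
  simp only [acceptProb, NNReal.coe_le_coe]
  rfl

/-- If `j` is active and desired and no active rival is desired, then `j` can be added to any
feasible set of desired services, so it lies in every maximal one. By independence this event has
probability `q j` times the product, and the contributions `p j` of the services whose events occur
add up to at most the price of any maximal set. -/
theorem ofReal_sum_le_oblRevenue {act : Fin I.numServices → Prop} {ord : Fin I.numVertices → ℕ}
    {p : Fin I.numServices → ℝ≥0} {q : Fin I.numServices → ℝ}
    (hq : ∀ j, act j → q j = I.acceptProb j (p j)) (hq0 : ∀ j, ¬ act j → q j = 0) :
    ENNReal.ofReal (∑ j, p j * q j * ∏ k ∈ I.rivals ord j, (1 - q k)) ≤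
      I.oblRevenue p (I.partitionSystem act ord) := by
  classical
  have := I.isProb
  have hq1 : ∀ j, 0 ≤ q j ∧ q j ≤ 1 := fun j => by
    by_cases h : act j
    · rw [hq j h]; exact ⟨measureReal_nonneg, measureReal_le_one⟩
    · rw [hq0 j h]; exact ⟨le_rfl, zero_le_one⟩
  -- `Set.univ.pi (B j)` is the event in question, written as a box in order to use the product
  -- measure. Inactive services have `q = 0` and put no constraint on the values.
  let B : Fin I.numServices → Fin I.numServices → Set ℝ≥0 := fun j k =>
    if k = j then (if act j then Set.Ici (p j) else ∅)
    else if k ∈ I.rivals ord j ∧ act k then Set.Iio (p k) else Set.univ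
  have hB : ∀ j, I.law (Set.univ.pi (B j))
      = ENNReal.ofReal (q j * ∏ k ∈ I.rivals ord j, (1 - q k)) := by
    intro j
    rw [law, Measure.pi_pi, ENNReal.ofReal_mul (hq1 j).1,
      ENNReal.ofReal_prod_of_nonneg fun k _ => sub_nonneg.2 (hq1 k).2,
      ← Finset.mul_prod_erase _ _ (Finset.mem_univ j)]
    congr 1
    · by_cases h : act j
      · simp [B, h, hq j h, acceptProb_coe]
      · simp [B, h, hq0 j h]
    · rw [← Finset.prod_subset (s₁ := I.rivals ord j)
        (fun k hk => Finset.mem_erase.2 ⟨(Finset.mem_filter.1 hk).2.1, Finset.mem_univ k⟩)]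
      · refine Finset.prod_congr rfl fun k hk => ?_
        have hkj : k ≠ j := (Finset.mem_filter.1 hk).2.1
        by_cases h : act k
        · simp only [B, hkj, hk, h, if_false, if_true, and_self]
          rw [hq k h, acceptProb_coe, ← probReal_compl_eq_one_sub measurableSet_Ici,
            Set.compl_Ici, ofReal_measureReal]
        · simp [B, hkj, h, hq0 k h]
      · intro k hk hk'
        simp [B, (Finset.mem_erase.1 hk).1, hk']
  have hBm : ∀ j, MeasurableSet (Set.univ.pi (B j)) := fun j => by
    refine MeasurableSet.univ_pi fun k => ?_
    simp only [B]
    split_ifs <;> first | exact measurableSet_Ici | exact measurableSet_Iio | simp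
  calc ENNReal.ofReal (∑ j, p j * q j * ∏ k ∈ I.rivals ord j, (1 - q k))
      = ∑ j, (p j : ℝ≥0∞) * I.law (Set.univ.pi (B j)) := by
        rw [ENNReal.ofReal_sum_of_nonneg]
        · refine Finset.sum_congr rfl fun j _ => ?_
          rw [hB, mul_assoc, ENNReal.ofReal_mul (NNReal.coe_nonneg _), ENNReal.ofReal_coe_nnreal]
        · exact fun j _ => mul_nonneg (mul_nonneg (NNReal.coe_nonneg _) (hq1 j).1)
            (Finset.prod_nonneg fun k _ => sub_nonneg.2 (hq1 k).2)
    _ = ∫⁻ v, ∑ j, (Set.univ.pi (B j)).indicator (fun _ => (p j : ℝ≥0∞)) v ∂I.law := by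
        rw [lintegral_finsetSum _ fun j _ => measurable_const.indicator (hBm j)]
        simp [hBm]
    _ ≤ I.oblRevenue p (I.partitionSystem act ord) := by
        refine lintegral_mono fun v => le_iInf₂ fun S hS => ?_
        have key : ∀ j, v ∈ Set.univ.pi (B j) → j ∈ S := by
          intro j hj
          have hj1 := hj j (Set.mem_univ j)
          simp only [B, if_true] at hj1
          have hact : act j := by
            by_contra h
            simp [h] at hj1
          rw [if_pos hact] at hj1
          have hriv : ∀ k ∈ S, k ∉ I.rivals ord j := by
            intro k hk hkr
            have hk1 := hj k (Set.mem_univ k)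
            have hkj : k ≠ j := (Finset.mem_filter.1 hkr).2.1
            simp only [B, hkj, hkr, hS.1.1.1 k hk, if_false, if_true, and_self] at hk1
            exact absurd (hS.1.2 k hk) (not_le.2 hk1)
          have hins : I.partitionSystem act ord (insert j S) := by
            refine ⟨fun k hk => ?_, ?_, ?_⟩
            · rcases Finset.mem_insert.1 hk with rfl | h
              · exact hact
              · exact hS.1.1.1 k h
            · rw [Finset.coe_insert]
              by_cases hjS : j ∈ S
              · rw [Set.insert_eq_of_mem (by exact_mod_cast hjS)]; exact hS.1.1.2.1
              refine (Set.injOn_insert (by exact_mod_cast hjS)).2 ⟨hS.1.1.2.1, ?_⟩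
              rintro ⟨k, hk, hkj⟩
              refine hriv k hk (Finset.mem_filter.2 ⟨Finset.mem_univ _, ?_, Or.inl hkj⟩)
              rintro rfl; exact hjS hk
            · rw [Finset.coe_insert]
              by_cases hjS : j ∈ S
              · rw [Set.insert_eq_of_mem (by exact_mod_cast hjS)]; exact hS.1.1.2.2
              refine (Set.injOn_insert (by exact_mod_cast hjS)).2 ⟨hS.1.1.2.2, ?_⟩
              rintro ⟨k, hk, hkj⟩
              refine hriv k hk (Finset.mem_filter.2 ⟨Finset.mem_univ _, ?_, Or.inr hkj⟩)
              rintro rfl; exact hjS hk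
          refine hS.2 (y := insert j S) ⟨hins, fun k hk => ?_⟩ (Finset.subset_insert j S)
            (Finset.mem_insert_self j S)
          rcases Finset.mem_insert.1 hk with rfl | h
          · exact hj1
          · exact hS.1.2 k h
        calc ∑ j, (Set.univ.pi (B j)).indicator (fun _ => (p j : ℝ≥0∞)) v
            ≤ ∑ j, if j ∈ S then (p j : ℝ≥0∞) else 0 := by
              refine Finset.sum_le_sum fun j _ => ?_
              by_cases h : v ∈ Set.univ.pi (B j)
              · rw [Set.indicator_of_mem h, if_pos (key j h)]
              · rw [Set.indicator_of_notMem h]; exact zero_le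
          _ = ∑ j ∈ S, (p j : ℝ≥0∞) := by rw [Finset.sum_ite_mem, Finset.univ_inter]

/-! ### An upper bound on the optimal revenue -/

variable {I}

theorem Mechanism.Admissible.bundle_eq {M : I.Mechanism} (hM : M.Admissible) {v : I.Values}
    {j : Fin I.numServices} (hj : j ∈ M.alloc v) : bundle (M.alloc v) (I.owner j) = {j} := by
  refine Finset.eq_singleton_iff_unique_mem.2 ⟨by simp [bundle, hj], fun k hk => ?_⟩
  simp only [bundle, Finset.mem_filter] at hk
  exact (hM.feasible v).1 hk.1 hj hk.2

/-- The payment for a service depends on the values of the other services only. -/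
theorem Mechanism.Admissible.pay_eq {M : I.Mechanism} (hM : M.Admissible) {v w : I.Values}
    {j : Fin I.numServices} (hv : j ∈ M.alloc v) (hw : j ∈ M.alloc w)
    (h : ∀ k, k ≠ j → v k = w k) : M.pay v (I.owner j) = M.pay w (I.owner j) := by
  have h1 := hM.truthful (I.owner j) v w fun k hk => (h k fun h' => hk (h' ▸ rfl)).symm
  have h2 := hM.truthful (I.owner j) w v fun k hk => h k fun h' => hk (h' ▸ rfl)
  simp only [Mechanism.utility, hM.bundle_eq hv, hM.bundle_eq hw, Finset.sum_singleton] at h1 h2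
  linarith

theorem Mechanism.Admissible.pay_le {M : I.Mechanism} (hM : M.Admissible) {v : I.Values}
    {j : Fin I.numServices} (hv : j ∈ M.alloc v) : M.pay v (I.owner j) ≤ v j := by
  have := (hM.rational v (I.owner j)).1
  simp only [Mechanism.utility, hM.bundle_eq hv, Finset.sum_singleton] at this
  linarith

/-- Charge every edge to its representative end point; no vertex is charged twice. The minimum makes
the bound independent of which end point the forest assigns to an edge. This is how acyclicity
enters the upper bound. -/
theorem sum_min_endpoint_le {S : Finset (Fin I.numServices)} (hS : I.Feasible S)
    {μ : Fin I.numVertices → ℝ} (hμ : ∀ u, 0 ≤ μ u) :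
    ∑ j ∈ S, min (μ (I.left j)) (μ (I.right j)) ≤ ∑ u, μ u := by
  classical
  obtain ⟨f, hf, hinj⟩ := exists_injOn_endpoint hS.2.2
  have hmem : ∀ j ∈ S, I.edge j ∈
      (SimpleGraph.fromEdgeSet (I.edge '' (S : Set (Fin I.numServices)))).edgeSet := by
    intro j hj
    rw [SimpleGraph.edgeSet_fromEdgeSet]
    refine ⟨⟨j, hj, rfl⟩, ?_⟩
    simp [edge, (I.adj j).ne]
  have hinj' : Set.InjOn (fun j => f (I.edge j)) (S : Set (Fin I.numServices)) :=
    fun j hj k hk h => hS.2.1 hj hk (hinj (hmem j hj) (hmem k hk) h)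
  calc ∑ j ∈ S, min (μ (I.left j)) (μ (I.right j)) ≤ ∑ j ∈ S, μ (f (I.edge j)) := by
        refine Finset.sum_le_sum fun j hj => ?_
        have := hf _ (hmem j hj)
        rcases Sym2.mem_iff.1 this with h | h
        · rw [h]; exact min_le_left _ _
        · rw [h]; exact min_le_right _ _
    _ = ∑ u ∈ S.image fun j => f (I.edge j), μ u := (Finset.sum_image hinj').symm
    _ ≤ ∑ u, μ u := Finset.sum_le_sum_of_subset_of_nonneg (Finset.subset_univ _) fun u _ _ => hμ u

theorem sum_owner_le {S : Finset (Fin I.numServices)} (hS : I.Feasible S)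
    {l : Fin I.numAgents → ℝ} (hl : ∀ i, 0 ≤ l i) : ∑ j ∈ S, l (I.owner j) ≤ ∑ i, l i := by
  classical
  rw [← Finset.sum_image (f := l) hS.1]
  exact Finset.sum_le_sum_of_subset_of_nonneg (Finset.subset_univ _) fun i _ _ => hl i

/-- Revenue from a service, given the values of the other ones. -/
theorem Mechanism.Admissible.lintegral_pay_le {M : I.Mechanism} (hM : M.Admissible)
    (j : Fin I.numServices) {L ν : ℝ} (hL : 0 ≤ L) (hν : 0 ≤ ν)
    (h : ∀ x : ℝ, 0 ≤ x → x * I.acceptProb j x ≤ I.acceptProb j x * L + ν) (v : I.Values) :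
    ∫⁻ y, {v | j ∈ M.alloc v}.indicator (fun v => ENNReal.ofReal (M.pay v (I.owner j)))
        (Function.update v j y) ∂I.dist j ≤
      ∫⁻ y, ({v | j ∈ M.alloc v}.indicator (fun _ => ENNReal.ofReal L)
        (Function.update v j y) + ENNReal.ofReal ν) ∂I.dist j := by
  have := I.isProb j
  have hA : MeasurableSet {y : ℝ≥0 | j ∈ M.alloc (Function.update v j y)} :=
    (measurable_update v) (hM.measurable_alloc j)
  set A : Set ℝ≥0 := {y : ℝ≥0 | j ∈ M.alloc (Function.update v j y)} with hAdef
  have hind : ∀ (f : I.Values → ℝ≥0∞) y, {v | j ∈ M.alloc v}.indicator f (Function.update v j y)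
      = A.indicator (fun y => f (Function.update v j y)) y := fun f y => rfl
  simp only [hind]
  rw [lintegral_add_right _ measurable_const, lintegral_indicator_const hA, lintegral_const,
    measure_univ, mul_one]
  rcases A.eq_empty_or_nonempty with h0 | ⟨a, ha⟩
  · simp [h0]
  -- On the set `A` of winning values the payment is a constant `P`.
  set P := M.pay (Function.update v j a) (I.owner j) with hP
  have hpay : ∀ y ∈ A, M.pay (Function.update v j y) (I.owner j) = P := fun y hy =>
    hM.pay_eq hy ha fun k hk => by simp [hk]
  rw [lintegral_congr fun y => show A.indicator (fun y => ENNReal.ofReal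
      (M.pay (Function.update v j y) (I.owner j))) y = A.indicator (fun _ => ENNReal.ofReal P) y by
    by_cases hy : y ∈ A
    · simp [hy, hpay y hy]
    · simp [hy], lintegral_indicator_const hA]
  by_cases hPL : P ≤ L
  · exact le_add_right (mul_le_mul_left (ENNReal.ofReal_le_ofReal hPL) _)
  push Not at hPL
  have hP0 : 0 ≤ P := hL.trans hPL.le
  -- By individual rationality all of `A` lies above `P`. Thus for `P > L` the surplus `(P - L) * Pr
  -- A` is at most `(P - L)` times the acceptance probability of `P`, hence at most `ν`.
  have hAP : (I.dist j).real A ≤ I.acceptProb j P := by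
    refine measureReal_mono fun y hy => ?_
    have := hM.pay_le (v := Function.update v j y) hy
    rw [hpay y hy] at this
    simpa using this
  have key : P * (I.dist j).real A ≤ L * (I.dist j).real A + ν := by
    nlinarith [h P hP0, sub_nonneg.2 hPL.le]
  rw [← ofReal_measureReal (μ := I.dist j) (s := A), ← ENNReal.ofReal_mul hP0,
    ← ENNReal.ofReal_mul hL,
    ← ENNReal.ofReal_add (mul_nonneg hL measureReal_nonneg) hν]
  exact ENNReal.ofReal_le_ofReal key

/-- Weak duality: prices for agents, vertices and services bound the optimal revenue. -/
theorem optRevenue_le_ofReal {l : Fin I.numAgents → ℝ} {μ : Fin I.numVertices → ℝ}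
    {ν : Fin I.numServices → ℝ} (hl : ∀ i, 0 ≤ l i) (hμ : ∀ u, 0 ≤ μ u) (hν : ∀ j, 0 ≤ ν j)
    (h : ∀ j, ∀ x : ℝ, 0 ≤ x → x * I.acceptProb j x ≤
      I.acceptProb j x * (l (I.owner j) + min (μ (I.left j)) (μ (I.right j))) + ν j) :
    I.optRevenue ≤ ENNReal.ofReal (∑ i, l i + ∑ u, μ u + ∑ j, ν j) := by
  classical
  refine iSup₂_le fun M hM => ?_
  have := I.isProb
  set L : Fin I.numServices → ℝ := fun j => l (I.owner j) + min (μ (I.left j)) (μ (I.right j))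
  have hL : ∀ j, 0 ≤ L j := fun j => add_nonneg (hl _) (le_min (hμ _) (hμ _))
  have : IsProbabilityMeasure I.law := by unfold law; infer_instance
  let f : Fin I.numServices → I.Values → ℝ≥0∞ := fun j =>
    {v | j ∈ M.alloc v}.indicator fun v => ENNReal.ofReal (M.pay v (I.owner j))
  let g : Fin I.numServices → I.Values → ℝ≥0∞ := fun j v =>
    {v | j ∈ M.alloc v}.indicator (fun _ => ENNReal.ofReal (L j)) v + ENNReal.ofReal (ν j)
  have hf : ∀ j, Measurable (f j) := fun j =>
    (hM.measurable_pay _).ennreal_ofReal.indicator (hM.measurable_alloc j)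
  have hg1 : ∀ j, Measurable ({v | j ∈ M.alloc v}.indicator fun _ => ENNReal.ofReal (L j)) :=
    fun j => measurable_const.indicator (hM.measurable_alloc j)
  have hg : ∀ j, Measurable (g j) := fun j => (hg1 j).add_const _
  calc M.revenue ≤ ∫⁻ v, ∑ j, f j v ∂I.law := by
        refine lintegral_mono fun v => ?_
        calc ENNReal.ofReal (∑ i, M.pay v i)
            ≤ ENNReal.ofReal (∑ j ∈ M.alloc v, M.pay v (I.owner j)) := by
              refine (congrArg _ ?_).le
              rw [← sum_bundle]
              refine Finset.sum_congr rfl fun i _ => ?_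
              rcases (bundle (M.alloc v) i).eq_empty_or_nonempty with h | ⟨j, hj⟩
              · rw [h, (hM.rational v i).2 h, Finset.sum_empty]
              · obtain ⟨hj1, rfl⟩ := Finset.mem_filter.1 hj
                rw [hM.bundle_eq hj1, Finset.sum_singleton]
          _ ≤ ∑ j ∈ M.alloc v, ENNReal.ofReal (M.pay v (I.owner j)) :=
              -- Single payments may be negative, so only subadditivity of `ENNReal.ofReal` is
              -- available.
              Finset.le_sum_of_subadditive _ ENNReal.ofReal_zero.le
                (fun _ _ => ENNReal.ofReal_add_le) _ _
          _ = ∑ j, f j v := by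
              simp [f, Set.indicator_apply]
    _ = ∑ j, ∫⁻ v, f j v ∂I.law := lintegral_finsetSum _ fun j _ => hf j
    _ ≤ ∑ j, ∫⁻ v, g j v ∂I.law := by
        refine Finset.sum_le_sum fun j _ => ?_
        -- Integrate over the value of `j` first, with all other values fixed.
        refine lintegral_le_of_lmarginal_le {j} (hf j) (hg j) ?_
        rw [lmarginal_singleton, lmarginal_singleton]
        exact fun v => hM.lintegral_pay_le j (hL j) (hν j) (h j) v
    _ = ∫⁻ v, ∑ j, {v | j ∈ M.alloc v}.indicator (fun _ => ENNReal.ofReal (L j)) v ∂I.law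
          + ENNReal.ofReal (∑ j, ν j) := by
        rw [lintegral_finsetSum _ fun j _ => hg1 j, ENNReal.ofReal_sum_of_nonneg fun j _ => hν j,
          ← Finset.sum_add_distrib]
        refine Finset.sum_congr rfl fun j _ => ?_
        rw [lintegral_add_right _ measurable_const, lintegral_const, measure_univ, mul_one]
    _ ≤ ∫⁻ _, ENNReal.ofReal (∑ i, l i + ∑ u, μ u) ∂I.law + ENNReal.ofReal (∑ j, ν j) := by
        refine add_le_add_left (lintegral_mono fun v => ?_) _
        calc ∑ j, {v | j ∈ M.alloc v}.indicator (fun _ => ENNReal.ofReal (L j)) v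
            = ∑ j ∈ M.alloc v, ENNReal.ofReal (L j) := by
              simp [Set.indicator_apply]
          _ = ENNReal.ofReal (∑ j ∈ M.alloc v, L j) :=
              (ENNReal.ofReal_sum_of_nonneg fun j _ => hL j).symm
          _ ≤ _ := by
              refine ENNReal.ofReal_le_ofReal ?_
              rw [Finset.sum_add_distrib]
              exact add_le_add (sum_owner_le (hM.feasible v) hl)
                (sum_min_endpoint_le (hM.feasible v) hμ)
    _ = ENNReal.ofReal (∑ i, l i + ∑ u, μ u + ∑ j, ν j) := by
        rw [lintegral_const, measure_univ, mul_one, ← ENNReal.ofReal_add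
          (add_nonneg (Finset.sum_nonneg fun i _ => hl i) (Finset.sum_nonneg fun u _ => hμ u))
          (Finset.sum_nonneg fun j _ => hν j)]

end GraphInstance
end PostedPricing

namespace PostedPricing

/-! ### Candidate prices -/

/-- The finitely many prices that are considered for service `j` when there are `m` services:
the upper quantiles for multiples of `1 / (40000 m)`, and one price for the tail. Index `0`
stands for not selling the service at all. -/
noncomputable def Oracle.candPrice (O : Oracle) (m j k : ℕ) : ℝ :=
  if k = 0 then 0
  else if k ≤ 40000 * m then O.quantile j (k / (40000 * m))
  else O.bestPrice j (201 / 200 * O.quantile j (1 / (200 * m))) (1 / 200)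

/-- The probability that service `j` is desired at candidate price `k`. -/
noncomputable def Oracle.candProb (O : Oracle) (m j k : ℕ) : ℝ :=
  if k = 0 then 0 else O.accept j (O.candPrice m j k)

namespace GraphInstance

variable {I : GraphInstance}

theorem acceptProb_nonneg (j : Fin I.numServices) (x : ℝ) : 0 ≤ I.acceptProb j x :=
  measureReal_nonneg

theorem acceptProb_le_one (j : Fin I.numServices) (x : ℝ) : I.acceptProb j x ≤ 1 := by
  have := I.isProb j
  exact measureReal_le_one

theorem acceptProb_antitone (j : Fin I.numServices) : Antitone (I.acceptProb j) := by
  have := I.isProb j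
  intro x y hxy
  exact measureReal_mono fun z (hz : y ≤ (z : ℝ)) => hxy.trans hz

theorem acceptProb_of_nonpos (j : Fin I.numServices) {x : ℝ} (hx : x ≤ 0) :
    I.acceptProb j x = 1 := by
  have := I.isProb j
  have : {y : ℝ≥0 | x ≤ (y : ℝ)} = Set.univ := by
    exact Set.eq_univ_of_forall fun y => hx.trans y.2
  rw [acceptProb, this, probReal_univ]

variable {O : Oracle}

theorem quantile_nonneg (hO : O.Correct I) (j : Fin I.numServices) {a : ℝ} (ha : 0 < a)
    (ha1 : a ≤ 1) : 0 ≤ O.quantile j a :=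
  (hO.quantile j a ha ha1).2 (show a ≤ I.acceptProb j 0 by rwa [acceptProb_of_nonpos j le_rfl])

theorem candPrice_nonneg (hO : O.Correct I) (j : Fin I.numServices) (k : ℕ) :
    0 ≤ O.candPrice I.numServices j k := by
  have hm : (1 : ℝ) ≤ I.numServices := by exact_mod_cast j.pos
  unfold Oracle.candPrice
  split_ifs with h0 h1
  · exact le_rfl
  · have hk : (0 : ℝ) < k := by exact_mod_cast Nat.pos_of_ne_zero h0
    refine quantile_nonneg hO j (by positivity) ?_
    rw [div_le_one (by positivity)]
    exact_mod_cast h1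
  · have h2 : 0 ≤ O.quantile j (1 / (200 * I.numServices)) := by
      refine quantile_nonneg hO j (by positivity) ?_
      rw [div_le_one (by positivity)]
      linarith
    have h3 : 0 ≤ 201 / 200 * O.quantile j (1 / (200 * I.numServices)) := by positivity
    exact h3.trans (hO.bestPrice j _ (1 / 200) h3 (by norm_num)).1

theorem candProb_eq (hO : O.Correct I) (j : Fin I.numServices) {k : ℕ} (hk : k ≠ 0) :
    O.candProb I.numServices j k = I.acceptProb j (O.candPrice I.numServices j k) := by
  rw [Oracle.candProb, if_neg hk, hO.accept]

theorem candProb_nonneg (hO : O.Correct I) (j : Fin I.numServices) (k : ℕ) :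
    0 ≤ O.candProb I.numServices j k := by
  by_cases hk : k = 0
  · simp [Oracle.candProb, hk]
  · rw [candProb_eq hO j hk]; exact acceptProb_nonneg _ _

theorem candProb_le_one (hO : O.Correct I) (j : Fin I.numServices) (k : ℕ) :
    O.candProb I.numServices j k ≤ 1 := by
  by_cases hk : k = 0
  · simp [Oracle.candProb, hk]
  · rw [candProb_eq hO j hk]; exact acceptProb_le_one _ _

/-- The candidate prices approximate all prices. -/
theorem mul_acceptProb_le (hO : O.Correct I) (j : Fin I.numServices) {ρ L ν : ℝ} (hρ : 0 ≤ ρ)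
    (hL : 0 ≤ L) (hν : 0 ≤ ν)
    (h : ∀ k ≤ 40000 * I.numServices + 1,
      O.candPrice I.numServices j k * O.candProb I.numServices j k ≤
        ρ * (O.candProb I.numServices j k * L + ν)) (x : ℝ) :
    x * I.acceptProb j x ≤
      201 / 200 * ρ * ((I.acceptProb j x + 1 / (200 * I.numServices)) * L + ν) := by
  set m : ℝ := (I.numServices : ℝ) with hm'
  have hm : (1 : ℝ) ≤ m := by rw [hm']; exact_mod_cast j.pos
  set δ : ℝ := 1 / (200 * m) with hδ
  have hδ0 : 0 < δ := by positivity
  have hδ1 : δ ≤ 1 := by rw [hδ, div_le_one (by positivity)]; linarith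
  set q := I.acceptProb j x with hq
  have hq0 : 0 ≤ q := acceptProb_nonneg _ _
  have hq1 : q ≤ 1 := acceptProb_le_one _ _
  -- the condition for a quantile
  have hquant : ∀ k : ℕ, 1 ≤ k → k ≤ 40000 * I.numServices → ∀ z,
      z = O.quantile j (k / (40000 * m)) → z * I.acceptProb j z ≤ ρ * (I.acceptProb j z * L + ν) ∧
        (k / (40000 * m) : ℝ) ≤ I.acceptProb j z ∧ 0 ≤ z ∧
        ∀ y, k / (40000 * m) ≤ I.acceptProb j y → y ≤ z := by
    rintro k hk1 hk2 z rfl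
    have h1 := h k (by omega)
    rw [candProb_eq hO j (by omega)] at h1
    have hp : O.candPrice I.numServices j k = O.quantile j (k / (40000 * m)) := by
      rw [Oracle.candPrice, if_neg (by omega), if_pos hk2]
    rw [hp] at h1
    have ha0 : (0 : ℝ) < k / (40000 * m) := by
      have : (0 : ℝ) < k := by exact_mod_cast hk1
      positivity
    have ha1 : (k : ℝ) / (40000 * m) ≤ 1 := by
      rw [div_le_one (by positivity)]
      have : (k : ℝ) ≤ ((40000 * I.numServices : ℕ) : ℝ) := by exact_mod_cast hk2
      simpa using this
    have hgr := hO.quantile j _ ha0 ha1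
    exact ⟨h1, hgr.1, quantile_nonneg hO j ha0 ha1, fun y hy => hgr.2 hy⟩
  rcases le_or_gt δ q with hqδ | hqδ
  · -- prices that are likely to be accepted
    have hN : 0 < 40000 * m := by positivity
    obtain ⟨k, hk⟩ : ∃ k : ℕ, k = ⌊q * (40000 * m)⌋₊ := ⟨_, rfl⟩
    have hqN : 0 ≤ q * (40000 * m) := by positivity
    have hk1 : (k : ℝ) ≤ q * (40000 * m) := hk ▸ Nat.floor_le hqN
    have hk2 : q * (40000 * m) < k + 1 := hk ▸ Nat.lt_floor_add_one _
    -- The threshold `δ` is 200 steps of the grid, so rounding `q` down to the grid changes it by a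
    -- factor of at most `201/200`.
    have hk3 : 200 ≤ k := by
      rw [hk]
      refine Nat.le_floor ?_
      have : δ * (40000 * m) = 200 := by rw [hδ]; field_simp; norm_num
      push_cast
      nlinarith
    have hk4 : k ≤ 40000 * I.numServices := by
      have : (k : ℝ) ≤ ((40000 * I.numServices : ℕ) : ℝ) := by
        push_cast
        rw [← hm']
        nlinarith
      exact_mod_cast this
    obtain ⟨h1, h2, h3, h4⟩ := hquant k (by omega) hk4 _ rfl
    set z := O.quantile j (k / (40000 * m))
    have hxz : x ≤ z := h4 x (by rw [div_le_iff₀ hN]; exact hk1)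
    have hqz : I.acceptProb j z ≤ q := acceptProb_antitone j hxz
    have h5 : q ≤ 201 / 200 * I.acceptProb j z := by
      have : q ≤ (k + 1) / (40000 * m) := by rw [le_div_iff₀ hN]; exact hk2.le
      have h6 : ((k : ℝ) + 1) / (40000 * m) ≤ 201 / 200 * (k / (40000 * m)) := by
        rw [← mul_div_assoc, div_le_div_iff_of_pos_right hN]
        have : (200 : ℝ) ≤ k := by exact_mod_cast hk3
        linarith
      linarith
    calc x * q ≤ z * (201 / 200 * I.acceptProb j z) := mul_le_mul hxz h5 hq0 h3
      _ = 201 / 200 * (z * I.acceptProb j z) := by ring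
      _ ≤ 201 / 200 * (ρ * (I.acceptProb j z * L + ν)) := by linarith
      _ ≤ 201 / 200 * (ρ * ((q + δ) * L + ν)) := by
          gcongr
          linarith
      _ = _ := by ring
  · have h200 : 200 ≤ 40000 * I.numServices := by have := j.pos; omega
    have hδ' : ((200 : ℕ) : ℝ) / (40000 * m) = δ := by rw [hδ]; field_simp; norm_num
    obtain ⟨h1, h2, h3, h4⟩ := hquant 200 (by norm_num) h200 (O.quantile j δ) (by rw [hδ'])
    rw [hδ'] at h2 h4
    set z := O.quantile j δ
    have hzx : z < x := by
      by_contra! hxz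
      exact absurd (h2.trans (acceptProb_antitone j hxz)) (not_le.2 hqδ)
    rcases le_or_gt x (201 / 200 * z) with hx2 | hx2
    · -- prices just above the quantile
      set a := I.acceptProb j z
      have ha : 0 < a := hδ0.trans_le h2
      have hqa : q ≤ a := hqδ.le.trans h2
      -- Sell at the quantile `z`, but only with probability `q / a`: the constraint at `z` scales
      -- down, and `ν` need not be scaled.
      have h5 : z * q ≤ ρ * (q * L + ν) := by
        have h6 : z * q * a ≤ ρ * (q * L + ν) * a := by
          calc z * q * a = q * (z * a) := by ring
            _ ≤ q * (ρ * (a * L + ν)) := by gcongr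
            _ = ρ * (q * L) * a + ρ * ν * q := by ring
            _ ≤ ρ * (q * L) * a + ρ * ν * a := by gcongr
            _ = _ := by ring
        exact le_of_mul_le_mul_right h6 ha
      calc x * q ≤ 201 / 200 * z * q := by gcongr
        _ = 201 / 200 * (z * q) := by ring
        _ ≤ 201 / 200 * (ρ * (q * L + ν)) := by linarith
        _ ≤ 201 / 200 * (ρ * ((q + δ) * L + ν)) := by
          gcongr
          linarith
        _ = _ := by ring
    · -- prices in the tail
      obtain ⟨h5, h6⟩ := hO.bestPrice j (201 / 200 * z) (1 / 200) (by positivity) (by norm_num)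
      have h7 := h (40000 * I.numServices + 1) le_rfl
      rw [candProb_eq hO j (by omega)] at h7
      have hp : O.candPrice I.numServices j (40000 * I.numServices + 1)
          = O.bestPrice j (201 / 200 * z) (1 / 200) := by
        rw [Oracle.candPrice, if_neg (by omega), if_neg (by omega)]
      rw [hp] at h7
      have h8 := h6 x hx2.le
      set y := O.bestPrice j (201 / 200 * z) (1 / 200)
      have hy0 : 0 ≤ y := le_trans (by positivity) h5
      have hstep : y * I.acceptProb j y ≤ ρ * ((q + δ) * L + ν) := by
        -- The tail starts at `201/200 * z` so that its prices lie strictly above `z`, where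
        -- acceptance is less likely than `δ`. The exception is `z = 0`, where `y = z` is possible,
        -- but then `y` earns nothing.
        rcases le_or_gt y z with hyz | hyz
        · have : y = 0 := by linarith
          rw [this, zero_mul]
          positivity
        · have hyδ : I.acceptProb j y < δ := by
            by_contra! hge
            exact absurd (h4 y hge) (not_le.2 hyz)
          refine h7.trans ?_
          gcongr
          linarith
      calc x * q ≤ (1 + 1 / 200) * (y * I.acceptProb j y) := h8
        _ ≤ (1 + 1 / 200) * (ρ * ((q + δ) * L + ν)) := by linarith
        _ = _ := by ring

/-- Weak duality in terms of the candidate prices. -/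
theorem optRevenue_le_of_cand (hO : O.Correct I) {ρ : ℝ} (hρ : 0 ≤ ρ) {l : Fin I.numAgents → ℝ}
    {μ : Fin I.numVertices → ℝ} {ν : Fin I.numServices → ℝ} (hl : ∀ i, 0 ≤ l i)
    (hμ : ∀ u, 0 ≤ μ u) (hν : ∀ j, 0 ≤ ν j)
    (h : ∀ j : Fin I.numServices, ∀ k ≤ 40000 * I.numServices + 1, ∀ u ∈ I.edge j,
      O.candPrice I.numServices j k * O.candProb I.numServices j k ≤
        ρ * (O.candProb I.numServices j k * (l (I.owner j) + μ u) + ν j)) :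
    I.optRevenue ≤
      ENNReal.ofReal ((201 / 200) ^ 2 * ρ * (∑ i, l i + ∑ u, μ u + ∑ j, ν j)) := by
  set L : Fin I.numServices → ℝ := fun j => l (I.owner j) + min (μ (I.left j)) (μ (I.right j))
    with hLdef
  have hL : ∀ j, 0 ≤ L j := fun j => add_nonneg (hl _) (le_min (hμ _) (hμ _))
  have hm0 : (0 : ℝ) ≤ I.numServices := Nat.cast_nonneg _
  set c : ℝ := 201 / 200 * ρ with hc
  have hc0 : 0 ≤ c := by positivity
  -- The additive error `1 / (200 * m) * L j` of the discretization goes into the price of service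
  -- `j`.
  refine (optRevenue_le_ofReal (l := fun i => c * l i) (μ := fun u => c * μ u)
    (ν := fun j => c * (ν j + 1 / (200 * I.numServices) * L j)) (fun i => mul_nonneg hc0 (hl i))
    (fun u => mul_nonneg hc0 (hμ u))
    (fun j => mul_nonneg hc0 (add_nonneg (hν j) (mul_nonneg (by positivity) (hL j)))) ?_).trans ?_
  · intro j x _
    rw [← mul_min_of_nonneg _ _ hc0]
    have hk : ∀ k ≤ 40000 * I.numServices + 1,
        O.candPrice I.numServices j k * O.candProb I.numServices j k ≤
          ρ * (O.candProb I.numServices j k * L j + ν j) := by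
      intro k hk
      rcases min_choice (μ (I.left j)) (μ (I.right j)) with h' | h'
      · simp only [hLdef, h']; exact h j k hk _ (by simp [edge])
      · simp only [hLdef, h']; exact h j k hk _ (by simp [edge])
    refine (mul_acceptProb_le hO j hρ (hL j) (hν j) hk x).trans_eq ?_
    simp only [hLdef]
    ring
  · refine ENNReal.ofReal_le_ofReal ?_
    simp only [← Finset.mul_sum, Finset.sum_add_distrib]
    set D := ∑ i, l i + ∑ u, μ u with hD
    have hD0 : 0 ≤ D := add_nonneg (Finset.sum_nonneg fun i _ => hl i)
      (Finset.sum_nonneg fun u _ => hμ u)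
    have hν0 : 0 ≤ ∑ j, ν j := Finset.sum_nonneg fun j _ => hν j
    have hLD : ∀ j, L j ≤ D := fun j => add_le_add
      (Finset.single_le_sum (fun i _ => hl i) (Finset.mem_univ (I.owner j)))
      ((min_le_left _ _).trans
        (Finset.single_le_sum (fun u _ => hμ u) (Finset.mem_univ (I.left j))))
    have hsum : ∑ j, L j ≤ I.numServices * D := by
      refine (Finset.sum_le_sum fun j _ => hLD j).trans_eq ?_
      simp
    -- The `m` additive errors together cost at most `D / 200`; this is the second factor `201/200`.
    have h1 : 1 / (200 * (I.numServices : ℝ)) * ∑ j, L j ≤ 1 / 200 * D := by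
      rcases Nat.eq_zero_or_pos I.numServices with h0 | h0
      · have h0' : (I.numServices : ℝ) = 0 := by exact_mod_cast h0
        simp only [h0', mul_zero, div_zero, zero_mul]
        positivity
      · have h0' : (0 : ℝ) < I.numServices := by exact_mod_cast h0
        calc 1 / (200 * (I.numServices : ℝ)) * ∑ j, L j
            ≤ 1 / (200 * (I.numServices : ℝ)) * (I.numServices * D) := by gcongr
          _ = 1 / 200 * D := by field_simp
    calc c * ∑ i, l i + c * ∑ u, μ u + c * (∑ j, ν j + 1 / (200 * I.numServices) * ∑ j, L j)
        = c * (D + ∑ j, ν j + 1 / (200 * I.numServices) * ∑ j, L j) := by rw [hD]; ring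
      _ ≤ c * (201 / 200 * (D + ∑ j, ν j)) := by
          refine mul_le_mul_of_nonneg_left ?_ hc0
          linarith
      _ = _ := by rw [hc]; ring

/-! ### Correct oracles exist -/

/-- The mechanism that offers a single service at a fixed price. -/
theorem mul_acceptProb_le_optRevenue (j : Fin I.numServices) (x : ℝ≥0) :
    ENNReal.ofReal (x * I.acceptProb j x) ≤ I.optRevenue := by
  classical
  have := I.isProb
  let p : Fin I.numServices → ℝ≥0 := fun _ => x
  let ord : Fin I.numVertices → ℕ := fun u => u
  have hord : ord.Injective := Fin.val_injective
  have hR := I.isRestriction_partitionSystem (fun k => k = j) hord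
  have h1 := I.ofReal_sum_le_oblRevenue (act := fun k => k = j) (ord := ord) (p := p)
    (q := fun k => if k = j then I.acceptProb j x else 0)
    (by rintro k rfl; simp [p]) (by intro k hk; simp [hk])
  refine le_trans ?_ (h1.trans ((oblRevenue_le_revenue hR 1).trans
    (le_iSup₂_of_le _ (admissible_postedPrice hR 1) le_rfl)))
  refine ENNReal.ofReal_le_ofReal ?_
  rw [Finset.sum_eq_single j (by intro k _ hk; simp [hk]) (by simp)]
  have : ∏ k ∈ I.rivals ord j, (1 - if k = j then I.acceptProb j x else 0) = 1 :=
    Finset.prod_eq_one fun k hk => by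
      have : k ≠ j := (Finset.mem_filter.1 hk).2.1
      simp [this]
  rw [this]
  simp [p]

/-- The acceptance probability tends to `0` at infinity, so the set is bounded. It is continuous
along increasing sequences of prices, so the supremum belongs to the set. -/
theorem exists_isGreatest_quantile (j : Fin I.numServices) {a : ℝ} (ha : 0 < a) (ha1 : a ≤ 1) :
    ∃ z, IsGreatest {x : ℝ | a ≤ I.acceptProb j x} z := by
  have hprob := I.isProb j
  have hne : (0 : ℝ) ∈ {x : ℝ | a ≤ I.acceptProb j x} := by
    show a ≤ _; rwa [acceptProb_of_nonpos j le_rfl]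
  have hlim : ∀ (s : ℕ → ℝ), Monotone s → Filter.Tendsto (fun n => I.acceptProb j (s n))
      Filter.atTop (nhds ((I.dist j).real (⋂ n, {y : ℝ≥0 | s n ≤ (y : ℝ)}))) := by
    intro s hs
    refine (ENNReal.tendsto_toReal (measure_ne_top _ _)).comp
      (tendsto_measure_iInter_atTop (fun n => ?_) (fun m n hmn y (hy : s n ≤ y) =>
      (hs hmn).trans hy) ⟨0, measure_ne_top _ _⟩)
    exact (measurableSet_le measurable_const measurable_coe_nnreal_real).nullMeasurableSet
  have hbdd : BddAbove {x : ℝ | a ≤ I.acceptProb j x} := by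
    have h1 := hlim (fun n => n) Nat.mono_cast
    have h2 : (⋂ n : ℕ, {y : ℝ≥0 | (n : ℝ) ≤ (y : ℝ)}) = ∅ := by
      ext y
      simp only [Set.mem_iInter, Set.mem_ofPred_eq, Set.mem_empty_iff_false, iff_false, not_forall,
        not_le]
      exact exists_nat_gt _
    rw [h2, measureReal_empty] at h1
    obtain ⟨n, hn⟩ := (h1.eventually (gt_mem_nhds ha)).exists
    refine ⟨n, fun x (hx : a ≤ _) => ?_⟩
    by_contra! h
    exact absurd (hx.trans (acceptProb_antitone j h.le)) (not_le.2 hn)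
  refine ⟨sSup {x : ℝ | a ≤ I.acceptProb j x}, ?_, fun x hx => le_csSup hbdd hx⟩
  set z := sSup {x : ℝ | a ≤ I.acceptProb j x}
  obtain ⟨u, hu1, hu2, hu3⟩ := exists_seq_tendsto_sSup ⟨0, hne⟩ hbdd
  have h1 := hlim u hu1
  have h2 : (⋂ n : ℕ, {y : ℝ≥0 | u n ≤ (y : ℝ)}) = {y : ℝ≥0 | z ≤ (y : ℝ)} := by
    ext y
    simp only [Set.mem_iInter, Set.mem_ofPred_eq]
    exact ⟨fun h => le_of_tendsto' hu2 h, fun h n => (le_csSup hbdd (hu3 n)).trans h⟩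
  rw [h2] at h1
  exact ge_of_tendsto' h1 hu3

/-- Selling one service alone at a posted price is a mechanism, so the revenue curve is bounded by
the finite optimum. A positive supremum is almost attained, and if the supremum is `0`, then `x`
will do. -/
theorem exists_bestPrice (hI : I.optRevenue ≠ ⊤) (j : Fin I.numServices) {x ε : ℝ} (hx : 0 ≤ x)
    (hε : 0 < ε) : ∃ z, x ≤ z ∧ ∀ y, x ≤ y → y * I.acceptProb j y ≤
      (1 + ε) * (z * I.acceptProb j z) := by
  set A : Set ℝ := (fun y => y * I.acceptProb j y) '' Set.Ici x
  have hA : BddAbove A := by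
    refine ⟨I.optRevenue.toReal, ?_⟩
    rintro _ ⟨y, hy : x ≤ y, rfl⟩
    have h1 := mul_acceptProb_le_optRevenue j (⟨y, hx.trans hy⟩ : ℝ≥0)
    have h2 := (ENNReal.ofReal_le_iff_le_toReal hI).1 h1
    exact h2
  have hmem : x * I.acceptProb j x ∈ A := ⟨x, Set.self_mem_Ici, rfl⟩
  have h0 : 0 ≤ sSup A := (mul_nonneg hx (acceptProb_nonneg _ _)).trans (le_csSup hA hmem)
  rcases h0.eq_or_lt with h | h
  · refine ⟨x, le_rfl, fun y hy => (le_csSup hA ⟨y, hy, rfl⟩).trans ?_⟩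
    rw [← h]
    exact mul_nonneg (by linarith) (mul_nonneg hx (acceptProb_nonneg _ _))
  · have hlt : sSup A / (1 + ε) < sSup A := div_lt_self h (by linarith)
    obtain ⟨_, ⟨z, hz, rfl⟩, hz2⟩ := exists_lt_of_lt_csSup ⟨_, hmem⟩ hlt
    refine ⟨z, hz, fun y hy => (le_csSup hA ⟨y, hy, rfl⟩).trans ?_⟩
    rw [div_lt_iff₀ (by linarith)] at hz2
    simp only at hz2
    linarith

/-- This makes the existence part of the theorem a consequence of the algorithm. -/
theorem exists_correct_oracle (hI : I.optRevenue ≠ ⊤) : ∃ O : Oracle, O.Correct I := by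
  classical
  have hq : ∀ (j : ℕ) (a : ℝ), ∃ z, ∀ h : j < I.numServices, 0 < a → a ≤ 1 →
      IsGreatest {x : ℝ | a ≤ I.acceptProb ⟨j, h⟩ x} z := by
    intro j a
    by_cases h : j < I.numServices ∧ 0 < a ∧ a ≤ 1
    · obtain ⟨z, hz⟩ := exists_isGreatest_quantile ⟨j, h.1⟩ h.2.1 h.2.2
      exact ⟨z, fun _ _ _ => hz⟩
    · exact ⟨0, fun h1 h2 h3 => absurd ⟨h1, h2, h3⟩ h⟩
  have hb : ∀ (j : ℕ) (x ε : ℝ), ∃ z, ∀ h : j < I.numServices, 0 ≤ x → 0 < ε →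
      x ≤ z ∧ ∀ y, x ≤ y → y * I.acceptProb ⟨j, h⟩ y ≤
        (1 + ε) * (z * I.acceptProb ⟨j, h⟩ z) := by
    intro j x ε
    by_cases h : j < I.numServices ∧ 0 ≤ x ∧ 0 < ε
    · obtain ⟨z, hz⟩ := exists_bestPrice hI ⟨j, h.1⟩ h.2.1 h.2.2
      exact ⟨z, fun _ _ _ => hz⟩
    · exact ⟨0, fun h1 h2 h3 => absurd ⟨h1, h2, h3⟩ h⟩
  choose quantile hquantile using hq
  choose best hbest using hb
  refine ⟨⟨fun j x => if h : j < I.numServices then I.acceptProb ⟨j, h⟩ x else 0, quantile, best⟩,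
    fun j x => by simp, fun j a h1 h2 => hquantile j a j.2 h1 h2,
    fun j x ε h1 h2 => hbest j x ε j.2 h1 h2⟩

end GraphInstance
end PostedPricing

namespace PostedPricing

/-! ### Fractional packing by multiplicative weights -/

/-- Change one entry of a two-dimensional array. -/
def upd {α : Type*} (f : ℕ → ℕ → α) (i k : ℕ) (x : α) : ℕ → ℕ → α :=
  fun i' k' => if i' = i ∧ k' = k then x else f i' k'

@[simp] theorem upd_self {α : Type*} (f : ℕ → ℕ → α) (i k : ℕ) (x : α) : upd f i k x i k = x := by
  simp [upd]

theorem upd_ne {α : Type*} (f : ℕ → ℕ → α) {i k i' k' : ℕ} (x : α) (h : ¬(i' = i ∧ k' = k)) :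
    upd f i k x i' k' = f i' k' := by
  simp [upd, h]

/-- The combinatorial data of an instance with finitely many candidate prices: `w j k` and `q j k`
are the expected revenue from service `j` and the probability of a sale at candidate price `k`,
and `opt` is bounded by weak duality. -/
structure Tables where
  m : ℕ
  n : ℕ
  V : ℕ
  K : ℕ
  own : ℕ → ℕ
  lft : ℕ → ℕ
  rgt : ℕ → ℕ
  w : ℕ → ℕ → ℝ
  q : ℕ → ℕ → ℝ
  opt : ℝ

namespace Tables

/-- The total length of all rows: agents (`0`), vertices (`1`) and services (`2`). -/
def total (D : Tables) (len : ℕ → ℕ → ℝ) : ℝ :=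
  ∑ i ∈ Finset.range D.n, len i 0 + ∑ u ∈ Finset.range D.V, len u 1 +
    ∑ j ∈ Finset.range D.m, len j 2

/-- The length of the column that assigns service `j` at price `k` to its end point `u`. -/
def cost (D : Tables) (len : ℕ → ℕ → ℝ) (j k u : ℕ) : ℝ :=
  D.q j k * (len (D.own j) 0 + len u 1) + len j 2

/-- The rows that exist. -/
def IsRow (D : Tables) (r c : ℕ) : Prop :=
  (c = 0 ∧ r < D.n) ∨ (c = 1 ∧ r < D.V) ∨ (c = 2 ∧ r < D.m)

/-- Through `dual`, weak duality on the finitely many columns, the analysis of the algorithm gets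
all that it needs to know about optimal mechanisms. Candidate `0`, with zero revenue and
probability, is the option of not selling. -/
structure Valid (D : Tables) : Prop where
  own_lt : ∀ j < D.m, D.own j < D.n
  lft_lt : ∀ j < D.m, D.lft j < D.V
  rgt_lt : ∀ j < D.m, D.rgt j < D.V
  ne : ∀ j < D.m, D.lft j ≠ D.rgt j
  K_pos : 0 < D.K
  w_nonneg : ∀ j < D.m, ∀ k < D.K, 0 ≤ D.w j k
  q_nonneg : ∀ j < D.m, ∀ k < D.K, 0 ≤ D.q j k
  q_le_one : ∀ j < D.m, ∀ k < D.K, D.q j k ≤ 1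
  w_zero : ∀ j < D.m, D.w j 0 = 0
  q_zero : ∀ j < D.m, D.q j 0 = 0
  opt_nonneg : 0 ≤ D.opt
  dual : ∀ (ρ : ℝ) (len : ℕ → ℕ → ℝ), 0 ≤ ρ → (∀ r c, 0 ≤ len r c) →
    (∀ j < D.m, ∀ k < D.K, ∀ u, u = D.lft j ∨ u = D.rgt j →
      D.w j k ≤ ρ * D.cost len j k u) →
    D.opt ≤ (201 / 200) ^ 2 * ρ * D.total len

variable {D : Tables}

theorem total_upd {len : ℕ → ℕ → ℝ} {r c : ℕ} (h : D.IsRow r c) (x : ℝ) :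
    D.total (upd len r c (len r c + x)) = D.total len + x := by
  have key : ∀ N, r < N → ∀ c', ∑ i ∈ Finset.range N, upd len r c (len r c + x) i c' =
      ∑ i ∈ Finset.range N, len i c' + if c' = c then x else 0 := by
    intro N hN c'
    by_cases hc : c' = c
    · subst hc
      rw [if_pos rfl, ← Finset.add_sum_erase _ _ (Finset.mem_range.2 hN),
        ← Finset.add_sum_erase _ (fun i => len i c') (Finset.mem_range.2 hN), upd_self]
      rw [Finset.sum_congr rfl fun i hi => upd_ne len _ fun h => (Finset.mem_erase.1 hi).1 h.1]
      ring
    · rw [if_neg hc, add_zero]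
      exact Finset.sum_congr rfl fun i _ => upd_ne len _ fun h => hc h.2
  have key' : ∀ N c', c' ≠ c → ∑ i ∈ Finset.range N, upd len r c (len r c + x) i c' =
      ∑ i ∈ Finset.range N, len i c' := fun N c' hc =>
    Finset.sum_congr rfl fun i _ => upd_ne len _ fun h => hc h.2
  rcases h with ⟨rfl, h⟩ | ⟨rfl, h⟩ | ⟨rfl, h⟩
  · simp only [total, key _ h, key' _ 1 (by norm_num), key' _ 2 (by norm_num), if_true]; ring
  · simp only [total, key _ h, key' _ 0 (by norm_num), key' _ 2 (by norm_num), if_true]; ring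
  · simp only [total, key _ h, key' _ 0 (by norm_num), key' _ 1 (by norm_num), if_true]; ring

/-- Lengths grow exponentially in the loads, and `M` is the maximal load. -/
structure RowInv (D : Tables) (len load : ℕ → ℕ → ℝ) (M : ℝ) : Prop where
  one_le : ∀ r c, 1 ≤ len r c
  log_ge : ∀ r c, load r c / 201 ≤ Real.log (len r c)
  load_le : ∀ r c, load r c ≤ M
  max_nonneg : 0 ≤ M
  exists_max : M = 0 ∨ ∃ r c, D.IsRow r c ∧ M = load r c

/-- A load `a ≤ 1` multiplies the length by `1 + a / 200`, whose logarithm is at least `a / (200 +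
a) ≥ a / 201`. -/
theorem RowInv.bump {len load : ℕ → ℕ → ℝ} {M : ℝ} (h : D.RowInv len load M) {r c : ℕ}
    (hr : D.IsRow r c) {a : ℝ} (ha : 0 ≤ a) (ha1 : a ≤ 1) :
    D.RowInv (upd len r c (len r c + len r c * (1 / 200 * a))) (upd load r c (load r c + a))
      (if M < load r c + a then load r c + a else M) where
  one_le r' c' := by
    by_cases hrc : r' = r ∧ c' = c
    · rw [hrc.1, hrc.2, upd_self]
      have := h.one_le r c
      nlinarith [mul_nonneg (zero_le_one.trans this) ha]
    · rw [upd_ne _ _ hrc]; exact h.one_le _ _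
  log_ge r' c' := by
    by_cases hrc : r' = r ∧ c' = c
    · rw [hrc.1, hrc.2, upd_self, upd_self]
      have h1 := h.one_le r c
      have h2 : len r c + len r c * (1 / 200 * a) = len r c * (1 + 1 / 200 * a) := by ring
      have hpos : 0 < 1 + 1 / 200 * a := by positivity
      rw [h2, Real.log_mul (by linarith) hpos.ne']
      have h3 := Real.one_sub_inv_le_log_of_pos hpos
      have h4 : a / 201 ≤ 1 - (1 + 1 / 200 * a)⁻¹ := by
        rw [le_sub_iff_add_le, ← le_sub_iff_add_le', inv_le_iff_one_le_mul₀ hpos]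
        nlinarith
      have := h.log_ge r c
      linarith [add_div (load r c) a 201]
    · rw [upd_ne _ _ hrc, upd_ne _ _ hrc]; exact h.log_ge _ _
  load_le r' c' := by
    by_cases hrc : r' = r ∧ c' = c
    · rw [hrc.1, hrc.2, upd_self]
      split_ifs with h' <;> linarith
    · rw [upd_ne _ _ hrc]
      have := h.load_le r' c'
      split_ifs with h' <;> linarith
  max_nonneg := by
    have := h.max_nonneg
    split_ifs with h' <;> linarith
  exists_max := by
    split_ifs with h'
    · exact Or.inr ⟨r, c, hr, by simp⟩
    · rcases h.exists_max with h0 | ⟨r', c', hr', h0⟩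
      · exact Or.inl h0
      · by_cases hrc : r' = r ∧ c' = c
        · rw [hrc.1, hrc.2] at h0
          exact Or.inr ⟨r, c, hr, by rw [upd_self]; linarith⟩
        · exact Or.inr ⟨r', c', hr', by rw [upd_ne _ _ hrc]; exact h0⟩

/-- The state of the packing algorithm after `t` iterations. -/
structure PackInv (D : Tables) (t : ℕ) (len load : ℕ → ℕ → ℝ) (M : ℝ) (rb qb : ℕ → ℕ → ℝ) :
    Prop where
  rows : D.RowInv len load M
  -- The potential argument: the logarithm of the total length grows at most in proportion to the
  -- accumulated revenue.
  log_total : D.opt * (Real.log (D.total len) - Real.log (D.n + D.V + D.m : ℕ)) ≤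
    1 / 200 * (201 / 200) ^ 2 * ∑ j ∈ Finset.range D.m, rb j 0
  count : ∑ j ∈ Finset.range D.m, load j 2 = t
  -- The pair `(rb j 0, qb j 0)` lies in the convex hull of the candidate pairs of `j`, scaled by
  -- the number `load j 2` of times `j` was used. The hull is described by its supporting
  -- half-planes, which is the form needed for derandomization.
  cone : ∀ j < D.m, ∀ A B X : ℝ, (∀ k < D.K, A * D.w j k + B * D.q j k ≤ X) →
    A * rb j 0 + B * qb j 0 ≤ X * load j 2
  agents : ∀ i, ∑ j ∈ Finset.range D.m with D.own j = i, qb j 0 ≤ load i 0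
  -- A service with both end points in `W` has loaded a vertex of `W`, whichever end point was used.
  inside : ∀ W : Finset ℕ,
    ∑ j ∈ Finset.range D.m with D.lft j ∈ W ∧ D.rgt j ∈ W, qb j 0 ≤ ∑ u ∈ W, load u 1

theorem PackInv.init (D : Tables) : D.PackInv 0 (fun _ _ => 1) (fun _ _ => 0) 0 (fun _ _ => 0)
    (fun _ _ => 0) where
  rows := ⟨fun _ _ => le_rfl, fun _ _ => by simp, fun _ _ => le_rfl, le_rfl, Or.inl rfl⟩
  log_total := by simp [total]
  count := by simp
  cone := by simp
  agents := by simp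
  inside := by simp

theorem PackInv.qb_nonneg (hD : D.Valid) {t : ℕ} {len load : ℕ → ℕ → ℝ} {M : ℝ}
    {rb qb : ℕ → ℕ → ℝ} (h : D.PackInv t len load M rb qb) {j : ℕ} (hj : j < D.m) :
    0 ≤ qb j 0 := by
  have := h.cone j hj 0 (-1) 0 fun k hk => by linarith [hD.q_nonneg j hj k hk]
  linarith

theorem PackInv.rb_nonneg (hD : D.Valid) {t : ℕ} {len load : ℕ → ℕ → ℝ} {M : ℝ}
    {rb qb : ℕ → ℕ → ℝ} (h : D.PackInv t len load M rb qb) {j : ℕ} (hj : j < D.m) :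
    0 ≤ rb j 0 := by
  have := h.cone j hj (-1) 0 0 fun k hk => by linarith [hD.w_nonneg j hj k hk]
  linarith

theorem PackInv.qb_le (hD : D.Valid) {t : ℕ} {len load : ℕ → ℕ → ℝ} {M : ℝ}
    {rb qb : ℕ → ℕ → ℝ} (h : D.PackInv t len load M rb qb) {j : ℕ} (hj : j < D.m) :
    qb j 0 ≤ load j 2 := by
  have := h.cone j hj 0 1 1 fun k hk => by linarith [hD.q_le_one j hj k hk]
  linarith

theorem sum_upd_range {f : ℕ → ℕ → ℝ} {j N : ℕ} (hj : j < N) (x : ℝ) (c : ℕ) :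
    ∑ i ∈ Finset.range N, upd f j c (f j c + x) i c = ∑ i ∈ Finset.range N, f i c + x := by
  rw [← Finset.add_sum_erase _ _ (Finset.mem_range.2 hj),
    ← Finset.add_sum_erase _ (fun i => f i c) (Finset.mem_range.2 hj), upd_self,
    Finset.sum_congr rfl fun i hi => upd_ne f _ fun h => (Finset.mem_erase.1 hi).1 h.1]
  ring

theorem sum_upd_of_mem {f : ℕ → ℕ → ℝ} {j : ℕ} {s : Finset ℕ} (hj : j ∈ s) (x : ℝ) (c : ℕ) :
    ∑ i ∈ s, upd f j c (f j c + x) i c = ∑ i ∈ s, f i c + x := by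
  rw [← Finset.add_sum_erase _ _ hj, ← Finset.add_sum_erase _ (fun i => f i c) hj, upd_self,
    Finset.sum_congr rfl fun i hi => upd_ne f _ fun h => (Finset.mem_erase.1 hi).1 h.1]
  ring

theorem sum_upd_of_notMem {f : ℕ → ℕ → ℝ} {j : ℕ} {s : Finset ℕ} (hj : j ∉ s) (x : ℝ) (c : ℕ) :
    ∑ i ∈ s, upd f j c x i c = ∑ i ∈ s, f i c :=
  Finset.sum_congr rfl fun _ hi => upd_ne f _ fun h => hj (h.1 ▸ hi)

theorem le_total {len : ℕ → ℕ → ℝ} (h : ∀ r c, 0 ≤ len r c) {r c : ℕ} (hr : D.IsRow r c) :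
    len r c ≤ D.total len := by
  have h0 := Finset.sum_nonneg fun i (_ : i ∈ Finset.range D.n) => h i 0
  have h1 := Finset.sum_nonneg fun i (_ : i ∈ Finset.range D.V) => h i 1
  have h2 := Finset.sum_nonneg fun i (_ : i ∈ Finset.range D.m) => h i 2
  unfold total
  rcases hr with ⟨rfl, hr⟩ | ⟨rfl, hr⟩ | ⟨rfl, hr⟩
  · linarith [Finset.single_le_sum (fun i _ => h i 0) (Finset.mem_range.2 hr)]
  · linarith [Finset.single_le_sum (fun i _ => h i 1) (Finset.mem_range.2 hr)]
  · linarith [Finset.single_le_sum (fun i _ => h i 2) (Finset.mem_range.2 hr)]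

/-- One iteration: a column of maximal ratio of revenue and length is used. -/
theorem PackInv.step (hD : D.Valid) {t : ℕ} {len load : ℕ → ℕ → ℝ} {M : ℝ}
    {rb qb : ℕ → ℕ → ℝ} (h : D.PackInv t len load M rb qb) {j k u : ℕ} (hj : j < D.m)
    (hk : k < D.K) (hu : u = D.lft j ∨ u = D.rgt j)
    (hmax : ∀ j' < D.m, ∀ k' < D.K, ∀ u', u' = D.lft j' ∨ u' = D.rgt j' →
      D.w j' k' / D.cost len j' k' u' ≤ D.w j k / D.cost len j k u)
    {len₁ len₂ len₃ load₁ load₂ load₃ : ℕ → ℕ → ℝ} {M₁ M₂ M₃ : ℝ}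
    (e1 : len₁ = upd len (D.own j) 0
      (len (D.own j) 0 + len (D.own j) 0 * (1 / 200 * D.q j k)))
    (e2 : len₂ = upd len₁ u 1 (len₁ u 1 + len₁ u 1 * (1 / 200 * D.q j k)))
    (e3 : len₃ = upd len₂ j 2 (len₂ j 2 + len₂ j 2 * (1 / 200 * 1)))
    (f1 : load₁ = upd load (D.own j) 0 (load (D.own j) 0 + D.q j k))
    (f2 : load₂ = upd load₁ u 1 (load₁ u 1 + D.q j k))
    (f3 : load₃ = upd load₂ j 2 (load₂ j 2 + 1))
    (g1 : M₁ = if M < load (D.own j) 0 + D.q j k then load (D.own j) 0 + D.q j k else M)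
    (g2 : M₂ = if M₁ < load₁ u 1 + D.q j k then load₁ u 1 + D.q j k else M₁)
    (g3 : M₃ = if M₂ < load₂ j 2 + 1 then load₂ j 2 + 1 else M₂) :
    D.PackInv (t + 1) len₃ load₃ M₃ (upd rb j 0 (rb j 0 + D.w j k))
      (upd qb j 0 (qb j 0 + D.q j k)) := by
  have hq0 := hD.q_nonneg j hj k hk
  have hq1 := hD.q_le_one j hj k hk
  have hri : D.IsRow (D.own j) 0 := Or.inl ⟨rfl, hD.own_lt j hj⟩
  have huV : u < D.V := by
    rcases hu with rfl | rfl
    · exact hD.lft_lt j hj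
    · exact hD.rgt_lt j hj
  have hru : D.IsRow u 1 := Or.inr (Or.inl ⟨rfl, huV⟩)
  have hrj : D.IsRow j 2 := Or.inr (Or.inr ⟨rfl, hj⟩)
  have R1 : D.RowInv len₁ load₁ M₁ := by
    subst e1 f1 g1; exact h.rows.bump hri hq0 hq1
  have R2 : D.RowInv len₂ load₂ M₂ := by
    rw [e2, f2, g2]; exact R1.bump hru hq0 hq1
  have R3 : D.RowInv len₃ load₃ M₃ := by
    rw [e3, f3, g3]; exact R2.bump hrj zero_le_one le_rfl
  have hpos : ∀ r c, 0 < len r c := fun r c => zero_lt_one.trans_le (h.rows.one_le r c)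
  have hcost : ∀ j < D.m, ∀ k < D.K, ∀ u, 0 < D.cost len j k u := fun j hj k hk u =>
    add_pos_of_nonneg_of_pos (mul_nonneg (hD.q_nonneg j hj k hk)
      (add_pos (hpos _ _) (hpos _ _)).le) (hpos _ _)
  have hc := hcost j hj k hk u
  -- lengths
  have l1 : len₁ u 1 = len u 1 := by rw [e1, upd_ne]; simp
  have l2 : len₂ j 2 = len j 2 := by rw [e2, upd_ne _ _ (by simp), e1, upd_ne _ _ (by simp)]
  have htot : D.total len₃ = D.total len + 1 / 200 * D.cost len j k u := by
    rw [e3, total_upd hrj, e2, total_upd hru, e1, total_upd hri, ← e1, ← e2, l1, l2, cost]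
    ring
  have hT : 0 < D.total len := (hpos _ _).trans_le (le_total (fun r c => (hpos r c).le) hri)
  -- loads
  have hl0 : ∀ i, load₃ i 0 = load₁ i 0 := fun i => by
    rw [f3, upd_ne _ _ (by simp), f2, upd_ne _ _ (by simp)]
  have hl1 : ∀ i, load₃ i 1 = upd load u 1 (load u 1 + D.q j k) i 1 := fun i => by
    have : ∀ i, load₁ i 1 = load i 1 := fun i => by rw [f1, upd_ne _ _ (by simp)]
    rw [f3, upd_ne _ _ (by simp), f2, this u]
    by_cases hiu : i = u
    · rw [hiu, upd_self, upd_self]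
    · rw [upd_ne _ _ (by simp [hiu]), upd_ne _ _ (by simp [hiu]), this]
  have hl2 : ∀ i, load₃ i 2 = upd load j 2 (load j 2 + 1) i 2 := fun i => by
    have : ∀ i, load₂ i 2 = load i 2 := fun i => by
      rw [f2, upd_ne _ _ (by simp), f1, upd_ne _ _ (by simp)]
    rw [f3, this j]
    by_cases hiu : i = j
    · rw [hiu, upd_self, upd_self]
    · rw [upd_ne _ _ (by simp [hiu]), upd_ne _ _ (by simp [hiu]), this]
  refine ⟨R3, ?_, ?_, ?_, ?_, ?_⟩
  · rw [htot, sum_upd_range hj]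
    have hρ : 0 ≤ D.w j k / D.cost len j k u := div_nonneg (hD.w_nonneg j hj k hk) hc.le
    -- With `ρ` the maximal ratio, all columns satisfy the dual constraints, so the optimum is at
    -- most `(201/200)^2 * ρ` times the total length.
    have hopt := hD.dual _ len hρ (fun r c => (hpos r c).le) fun j' hj' k' hk' u' hu' =>
      (div_le_iff₀ (hcost j' hj' k' hk' u')).1 (hmax j' hj' k' hk' u' hu')
    have hlog : Real.log (D.total len + 1 / 200 * D.cost len j k u) ≤
        Real.log (D.total len) + 1 / 200 * D.cost len j k u / D.total len := by
      have : D.total len + 1 / 200 * D.cost len j k u =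
          D.total len * (1 + 1 / 200 * D.cost len j k u / D.total len) := by
        field_simp
      have hp : 0 < 1 + 1 / 200 * D.cost len j k u / D.total len := by positivity
      rw [this, Real.log_mul hT.ne' hp.ne']
      linarith [Real.log_le_sub_one_of_pos hp]
    -- The relative growth of the total length is paid for by the revenue of the chosen column.
    have h1 : D.opt * (1 / 200 * D.cost len j k u / D.total len) ≤
        1 / 200 * (201 / 200) ^ 2 * D.w j k := by
      calc D.opt * (1 / 200 * D.cost len j k u / D.total len)
          ≤ (201 / 200) ^ 2 * (D.w j k / D.cost len j k u) * D.total len *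
            (1 / 200 * D.cost len j k u / D.total len) := by gcongr
        _ = _ := by field_simp
    have h2 := mul_le_mul_of_nonneg_left hlog hD.opt_nonneg
    have h3 := h.log_total
    rw [mul_sub] at h3 ⊢
    rw [mul_add] at h2 ⊢
    linarith
  · rw [Finset.sum_congr rfl fun _ _ => hl2 _, sum_upd_range hj, h.count]
    push_cast; ring
  · intro j' hj' A B X hX
    rw [hl2]
    by_cases hjj : j' = j
    · subst hjj
      rw [upd_self, upd_self, upd_self]
      linarith [h.cone j' hj' A B X hX, hX k hk]
    · rw [upd_ne _ _ (by simp [hjj]), upd_ne _ _ (by simp [hjj]), upd_ne _ _ (by simp [hjj])]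
      exact h.cone j' hj' A B X hX
  · intro i
    rw [hl0, f1]
    by_cases hi : D.own j = i
    · subst hi
      rw [upd_self, sum_upd_of_mem (by simp [hj])]
      linarith [h.agents (D.own j)]
    · rw [upd_ne _ _ (fun h => hi h.1.symm), sum_upd_of_notMem (by simp [hi])]
      exact h.agents i
  · intro W
    rw [Finset.sum_congr rfl fun i _ => hl1 i]
    have hW : ∑ i ∈ W, load i 1 ≤ ∑ i ∈ W, upd load u 1 (load u 1 + D.q j k) i 1 := by
      by_cases huW : u ∈ W
      · rw [sum_upd_of_mem huW]; linarith
      · rw [sum_upd_of_notMem huW]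
    by_cases hjW : D.lft j ∈ W ∧ D.rgt j ∈ W
    · have huW : u ∈ W := by rcases hu with rfl | rfl; exacts [hjW.1, hjW.2]
      rw [sum_upd_of_mem (by simp [hj, hjW]), sum_upd_of_mem huW]
      linarith [h.inside W]
    · rw [sum_upd_of_notMem (by simp only [Finset.mem_filter]; tauto)]
      exact (h.inside W).trans hW

/-- After enough iterations, the average column is almost optimal. -/
theorem PackInv.final (hD : D.Valid) (hm : 0 < D.m) {t : ℕ} {len load : ℕ → ℕ → ℝ} {M : ℝ}
    {rb qb : ℕ → ℕ → ℝ} (h : D.PackInv t len load M rb qb)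
    (ht : 40000 * (D.n + D.V + D.m) * D.m ≤ t) :
    0 < M ∧ 125 / 128 * (M * D.opt) ≤ ∑ j ∈ Finset.range D.m, rb j 0 := by
  have hm' : (0 : ℝ) < D.m := by exact_mod_cast hm
  obtain ⟨R, hR⟩ : ∃ R : ℝ, R = ((D.n + D.V + D.m : ℕ) : ℝ) := ⟨_, rfl⟩
  have hR1 : 1 ≤ R := by rw [hR]; exact_mod_cast (by omega : 1 ≤ D.n + D.V + D.m)
  -- Each iteration adds one unit to the row of some service, so some service has load at least `t /
  -- m`.
  have hM : 40000 * R ≤ M := by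
    have h1 : (t : ℝ) ≤ D.m * M := by
      rw [← h.count]
      refine (Finset.sum_le_sum fun j _ => h.rows.load_le j 2).trans_eq ?_
      simp
    have h2 : 40000 * R * D.m ≤ t := by rw [hR]; exact_mod_cast ht
    have h3 : 40000 * R * D.m ≤ M * D.m := by linarith
    exact le_of_mul_le_mul_right h3 hm'
  have hM0 : 0 < M := by linarith
  refine ⟨hM0, ?_⟩
  obtain ⟨r, c, hrc, hr⟩ := h.rows.exists_max.resolve_left hM0.ne'
  have hpos : ∀ r c, 0 < len r c := fun r c => zero_lt_one.trans_le (h.rows.one_le r c)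
  have h1 := h.rows.log_ge r c
  have h2 := Real.log_le_log (hpos r c) (le_total (fun r c => (hpos r c).le) hrc)
  have h3 := h.log_total
  rw [← hr] at h1
  rw [← hR] at h3
  -- The initial total length `R` contributes at most `log R ≤ R ≤ M / 40000`, which is negligible
  -- against `M / 201`.
  have h4 : Real.log R ≤ R := (Real.log_le_sub_one_of_pos (by linarith)).trans (by linarith)
  have h5 : M / 201 - M / 40000 ≤ Real.log (D.total len) - Real.log R := by linarith
  have h6 := mul_le_mul_of_nonneg_left h5 hD.opt_nonneg
  have h7 : 0 ≤ M * D.opt := mul_nonneg hM0.le hD.opt_nonneg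
  -- The constants fit: `(200/201)^3 - (200/201)^2 / 200 > 125/128`.
  nlinarith

/-! ### Peeling off vertices of small degree -/

/-- The total probability of the services at vertex `u` inside the vertex set `W`. -/
def degree (D : Tables) (qb : ℕ → ℕ → ℝ) (W : Finset ℕ) (u : ℕ) : ℝ :=
  ∑ j ∈ Finset.range D.m with
    (D.lft j ∈ W ∧ D.rgt j ∈ W) ∧ (D.lft j = u ∨ D.rgt j = u), qb j 0

/-- Handshake: the degrees in `W` add up to twice the probability inside `W`, which is at most the
load on `W`, that is, at most `M` per vertex. -/
theorem PackInv.exists_degree_le (hD : D.Valid) {t : ℕ} {len load : ℕ → ℕ → ℝ} {M : ℝ}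
    {rb qb : ℕ → ℕ → ℝ} (h : D.PackInv t len load M rb qb) {W : Finset ℕ} (hW : W.Nonempty) :
    ∃ u ∈ W, D.degree qb W u ≤ 2 * M := by
  refine Finset.exists_le_of_sum_le hW ?_
  have h1 : ∑ u ∈ W, D.degree qb W u =
      ∑ j ∈ Finset.range D.m with D.lft j ∈ W ∧ D.rgt j ∈ W, 2 * qb j 0 := by
    have hd : ∀ u, D.degree qb W u =
        ∑ j ∈ Finset.range D.m with D.lft j ∈ W ∧ D.rgt j ∈ W,
          if D.lft j = u ∨ D.rgt j = u then qb j 0 else 0 := fun u => by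
      rw [degree, ← Finset.filter_filter, Finset.sum_filter (p := fun j => D.lft j = u ∨ _)]
    simp only [hd]
    rw [Finset.sum_comm]
    refine Finset.sum_congr rfl fun j hj => ?_
    obtain ⟨hj, h1, h2⟩ := Finset.mem_filter.1 hj
    have hne := hD.ne j (Finset.mem_range.1 hj)
    rw [← Finset.sum_filter, Finset.sum_const]
    have : (W.filter fun u => D.lft j = u ∨ D.rgt j = u) = {D.lft j, D.rgt j} := by
      ext u
      simp only [Finset.mem_filter, Finset.mem_insert, Finset.mem_singleton]
      constructor
      · rintro ⟨_, h | h⟩ <;> simp [h]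
      · rintro (rfl | rfl) <;> simp [h1, h2]
    rw [this, Finset.card_pair hne]
    simp
  rw [h1, ← Finset.mul_sum]
  refine (mul_le_mul_of_nonneg_left (h.inside W) zero_le_two).trans ?_
  rw [Finset.mul_sum]
  exact Finset.sum_le_sum fun u _ => by linarith [h.rows.load_le u 1]

/-- The state of the peeling after `t` rounds; `ord u = 0` means that `u` was not peeled off. -/
structure PeelInv (D : Tables) (qb : ℕ → ℕ → ℝ) (M : ℝ) (t : ℕ) (ord : ℕ → ℕ → ℕ) : Prop where
  card : (Finset.range D.V |>.filter fun u => ord u 0 = 0).card + t = D.V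
  le : ∀ u < D.V, ord u 0 ≤ t
  inj : ∀ u < D.V, ∀ u' < D.V, ord u 0 = ord u' 0 → ord u 0 ≠ 0 → u = u'
  degree_le : ∀ u < D.V, ord u 0 ≠ 0 → ∑ j ∈ Finset.range D.m with
    (D.lft j = u ∧ (ord (D.rgt j) 0 = 0 ∨ ord u 0 < ord (D.rgt j) 0)) ∨
    (D.rgt j = u ∧ (ord (D.lft j) 0 = 0 ∨ ord u 0 < ord (D.lft j) 0)), qb j 0 ≤ 2 * M

theorem PeelInv.init (D : Tables) (qb : ℕ → ℕ → ℝ) (M : ℝ) :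
    D.PeelInv qb M 0 (fun _ _ => 0) where
  card := by simp
  le := by simp
  inj := by simp
  degree_le := by simp

theorem PeelInv.step (hD : D.Valid) {qb : ℕ → ℕ → ℝ} {M : ℝ} {t : ℕ} {ord : ℕ → ℕ → ℕ}
    (h : D.PeelInv qb M t ord) {u : ℕ} (hu : u < D.V) (hu0 : ord u 0 = 0)
    (hdeg : D.degree qb ((Finset.range D.V).filter fun u => ord u 0 = 0) u ≤ 2 * M) :
    D.PeelInv qb M (t + 1) (upd ord u 0 (t + 1)) := by
  have hne : ∀ v, v ≠ u → upd ord u 0 (t + 1) v 0 = ord v 0 := fun v hv =>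
    upd_ne _ _ fun h => hv h.1
  refine ⟨?_, ?_, ?_, ?_⟩
  · have : ((Finset.range D.V).filter fun v => upd ord u 0 (t + 1) v 0 = 0) =
        ((Finset.range D.V).filter fun v => ord v 0 = 0).erase u := by
      ext v
      simp only [Finset.mem_filter, Finset.mem_erase, Finset.mem_range]
      by_cases hv : v = u
      · simp [hv]
      · simp [hv, hne]
    have hmem : u ∈ (Finset.range D.V).filter fun v => ord v 0 = 0 := by simp [hu, hu0]
    have h2 := Finset.card_erase_add_one hmem
    rw [this]
    have := h.card
    omega
  · intro v hv
    by_cases hvu : v = u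
    · rw [hvu, upd_self]
    · rw [hne v hvu]; exact (h.le v hv).trans (Nat.le_succ t)
  · intro v hv v' hv' hvv h0
    by_cases hvu : v = u <;> by_cases hvu' : v' = u
    · rw [hvu, hvu']
    · rw [hvu, upd_self, hne v' hvu'] at hvv
      have := h.le v' hv'
      omega
    · rw [hvu', upd_self, hne v hvu] at hvv
      have := h.le v hv
      omega
    · rw [hne v hvu, hne v' hvu'] at hvv
      rw [hne v hvu] at h0
      exact h.inj v hv v' hv' hvv h0
  · intro v hv h0
    by_cases hvu : v = u
    · subst hvu
      refine le_trans (le_of_eq ?_) hdeg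
      unfold degree
      refine Finset.sum_congr (Finset.filter_congr fun j hj => ?_) fun _ _ => rfl
      have hj := Finset.mem_range.1 hj
      have h1 := hD.lft_lt j hj
      have h2 := hD.rgt_lt j hj
      have h3 := hD.ne j hj
      have h4 := h.le _ h1
      have h5 := h.le _ h2
      simp only [upd_self, Finset.mem_filter, Finset.mem_range, h1, h2, true_and]
      constructor
      · rintro (⟨rfl, h6⟩ | ⟨rfl, h6⟩)
        · rw [hne _ h3.symm] at h6
          refine ⟨⟨hu0, by omega⟩, Or.inl rfl⟩
        · rw [hne _ h3] at h6
          refine ⟨⟨by omega, hu0⟩, Or.inr rfl⟩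
      · rintro ⟨⟨h6, h7⟩, rfl | rfl⟩
        · exact Or.inl ⟨rfl, by rw [hne _ h3.symm]; exact Or.inl h7⟩
        · exact Or.inr ⟨rfl, by rw [hne _ h3]; exact Or.inl h6⟩
    · rw [hne v hvu] at h0
      refine le_trans (le_of_eq ?_) (h.degree_le v hv h0)
      refine Finset.sum_congr (Finset.filter_congr fun j _ => ?_) fun _ _ => rfl
      rw [hne v hvu]
      have hle := h.le v hv
      -- For a vertex `v` peeled off earlier, `u` changes from unranked to rank `t + 1`, which is
      -- above the rank of `v`; so the sum at `v` stays the same.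
      have key : ∀ x, (upd ord u 0 (t + 1) x 0 = 0 ∨ ord v 0 < upd ord u 0 (t + 1) x 0) ↔
          (ord x 0 = 0 ∨ ord v 0 < ord x 0) := by
        intro x
        by_cases hxu : x = u
        · rw [hxu, upd_self, hu0]; omega
        · rw [hne x hxu]
      rw [key, key]

/-- The first end point of a service in the order of peeling. -/
def first (D : Tables) (ord : ℕ → ℕ → ℕ) (j : ℕ) : ℕ :=
  if ord (D.lft j) 0 < ord (D.rgt j) 0 then D.lft j else D.rgt j

theorem PeelInv.pos {qb : ℕ → ℕ → ℝ} {M : ℝ} {ord : ℕ → ℕ → ℕ} (h : D.PeelInv qb M D.V ord)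
    {u : ℕ} (hu : u < D.V) : ord u 0 ≠ 0 := by
  have h1 := h.card
  have h2 : ((Finset.range D.V).filter fun u => ord u 0 = 0) = ∅ := by
    rw [← Finset.card_eq_zero]; omega
  intro h0
  have : u ∈ ((Finset.range D.V).filter fun u => ord u 0 = 0) := by simp [hu, h0]
  rw [h2] at this
  simp at this

/-- If `u` is the first end point of a service, the other end point was still present when `u` was
peeled off. So the service was counted in the degree of `u` at that moment. -/
theorem PeelInv.sum_first_le (hD : D.Valid) {qb : ℕ → ℕ → ℝ} {M : ℝ} {ord : ℕ → ℕ → ℕ}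
    (hq : ∀ j < D.m, 0 ≤ qb j 0) (h : D.PeelInv qb M D.V ord) {u : ℕ} (hu : u < D.V) :
    ∑ j ∈ Finset.range D.m with D.first ord j = u, qb j 0 ≤ 2 * M := by
  refine le_trans ?_ (h.degree_le u hu (h.pos hu))
  refine Finset.sum_le_sum_of_subset_of_nonneg ?_
    fun j hj _ => hq j (Finset.mem_range.1 (Finset.mem_filter.1 hj).1)
  intro j hj
  obtain ⟨hj, hju⟩ := Finset.mem_filter.1 hj
  have hj' := Finset.mem_range.1 hj
  have hne : ord (D.lft j) 0 ≠ ord (D.rgt j) 0 := fun h' => hD.ne j hj'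
    (h.inj _ (hD.lft_lt j hj') _ (hD.rgt_lt j hj') h' (h.pos (hD.lft_lt j hj')))
  refine Finset.mem_filter.2 ⟨hj, ?_⟩
  unfold first at hju
  split_ifs at hju with h'
  · subst hju; exact Or.inl ⟨rfl, Or.inr h'⟩
  · subst hju; exact Or.inr ⟨rfl, Or.inr (by omega)⟩

/-! ### Derandomization -/

/-- A lower bound on the order-oblivious revenue for revenues `r` and probabilities `q` of the
services, if service `j` has to give way to the other services `k` with `rival j k`. -/
def bound (m : ℕ) (rival : ℕ → ℕ → Prop) [∀ j k, Decidable (rival j k)] (r q : ℕ → ℕ → ℝ) : ℝ :=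
  ∑ j ∈ Finset.range m, r j 0 * ∏ k ∈ Finset.range m, if k ≠ j ∧ rival j k then 1 - q k 0 else 1

/-- The revenue of `j` occurs in the term of `j` only, and its probability in the terms of other
services only, in at most one factor each. So the two parameters are never multiplied, and the bound
is affine in the pair, not just in each of them. -/
theorem bound_upd_affine (m : ℕ) (rival : ℕ → ℕ → Prop) [∀ j k, Decidable (rival j k)]
    (r q : ℕ → ℕ → ℝ) (j : ℕ) :
    ∃ A B C : ℝ, ∀ x y, bound m rival (upd r j 0 x) (upd q j 0 y) = A * x + B * y + C := by
  have key : ∀ i, ∃ A B C : ℝ, ∀ x y, upd r j 0 x i 0 * ∏ k ∈ Finset.range m,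
      (if k ≠ i ∧ rival i k then 1 - upd q j 0 y k 0 else 1) = A * x + B * y + C := by
    intro i
    by_cases hi : i = j
    · refine ⟨∏ k ∈ Finset.range m, (if k ≠ i ∧ rival i k then 1 - q k 0 else 1), 0, 0,
        fun x y => ?_⟩
      have : ∏ k ∈ Finset.range m, (if k ≠ i ∧ rival i k then 1 - upd q j 0 y k 0 else 1) =
          ∏ k ∈ Finset.range m, (if k ≠ i ∧ rival i k then 1 - q k 0 else 1) := by
        refine Finset.prod_congr rfl fun k _ => ?_
        by_cases hk : k ≠ i ∧ rival i k
        · rw [if_pos hk, if_pos hk, upd_ne _ _ fun h => hk.1 (h.1.trans hi.symm)]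
        · rw [if_neg hk, if_neg hk]
      rw [this, hi, upd_self]
      ring
    · have hr : ∀ x, upd r j 0 x i 0 = r i 0 := fun x => upd_ne _ _ fun h => hi h.1
      have hprod : ∃ b c : ℝ, ∀ y, ∏ k ∈ Finset.range m,
          (if k ≠ i ∧ rival i k then 1 - upd q j 0 y k 0 else 1) = b * y + c := by
        have hoth : ∀ k, k ≠ j → ∀ y, (if k ≠ i ∧ rival i k then 1 - upd q j 0 y k 0 else 1) =
            (if k ≠ i ∧ rival i k then 1 - q k 0 else 1) := fun k hk y => by
          rw [upd_ne _ _ fun h => hk h.1]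
        by_cases hj : j ∈ Finset.range m
        · set c := ∏ k ∈ (Finset.range m).erase j, (if k ≠ i ∧ rival i k then 1 - q k 0 else 1)
          refine ⟨if j ≠ i ∧ rival i j then -c else 0, c, fun y => ?_⟩
          rw [← Finset.mul_prod_erase _ _ hj,
            Finset.prod_congr rfl fun k hk => hoth k (Finset.mem_erase.1 hk).1 y, upd_self]
          split_ifs <;> ring
        · refine ⟨0, ∏ k ∈ Finset.range m, (if k ≠ i ∧ rival i k then 1 - q k 0 else 1),
            fun y => ?_⟩
          rw [Finset.prod_congr rfl fun k hk => hoth k (fun h => hj (h ▸ hk)) y]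
          ring
      obtain ⟨b, c, hbc⟩ := hprod
      exact ⟨0, r i 0 * b, r i 0 * c, fun x y => by rw [hbc, hr]; ring⟩
  choose A B C hABC using key
  refine ⟨∑ i ∈ Finset.range m, A i, ∑ i ∈ Finset.range m, B i, ∑ i ∈ Finset.range m, C i,
    fun x y => ?_⟩
  unfold bound
  rw [Finset.sum_congr rfl fun i _ => hABC i x y]
  simp only [Finset.sum_add_distrib, Finset.sum_mul]

/-- Some candidate price is at least as good as the average one. -/
theorem PackInv.bound_le (hD : D.Valid) {t : ℕ} {len load : ℕ → ℕ → ℝ} {M : ℝ}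
    {rb qb : ℕ → ℕ → ℝ} (h : D.PackInv t len load M rb qb) (rival : ℕ → ℕ → Prop)
    [∀ j k, Decidable (rival j k)] {s : ℝ} (hs0 : 0 ≤ s) (hs : s * M ≤ 1) {j : ℕ} (hj : j < D.m)
    {r q : ℕ → ℕ → ℝ} (hr : r j 0 = s * rb j 0) (hq : q j 0 = s * qb j 0) {X : ℝ}
    (hX : ∀ k < D.K, bound D.m rival (upd r j 0 (D.w j k)) (upd q j 0 (D.q j k)) ≤ X) :
    bound D.m rival r q ≤ X := by
  obtain ⟨A, B, C, hABC⟩ := bound_upd_affine D.m rival r q j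
  have hself : bound D.m rival r q = A * r j 0 + B * q j 0 + C := by
    rw [← hABC]
    congr 1 <;> · ext a b; unfold upd; split_ifs with h' <;> simp [h']
  simp only [hABC] at hX
  have h0 := hX 0 hD.K_pos
  rw [hD.w_zero j hj, hD.q_zero j hj] at h0
  -- The scaled average is a convex combination of candidates: the columns of `j` have total weight
  -- `s * load j 2 ≤ 1`, and the remaining weight goes to candidate `0`.
  have h1 := h.cone j hj A B (X - C) fun k hk => by linarith [hX k hk]
  have h2 := mul_le_mul_of_nonneg_left h1 hs0
  have h3 : s * load j 2 ≤ 1 := (mul_le_mul_of_nonneg_left (h.rows.load_le j 2) hs0).trans hs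
  rw [hself, hr, hq]
  nlinarith

theorem one_sub_sum_le_prod {ι : Type*} (s : Finset ι) (f : ι → ℝ) (h0 : ∀ i ∈ s, 0 ≤ f i)
    (h1 : ∀ i ∈ s, f i ≤ 1) : 1 - ∑ i ∈ s, f i ≤ ∏ i ∈ s, (1 - f i) := by
  classical
  induction s using Finset.induction_on with
  | empty => simp
  | insert a s ha ih =>
    rw [Finset.sum_insert ha, Finset.prod_insert ha]
    have h2 := ih (fun i hi => h0 i (Finset.mem_insert_of_mem hi))
      fun i hi => h1 i (Finset.mem_insert_of_mem hi)
    have h3 := h0 a (Finset.mem_insert_self a s)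
    have h4 := h1 a (Finset.mem_insert_self a s)
    have h5 : ∏ i ∈ s, (1 - f i) ≤ 1 := Finset.prod_le_one
      (fun i hi => sub_nonneg.2 (h1 i (Finset.mem_insert_of_mem hi)))
      fun i hi => by linarith [h0 i (Finset.mem_insert_of_mem hi)]
    nlinarith

/-- The bound for the scaled average prices. -/
theorem PackInv.le_bound (hD : D.Valid) {t : ℕ} {len load : ℕ → ℕ → ℝ} {M : ℝ}
    {rb qb : ℕ → ℕ → ℝ} (h : D.PackInv t len load M rb qb)
    (ht : 40000 * (D.n + D.V + D.m) * D.m ≤ t) {ord : ℕ → ℕ → ℕ} (ho : D.PeelInv qb M D.V ord)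
    {r q : ℕ → ℕ → ℝ} (hr : ∀ j < D.m, r j 0 = 1 / (5 * M) * rb j 0)
    (hq : ∀ j < D.m, q j 0 = 1 / (5 * M) * qb j 0) :
    3 / 32 * D.opt ≤
      bound D.m (fun j k => D.own k = D.own j ∨ D.first ord k = D.first ord j) r q := by
  rcases Nat.eq_zero_or_pos D.m with hm | hm
  · have := hD.dual 0 (fun _ _ => 0) le_rfl (fun _ _ => le_rfl) (by simp [hm])
    simp only [mul_zero, zero_mul] at this
    simp only [bound, hm, Finset.range_zero, Finset.sum_empty]
    linarith
  obtain ⟨hM, hfin⟩ := h.final hD hm ht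
  -- At scale `x / M` the guarantee is `x * (1 - x) * (1 - 2 * x)`; `x = 1/5` is close to the
  -- maximizer and gives `12/125`, and `12/125 * (125/128) = 3/32`.
  set s := 1 / (5 * M) with hs
  have hs0 : 0 < s := by positivity
  have hsM : s * M = 1 / 5 := by rw [hs]; field_simp
  have hqb0 : ∀ j < D.m, 0 ≤ qb j 0 := fun j hj => h.qb_nonneg hD hj
  have hq0 : ∀ j < D.m, 0 ≤ q j 0 := fun j hj => by
    rw [hq j hj]; exact mul_nonneg hs0.le (hqb0 j hj)
  have hq1 : ∀ j < D.m, q j 0 ≤ 1 := fun j hj => by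
    rw [hq j hj]
    have := mul_le_mul_of_nonneg_left ((h.qb_le hD hj).trans (h.rows.load_le j 2)) hs0.le
    linarith
  have hscale : ∀ (P : ℕ → Prop) [DecidablePred P] (c : ℝ),
      ∑ j ∈ Finset.range D.m with P j, qb j 0 ≤ c * M →
      1 - c / 5 ≤ ∏ j ∈ Finset.range D.m with P j, (1 - q j 0) := by
    intro P _ c hc
    have hmem : ∀ j ∈ (Finset.range D.m).filter P, j < D.m := fun j hj =>
      Finset.mem_range.1 (Finset.mem_filter.1 hj).1
    refine le_trans ?_ (one_sub_sum_le_prod _ _ (fun j hj => hq0 j (hmem j hj))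
      fun j hj => hq1 j (hmem j hj))
    rw [Finset.sum_congr rfl fun j hj => hq j (hmem j hj), ← Finset.mul_sum]
    have h1 := mul_le_mul_of_nonneg_left hc hs0.le
    have h2 : s * (c * M) = c / 5 := by rw [mul_left_comm, hsM]; ring
    linarith
  have hterm : ∀ j < D.m, 12 / 25 * r j 0 ≤ r j 0 * ∏ k ∈ Finset.range D.m,
      if k ≠ j ∧ (D.own k = D.own j ∨ D.first ord k = D.first ord j) then 1 - q k 0 else 1 := by
    intro j hj
    have hr0 : 0 ≤ r j 0 := by rw [hr j hj]; exact mul_nonneg hs0.le (h.rb_nonneg hD hj)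
    rw [mul_comm]
    refine mul_le_mul_of_nonneg_left ?_ hr0
    have h1 := hscale (fun k => D.own k = D.own j) 1
      (by rw [one_mul]; exact (h.agents _).trans (h.rows.load_le _ _))
    have hfV : D.first ord j < D.V := by
      unfold first; split_ifs
      exacts [hD.lft_lt j hj, hD.rgt_lt j hj]
    have h2 := hscale (fun k => D.first ord k = D.first ord j) 2 (ho.sum_first_le hD hqb0 hfV)
    calc (12 / 25 : ℝ) = (1 - 1 / 5) * (1 - 2 / 5) := by norm_num
      _ ≤ (∏ k ∈ Finset.range D.m with D.own k = D.own j, (1 - q k 0)) *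
          ∏ k ∈ Finset.range D.m with D.first ord k = D.first ord j, (1 - q k 0) :=
        mul_le_mul h1 h2 (by norm_num) (le_trans (by norm_num) h1)
      _ = ∏ k ∈ Finset.range D.m, (if D.own k = D.own j then 1 - q k 0 else 1) *
          (if D.first ord k = D.first ord j then 1 - q k 0 else 1) := by
        rw [Finset.prod_filter, Finset.prod_filter, Finset.prod_mul_distrib]
      -- The left side also has the factors of `j` itself, and counts services that share both the
      -- agent and the first end point twice. All factors lie in `[0, 1]`, so omitting the surplus
      -- ones only helps.
      _ ≤ _ := by
        refine Finset.prod_le_prod (fun k hk => ?_) fun k hk => ?_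
        · have := hq1 k (Finset.mem_range.1 hk)
          refine mul_nonneg ?_ ?_ <;> split_ifs <;> linarith
        · have h3 := hq1 k (Finset.mem_range.1 hk)
          have h4 := hq0 k (Finset.mem_range.1 hk)
          rcases eq_or_ne k j with rfl | c
          · simp only [ne_eq, not_true_eq_false, false_and, if_true, if_false]
            nlinarith
          · by_cases a : D.own k = D.own j <;> by_cases b : D.first ord k = D.first ord j <;>
              simp only [a, b, c, ne_eq, not_false_eq_true, if_true, if_false, true_and, or_self,
                or_true, mul_one, one_mul, or_false, le_refl]
            nlinarith
  have hsum := Finset.sum_le_sum fun j hj => hterm j (Finset.mem_range.1 hj)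
  refine le_trans ?_ hsum
  rw [Finset.sum_congr rfl fun j hj => by rw [hr j (Finset.mem_range.1 hj)], ← Finset.mul_sum,
    ← Finset.mul_sum]
  have h3 := mul_le_mul_of_nonneg_left hfin hs0.le
  have h4 : s * (125 / 128 * (M * D.opt)) = 125 / 128 * (1 / 5 * D.opt) := by
    rw [← hsM]; ring
  linarith

end Tables
end PostedPricing

namespace PostedPricing

/-! ### Reasoning about programs -/

namespace Memory

variable (s : Memory) (a i k : ℕ)

@[simp] theorem setNat_nat_self (x : ℕ) : (s.setNat a i k x).nat a = upd (s.nat a) i k x := by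
  ext i' k'; simp [setNat, upd]

@[simp] theorem setNat_nat_ne {a b : ℕ} (h : b ≠ a) (x : ℕ) :
    (s.setNat a i k x).nat b = s.nat b := by
  ext i' k'; simp [setNat, h]

@[simp] theorem setNat_real (x : ℕ) : (s.setNat a i k x).real = s.real := rfl

@[simp] theorem setReal_real_self (x : ℝ) :
    (s.setReal a i k x).real a = upd (s.real a) i k x := by
  ext i' k'; simp [setReal, upd]

@[simp] theorem setReal_real_ne {a b : ℕ} (h : b ≠ a) (x : ℝ) :
    (s.setReal a i k x).real b = s.real b := by
  ext i' k'; simp [setReal, h]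

@[simp] theorem setReal_nat (x : ℝ) : (s.setReal a i k x).nat = s.nat := rfl

/-- The memories agree, except perhaps in the arrays in the lists. -/
def Agree (A B : List ℕ) (s s' : Memory) : Prop :=
  (∀ a ∉ A, s'.nat a = s.nat a) ∧ ∀ a ∉ B, s'.real a = s.real a

theorem Agree.refl (A B : List ℕ) (s : Memory) : Agree A B s s :=
  ⟨fun _ _ => rfl, fun _ _ => rfl⟩

theorem Agree.trans {A B : List ℕ} {s s' s'' : Memory} (h : Agree A B s s')
    (h' : Agree A B s' s'') : Agree A B s s'' :=
  ⟨fun a ha => (h'.1 a ha).trans (h.1 a ha), fun a ha => (h'.2 a ha).trans (h.2 a ha)⟩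

theorem Agree.mono {A B A' B' : List ℕ} {s s' : Memory} (h : Agree A B s s') (hA : A ⊆ A')
    (hB : B ⊆ B') : Agree A' B' s s' :=
  ⟨fun a ha => h.1 a fun h' => ha (hA h'), fun a ha => h.2 a fun h' => ha (hB h')⟩

end Memory

open Memory (Agree)

/-- The natural arrays that a program writes. -/
def Program.natW : Program → List ℕ
  | skip => []
  | setNat a _ _ _ => [a]
  | setReal _ _ _ _ => []
  | seq P Q => P.natW ++ Q.natW
  | ite _ P Q => P.natW ++ Q.natW
  | loop _ P => P.natW

/-- The real arrays that a program writes. -/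
def Program.realW : Program → List ℕ
  | skip => []
  | setNat _ _ _ _ => []
  | setReal a _ _ _ => [a]
  | seq P Q => P.realW ++ Q.realW
  | ite _ P Q => P.realW ++ Q.realW
  | loop _ P => P.realW

variable {O : Oracle}

/-- The frame rule. The arrays written are read off the syntax, so that `decide` can settle most
frame conditions. -/
theorem Runs.agree {P : Program} {s s' : Memory} {t : ℕ} (h : Runs O P s s' t) :
    Agree P.natW P.realW s s' := by
  induction h with
  | skip s => exact .refl _ _ _
  | setNat a i k x s =>
    exact ⟨fun b hb => s.setNat_nat_ne _ _ (by simpa [Program.natW] using hb) _, fun _ _ => rfl⟩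
  | setReal a i k x s =>
    exact ⟨fun _ _ => rfl, fun b hb => s.setReal_real_ne _ _ (by simpa [Program.realW] using hb) _⟩
  | seq _ _ ih ih' =>
    exact (ih.mono (List.subset_append_left _ _) (List.subset_append_left _ _)).trans
      (ih'.mono (List.subset_append_right _ _) (List.subset_append_right _ _))
  | ite_true _ _ ih => exact ih.mono (List.subset_append_left _ _) (List.subset_append_left _ _)
  | ite_false _ _ ih => exact ih.mono (List.subset_append_right _ _) (List.subset_append_right _ _)
  | loop_done _ => exact .refl _ _ _
  | loop_step _ _ _ ih ih' => exact Agree.trans ih ih'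

/-- Started in `s`, the program halts after at most `T` steps in a memory that satisfies `Q`. -/
def Spec (O : Oracle) (P : Program) (s : Memory) (T : ℕ) (Q : Memory → Prop) : Prop :=
  ∃ s' t, Runs O P s s' t ∧ t ≤ T ∧ Q s'

namespace Spec

variable {P P' : Program} {s : Memory} {T T' : ℕ} {Q Q' : Memory → Prop}

theorem imp (h : Spec O P s T Q) (hQ : ∀ s', Agree P.natW P.realW s s' → Q s' → Q' s') :
    Spec O P s T Q' := by
  obtain ⟨s', t, hr, ht, hq⟩ := h
  exact ⟨s', t, hr, ht, hQ s' hr.agree hq⟩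

theorem le (h : Spec O P s T Q) (hT : T ≤ T') : Spec O P s T' Q := by
  obtain ⟨s', t, hr, ht, hq⟩ := h
  exact ⟨s', t, hr, ht.trans hT, hq⟩

theorem skip (h : Q s) : Spec O .skip s 1 Q := ⟨_, _, .skip s, le_rfl, h⟩

theorem setNat {a : ℕ} {i k x : NatExpr}
    (h : Q (s.setNat a (i.eval s) (k.eval s) (x.eval s))) : Spec O (.setNat a i k x) s 1 Q :=
  ⟨_, _, .setNat a i k x s, le_rfl, h⟩

theorem setReal {a : ℕ} {i k : NatExpr} {x : RealExpr}
    (h : Q (s.setReal a (i.eval s) (k.eval s) (x.eval O s))) : Spec O (.setReal a i k x) s 1 Q :=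
  ⟨_, _, .setReal a i k x s, le_rfl, h⟩

theorem seq (h : Spec O P s T fun s' => Spec O P' s' T' Q) :
    Spec O (.seq P P') s (T + T') Q := by
  obtain ⟨s', t, hr, ht, s'', t', hr', ht', hq⟩ := h
  exact ⟨s'', _, .seq hr hr', Nat.add_le_add ht ht', hq⟩

/-- The first program in a sequence is described by its effect. -/
theorem seqImp (h : Spec O P s T Q')
    (h' : ∀ s', Agree P.natW P.realW s s' → Q' s' → Spec O P' s' T' Q) :
    Spec O (.seq P P') s (T + T') Q :=
  seq (h.imp h')

theorem ite {b : Test} (h : b.Holds O s → Spec O P s T Q)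
    (h' : ¬ b.Holds O s → Spec O P' s T Q) : Spec O (.ite b P P') s (T + 1) Q := by
  by_cases hb : b.Holds O s
  · obtain ⟨s', t, hr, ht, hq⟩ := h hb
    exact ⟨s', _, .ite_true hb hr, Nat.succ_le_succ ht, hq⟩
  · obtain ⟨s', t, hr, ht, hq⟩ := h' hb
    exact ⟨s', _, .ite_false hb hr, Nat.succ_le_succ ht, hq⟩

end Spec

/-! Abbreviations for programs -/

/-- The natural variable number `a`. -/
abbrev nv (a : ℕ) : NatExpr := .get a (.const 0) (.const 0)

/-- Entry `i` of a one-dimensional natural array. -/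
abbrev na (a : ℕ) (i : NatExpr) : NatExpr := .get a i (.const 0)

/-- The real variable number `a`. -/
abbrev rv (a : ℕ) : RealExpr := .get a (.const 0) (.const 0)

/-- Entry `i` of a one-dimensional real array. -/
abbrev ra (a : ℕ) (i : NatExpr) : RealExpr := .get a i (.const 0)

/-- A real constant. -/
abbrev rc (c : ℕ) : RealExpr := .ofNat (.const c)

/-- Equality of natural numbers. -/
def Test.eq (x y : NatExpr) : Test := .and (.not (.natLt x y)) (.not (.natLt y x))

/-- Disjunction. -/
def Test.or (b c : Test) : Test := .not (.and (.not b) (.not c))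

theorem Test.holds_eq {s : Memory} {x y : NatExpr} :
    (Test.eq x y).Holds O s ↔ x.eval s = y.eval s := by
  simp only [Test.eq, Test.Holds]; omega

theorem Test.holds_or {s : Memory} {b c : Test} :
    (Test.or b c).Holds O s ↔ b.Holds O s ∨ c.Holds O s := by
  simp only [Test.or, Test.Holds]; tauto

/-- Conditional execution. -/
def Program.when (b : Test) (P : Program) : Program := .ite b P .skip

/-- Run through the values of the counter `c` for which `b` holds. -/
def Program.count (c : ℕ) (b : Test) (P : Program) : Program :=
  .seq (.setNat c (.const 0) (.const 0) (.const 0))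
    (.loop b (.seq P (.setNat c (.const 0) (.const 0) (.add (nv c) (.const 1)))))

/-- Run through the values of the counter `c` below `n`. -/
def Program.forLt (c : ℕ) (n : NatExpr) (P : Program) : Program :=
  .count c (.natLt (nv c) n) P

theorem Spec.when {b : Test} {P : Program} {s : Memory} {T : ℕ} {Q : Memory → Prop}
    (hT : 1 ≤ T) (h : b.Holds O s → Spec O P s T Q) (h' : ¬ b.Holds O s → Q s) :
    Spec O (.when b P) s (T + 1) Q :=
  Spec.ite h fun hb => (Spec.skip (h' hb)).le hT

/-- The test is arbitrary as long as it amounts to comparing the counter with `n`: bounds such as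
`40000 * m` are products, which only real expressions can form. A round costs two steps besides the
body, for the test and the increment. -/
theorem Spec.count {c : ℕ} {b : Test} {P : Program} {s : Memory} {n N T : ℕ}
    (Inv : ℕ → Memory → Prop) (hN : n ≤ N) (hc : c ∉ P.natW)
    (hb : ∀ s', Agree (c :: P.natW) P.realW s s' → (b.Holds O s' ↔ s'.nat c 0 0 < n))
    (h0 : Inv 0 (s.setNat c 0 0 0))
    (hstep : ∀ k < n, ∀ s', Agree (c :: P.natW) P.realW s s' → s'.nat c 0 0 = k → Inv k s' →
      Spec O P s' T fun s'' => Inv (k + 1) (s''.setNat c 0 0 (k + 1))) :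
    Spec O (.count c b P) s (N * (T + 2) + 2)
      fun s' => Inv n s' ∧ Agree (c :: P.natW) P.realW s s' := by
  have main : ∀ d k, k + d = n → ∀ s', Agree (c :: P.natW) P.realW s s' → s'.nat c 0 0 = k →
      Inv k s' → Spec O (.loop b (.seq P (.setNat c (.const 0) (.const 0)
        (.add (nv c) (.const 1))))) s' (d * (T + 2) + 1)
      fun s' => Inv n s' ∧ Agree (c :: P.natW) P.realW s s' := by
    intro d
    induction d with
    | zero =>
      intro k hk s' hs hks hI
      obtain rfl : k = n := by omega
      exact ⟨s', 1, .loop_done (by rw [hb s' hs, hks]; exact lt_irrefl _), by omega, hI, hs⟩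
    | succ d ih =>
      intro k hk s' hs hks hI
      obtain ⟨s'', t, hr, ht, hI'⟩ := hstep k (by omega) s' hs hks hI
      have hcs : s''.nat c 0 0 = k := by rw [hr.agree.1 c hc, hks]
      have hs'' : Agree (c :: P.natW) P.realW s (s''.setNat c 0 0 (k + 1)) := by
        refine (hs.trans (hr.agree.mono (List.subset_cons_self _ _) (List.Subset.refl _))).trans ?_
        exact ⟨fun a ha => s''.setNat_nat_ne _ _ (fun h => ha (by rw [h]; exact List.mem_cons_self)) _,
          fun _ _ => rfl⟩
      obtain ⟨s3, t3, hr3, ht3, hI3⟩ := ih (k + 1) (by omega) _ hs'' (by simp) hI'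
      have hset : Runs O (.setNat c (.const 0) (.const 0) (.add (nv c) (.const 1))) s''
          (s''.setNat c 0 0 (k + 1)) 1 := by
        have := Runs.setNat (O := O) c (.const 0) (.const 0) (.add (nv c) (.const 1)) s''
        simpa [NatExpr.eval, hcs] using this
      refine ⟨s3, _, .loop_step ((hb s' hs).2 (by omega)) (.seq hr hset) hr3, ?_, hI3⟩
      rw [Nat.succ_mul]
      omega
  obtain ⟨s', t, hr, ht, hI⟩ := main n 0 (by omega) (s.setNat c 0 0 0)
    ⟨fun a ha => s.setNat_nat_ne _ _ (fun h => ha (by rw [h]; exact List.mem_cons_self)) _, fun _ _ => rfl⟩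
    (by simp) h0
  refine ⟨s', _, .seq (.setNat c _ _ _ s) hr, ?_, hI⟩
  have := Nat.mul_le_mul_right (T + 2) hN
  omega

theorem Spec.forLt {c : ℕ} {e : NatExpr} {P : Program} {s : Memory} {n N T : ℕ}
    (Inv : ℕ → Memory → Prop) (hN : n ≤ N) (hc : c ∉ P.natW)
    (he : ∀ s', Agree (c :: P.natW) P.realW s s' → e.eval s' = n)
    (h0 : Inv 0 (s.setNat c 0 0 0))
    (hstep : ∀ k < n, ∀ s', Agree (c :: P.natW) P.realW s s' → s'.nat c 0 0 = k → Inv k s' →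
      Spec O P s' T fun s'' => Inv (k + 1) (s''.setNat c 0 0 (k + 1))) :
    Spec O (.forLt c e P) s (N * (T + 2) + 2)
      fun s' => Inv n s' ∧ Agree (c :: P.natW) P.realW s s' :=
  Spec.count Inv hN hc (fun s' hs => by simp [Test.Holds, NatExpr.eval, he s' hs]) h0 hstep

/-! Programs that do not use an array do not depend on it -/

/-- The expression does not read the natural array `a`. -/
def NatExpr.Avoids (a : ℕ) : NatExpr → Prop
  | const _ => True
  | get b i k => b ≠ a ∧ i.Avoids a ∧ k.Avoids a
  | add x y => x.Avoids a ∧ y.Avoids a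
  | sub x y => x.Avoids a ∧ y.Avoids a

/-- The expression does not read the natural array `a`. -/
def RealExpr.Avoids (a : ℕ) : RealExpr → Prop
  | ofNat x => x.Avoids a
  | get _ i k => i.Avoids a ∧ k.Avoids a
  | add x y => x.Avoids a ∧ y.Avoids a
  | sub x y => x.Avoids a ∧ y.Avoids a
  | mul x y => x.Avoids a ∧ y.Avoids a
  | div x y => x.Avoids a ∧ y.Avoids a
  | accept j x => j.Avoids a ∧ x.Avoids a
  | quantile j x => j.Avoids a ∧ x.Avoids a
  | bestPrice j x y => j.Avoids a ∧ x.Avoids a ∧ y.Avoids a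

/-- The test does not read the natural array `a`. -/
def Test.Avoids (a : ℕ) : Test → Prop
  | natLt x y => x.Avoids a ∧ y.Avoids a
  | realLt x y => x.Avoids a ∧ y.Avoids a
  | not b => b.Avoids a
  | and b c => b.Avoids a ∧ c.Avoids a

/-- The program does not use the natural array `a`. -/
def Program.Avoids (a : ℕ) : Program → Prop
  | skip => True
  | setNat b i k x => b ≠ a ∧ i.Avoids a ∧ k.Avoids a ∧ x.Avoids a
  | setReal _ i k x => i.Avoids a ∧ k.Avoids a ∧ x.Avoids a
  | seq P Q => P.Avoids a ∧ Q.Avoids a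
  | ite b P Q => b.Avoids a ∧ P.Avoids a ∧ Q.Avoids a
  | loop b P => b.Avoids a ∧ P.Avoids a

/-- Replace the natural array `a`. -/
def Memory.withArray (s : Memory) (a : ℕ) (A : ℕ → ℕ → ℕ) : Memory where
  nat b := if b = a then A else s.nat b
  real := s.real

theorem NatExpr.eval_withArray {a : ℕ} {e : NatExpr} (h : e.Avoids a) (s : Memory)
    (A : ℕ → ℕ → ℕ) : e.eval (s.withArray a A) = e.eval s := by
  induction e with
  | const c => rfl
  | get b i k ih ih' =>
    simp only [NatExpr.eval, ih h.2.1, ih' h.2.2]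
    simp [Memory.withArray, h.1]
  | add x y ih ih' => simp only [NatExpr.eval, ih h.1, ih' h.2]
  | sub x y ih ih' => simp only [NatExpr.eval, ih h.1, ih' h.2]

theorem RealExpr.eval_withArray {a : ℕ} {e : RealExpr} (h : e.Avoids a) (s : Memory)
    (A : ℕ → ℕ → ℕ) : e.eval O (s.withArray a A) = e.eval O s := by
  induction e with
  | ofNat x => simp only [RealExpr.eval, NatExpr.eval_withArray h]
  | get b i k =>
    simp only [RealExpr.eval, NatExpr.eval_withArray h.1, NatExpr.eval_withArray h.2]
    rfl
  | add x y ih ih' => simp only [RealExpr.eval, ih h.1, ih' h.2]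
  | sub x y ih ih' => simp only [RealExpr.eval, ih h.1, ih' h.2]
  | mul x y ih ih' => simp only [RealExpr.eval, ih h.1, ih' h.2]
  | div x y ih ih' => simp only [RealExpr.eval, ih h.1, ih' h.2]
  | accept j x ih => simp only [RealExpr.eval, NatExpr.eval_withArray h.1, ih h.2]
  | quantile j x ih => simp only [RealExpr.eval, NatExpr.eval_withArray h.1, ih h.2]
  | bestPrice j x y ih ih' =>
    simp only [RealExpr.eval, NatExpr.eval_withArray h.1, ih h.2.1, ih' h.2.2]

theorem Test.holds_withArray {a : ℕ} {b : Test} (h : b.Avoids a) (s : Memory)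
    (A : ℕ → ℕ → ℕ) : b.Holds O (s.withArray a A) ↔ b.Holds O s := by
  induction b with
  | natLt x y => simp only [Test.Holds, NatExpr.eval_withArray h.1, NatExpr.eval_withArray h.2]
  | realLt x y => simp only [Test.Holds, RealExpr.eval_withArray h.1, RealExpr.eval_withArray h.2]
  | not b ih => simp only [Test.Holds, ih h]
  | and b c ih ih' => simp only [Test.Holds, ih h.1, ih' h.2]

/-- Applied to array `4`, which holds the queried set: the prices are computed by the same run
whatever the set is. -/
theorem Runs.withArray {a : ℕ} {P : Program} {s s' : Memory} {t : ℕ} (h : Runs O P s s' t)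
    (ha : P.Avoids a) (A : ℕ → ℕ → ℕ) : Runs O P (s.withArray a A) (s'.withArray a A) t := by
  induction h with
  | skip s => exact .skip _
  | setNat b i k x s =>
    have := Runs.setNat (O := O) b i k x (s.withArray a A)
    rw [NatExpr.eval_withArray ha.2.1, NatExpr.eval_withArray ha.2.2.1,
      NatExpr.eval_withArray ha.2.2.2] at this
    convert this using 1
    simp only [Memory.withArray, Memory.setNat, Memory.mk.injEq, and_true]
    ext c i' k'
    by_cases hc : c = a
    · simp [hc, ha.1.symm]
    · simp [hc]
  | setReal b i k x s =>
    have := Runs.setReal (O := O) b i k x (s.withArray a A)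
    rwa [NatExpr.eval_withArray ha.1, NatExpr.eval_withArray ha.2.1,
      RealExpr.eval_withArray ha.2.2] at this
  | seq _ _ ih ih' => exact .seq (ih ha.1) (ih' ha.2)
  | ite_true hb _ ih => exact .ite_true ((Test.holds_withArray ha.1 _ _).2 hb) (ih ha.2.1)
  | ite_false hb _ ih => exact .ite_false (fun h => hb ((Test.holds_withArray ha.1 _ _).1 h)) (ih ha.2.2)
  | loop_done hb => exact .loop_done fun h => hb ((Test.holds_withArray ha.1 _ _).1 h)
  | loop_step hb _ _ ih ih' =>
    exact .loop_step ((Test.holds_withArray ha.1 _ _).2 hb) (ih ha.2) (ih' ha)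

end PostedPricing

namespace PostedPricing

open Memory (Agree)

attribute [local simp] NatExpr.eval RealExpr.eval Test.Holds Test.holds_eq Test.holds_or

/-! ### The program

Natural arrays: `0`-`4` input, `5`-`8` and `13` counters, `10`-`12` the best column found so far,
`14` the order of peeling, `15` first end points, `16` the answer, `17` the next vertex to be peeled
off, `18` the chosen candidates.
Real arrays: `0` final prices, `1`-`3` prices, probabilities and revenues of the candidates, `4`
lengths (minus one), `5` loads, `6` maximal load, `7` and `8` accumulated revenues and
probabilities, `9` and `10` best and current value in a search, `11` degree, `12` and `13` current
revenues and probabilities, `14` and `15` the bound and one of its terms. -/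

/-- The number of services. -/
abbrev mE : NatExpr := na 0 (.const 2)

/-- The number of agents. -/
abbrev nE : NatExpr := na 0 (.const 1)

/-- The number of vertices. -/
abbrev vE : NatExpr := na 0 (.const 0)

/-- Whether counter `6` is the index of a candidate. -/
def isCand : Test := .realLt (.ofNat (nv 6)) (.add (.mul (rc 40000) (.ofNat mE)) (rc 2))

def candPriceP : Program :=
  .ite (.realLt (.mul (rc 40000) (.ofNat mE)) (.ofNat (nv 6)))
    (.setReal 1 (nv 5) (nv 6) (.bestPrice (nv 5)
      (.mul (.div (rc 201) (rc 200)) (.quantile (nv 5) (.div (rc 1) (.mul (rc 200) (.ofNat mE)))))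
      (.div (rc 1) (rc 200))))
    (.setReal 1 (nv 5) (nv 6)
      (.quantile (nv 5) (.div (.ofNat (nv 6)) (.mul (rc 40000) (.ofNat mE)))))

def candP : Program :=
  .seq
    (.ite (.natLt (nv 6) (.const 1))
      (.seq (.setReal 1 (nv 5) (nv 6) (rc 0)) (.setReal 2 (nv 5) (nv 6) (rc 0)))
      (.seq candPriceP
        (.setReal 2 (nv 5) (nv 6) (.accept (nv 5) (.get 1 (nv 5) (nv 6))))))
    (.setReal 3 (nv 5) (nv 6) (.mul (.get 1 (nv 5) (nv 6)) (.get 2 (nv 5) (nv 6))))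

/-- Compute the candidate prices. -/
def tablesP : Program := .forLt 5 mE (.count 6 isCand candP)

/-- Compare the column for service `5`, price `6` and its end point in array `a` with the best. -/
def columnP (a : ℕ) : Program :=
  .seq (.setNat 13 (.const 0) (.const 0) (na a (nv 5)))
  (.seq (.setReal 10 (.const 0) (.const 0) (.div (.get 3 (nv 5) (nv 6))
      (.add (.mul (.get 2 (nv 5) (nv 6)) (.add (.add (.get 4 (na 1 (nv 5)) (.const 0)) (rc 1))
        (.add (.get 4 (nv 13) (.const 1)) (rc 1)))) (.add (.get 4 (nv 5) (.const 2)) (rc 1)))))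
  (.when (.realLt (rv 9) (rv 10))
    (.seq (.setReal 9 (.const 0) (.const 0) (rv 10))
    (.seq (.setNat 10 (.const 0) (.const 0) (nv 5))
    (.seq (.setNat 11 (.const 0) (.const 0) (nv 6))
      (.setNat 12 (.const 0) (.const 0) (nv 13)))))))

/-- Find the best column. -/
def searchP : Program :=
  .seq (.setReal 9 (.const 0) (.const 0) (.sub (rc 0) (rc 1)))
    (.forLt 5 mE (.count 6 isCand (.seq (columnP 2) (columnP 3))))

/-- Add `x` to the load of row `r, c`. -/
def bumpP (r : NatExpr) (c : ℕ) (x : RealExpr) : Program :=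
  .seq (.setReal 4 r (.const c) (.add (.get 4 r (.const c))
    (.mul (.add (.get 4 r (.const c)) (rc 1)) (.mul (.div (rc 1) (rc 200)) x))))
  (.seq (.setReal 5 r (.const c) (.add (.get 5 r (.const c)) x))
  (.when (.realLt (rv 6) (.get 5 r (.const c)))
    (.setReal 6 (.const 0) (.const 0) (.get 5 r (.const c)))))

def packStepP : Program :=
  .seq searchP
  (.seq (bumpP (na 1 (nv 10)) 0 (.get 2 (nv 10) (nv 11)))
  (.seq (bumpP (nv 12) 1 (.get 2 (nv 10) (nv 11)))
  (.seq (bumpP (nv 10) 2 (rc 1))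
  (.seq (.setReal 7 (nv 10) (.const 0) (.add (ra 7 (nv 10)) (.get 3 (nv 10) (nv 11))))
    (.setReal 8 (nv 10) (.const 0) (.add (ra 8 (nv 10)) (.get 2 (nv 10) (nv 11))))))))

/-- The packing algorithm. -/
def packP : Program :=
  .count 7 (.realLt (.ofNat (nv 7))
    (.mul (.mul (rc 40000) (.ofNat (.add (.add nE vE) mE))) (.ofNat mE))) packStepP

/-- Compute the degree of vertex `8`. -/
def degreeP : Program :=
  .seq (.setReal 11 (.const 0) (.const 0) (rc 0))
    (.forLt 5 mE (.when
      (.and (.and (.natLt (na 14 (na 2 (nv 5))) (.const 1))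
          (.natLt (na 14 (na 3 (nv 5))) (.const 1)))
        (.or (.eq (na 2 (nv 5)) (nv 8)) (.eq (na 3 (nv 5)) (nv 8))))
      (.setReal 11 (.const 0) (.const 0) (.add (rv 11) (ra 8 (nv 5))))))

def peelStepP : Program :=
  .seq
    (.forLt 8 vE (.when (.natLt (na 14 (nv 8)) (.const 1))
      (.seq degreeP (.when (.not (.realLt (.mul (rc 2) (rv 6)) (rv 11)))
        (.setNat 17 (.const 0) (.const 0) (nv 8))))))
    (.setNat 14 (nv 17) (.const 0) (.add (nv 7) (.const 1)))

/-- The peeling order. -/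
def peelP : Program := .forLt 7 vE peelStepP

/-- The first end points. -/
def firstP : Program :=
  .forLt 5 mE (.ite (.natLt (na 14 (na 2 (nv 5))) (na 14 (na 3 (nv 5))))
    (.setNat 15 (nv 5) (.const 0) (na 2 (nv 5))) (.setNat 15 (nv 5) (.const 0) (na 3 (nv 5))))

/-- Scale the average revenues and probabilities. -/
def scaleP : Program :=
  .forLt 5 mE
    (.seq (.setReal 12 (nv 5) (.const 0) (.mul (.div (rc 1) (.mul (rc 5) (rv 6))) (ra 7 (nv 5))))
      (.setReal 13 (nv 5) (.const 0) (.mul (.div (rc 1) (.mul (rc 5) (rv 6))) (ra 8 (nv 5)))))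

/-- Compute the bound on the revenue. -/
def boundP : Program :=
  .seq (.setReal 14 (.const 0) (.const 0) (rc 0))
  (.forLt 8 mE
    (.seq (.setReal 15 (.const 0) (.const 0) (rc 1))
    (.seq (.forLt 13 mE (.when (.and (.not (.eq (nv 13) (nv 8)))
          (.or (.eq (na 1 (nv 13)) (na 1 (nv 8))) (.eq (na 15 (nv 13)) (na 15 (nv 8)))))
        (.setReal 15 (.const 0) (.const 0) (.mul (rv 15) (.sub (rc 1) (ra 13 (nv 13)))))))
      (.setReal 14 (.const 0) (.const 0) (.add (rv 14) (.mul (ra 12 (nv 8)) (rv 15)))))))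

/-- Try candidate `6` for service `5`. -/
def tryP : Program :=
  .seq (.setReal 12 (nv 5) (.const 0) (.get 3 (nv 5) (nv 6)))
  (.seq (.setReal 13 (nv 5) (.const 0) (.get 2 (nv 5) (nv 6)))
  (.seq boundP
  (.when (.or (.natLt (nv 6) (.const 1)) (.realLt (rv 9) (rv 14)))
    (.seq (.setReal 9 (.const 0) (.const 0) (rv 14))
      (.setNat 11 (.const 0) (.const 0) (nv 6))))))

/-- Fix the candidate for service `5`. -/
def fixP : Program :=
  .seq (.setReal 12 (nv 5) (.const 0) (.get 3 (nv 5) (nv 11)))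
  (.seq (.setReal 13 (nv 5) (.const 0) (.get 2 (nv 5) (nv 11)))
  (.seq (.setReal 0 (nv 5) (.const 0) (.get 1 (nv 5) (nv 11)))
    (.setNat 18 (nv 5) (.const 0) (nv 11))))

/-- Choose one candidate for each service. -/
def chooseP : Program := .forLt 5 mE (.seq (.count 6 isCand tryP) fixP)

/-- Decide whether the given set is in the restricted system. -/
def checkP : Program :=
  .seq (.setNat 16 (.const 0) (.const 0) (.const 1))
  (.seq (.forLt 5 mE (.forLt 6 mE
    (.when (.and (.eq (na 4 (nv 5)) (.const 1)) (.or (.eq (na 18 (nv 5)) (.const 0))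
        (.and (.and (.eq (na 4 (nv 6)) (.const 1)) (.not (.eq (nv 6) (nv 5))))
          (.or (.eq (na 1 (nv 6)) (na 1 (nv 5))) (.eq (na 15 (nv 6)) (na 15 (nv 5)))))))
      (.setNat 16 (.const 0) (.const 0) (.const 0)))))
    -- Array `0` holds the sizes, so the answer is kept in array `16` while the loops run.
    (.setNat 0 (.const 0) (.const 0) (nv 16)))

def pricesP : Program :=
  .seq tablesP (.seq packP (.seq peelP (.seq firstP (.seq scaleP chooseP))))

/-- The whole program. -/
def opmProgram : Program := .seq pricesP checkP

theorem pricesP_avoids : pricesP.Avoids 4 := by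
  simp [pricesP, tablesP, packP, peelP, firstP, scaleP, chooseP, packStepP, peelStepP, searchP,
    bumpP, columnP, degreeP, candP, candPriceP, isCand, tryP, fixP, boundP, Program.forLt,
    Program.count, Program.when, Program.Avoids, Test.Avoids, NatExpr.Avoids, RealExpr.Avoids,
    Test.eq, Test.or]

/-! ### Correctness of the candidate entries -/

variable {O : Oracle} {D : Tables} {s : Memory} {z : ℕ}

/-- The memory holds the combinatorial part of the instance. -/
structure Loaded (D : Tables) (s : Memory) : Prop where
  numV : s.nat 0 0 0 = D.V
  numN : s.nat 0 1 0 = D.n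
  numM : s.nat 0 2 0 = D.m
  own : ∀ j, s.nat 1 j 0 = D.own j
  lft : ∀ j, s.nat 2 j 0 = D.lft j
  rgt : ∀ j, s.nat 3 j 0 = D.rgt j
  K_eq : D.K = 40000 * D.m + 2

theorem Loaded.agree {A B : List ℕ} {s s' : Memory} (h : Loaded D s) (ha : Agree A B s s')
    (hA : ∀ a < 4, a ∉ A) : Loaded D s' where
  numV := by rw [ha.1 0 (hA 0 (by norm_num)), h.numV]
  numN := by rw [ha.1 0 (hA 0 (by norm_num)), h.numN]
  numM := by rw [ha.1 0 (hA 0 (by norm_num)), h.numM]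
  own j := by rw [ha.1 1 (hA 1 (by norm_num)), h.own]
  lft j := by rw [ha.1 2 (hA 2 (by norm_num)), h.lft]
  rgt j := by rw [ha.1 3 (hA 3 (by norm_num)), h.rgt]
  K_eq := h.K_eq

theorem Loaded.isCand_iff {s : Memory} (h : Loaded D s) :
    isCand.Holds O s ↔ s.nat 6 0 0 < D.K := by
  simp only [isCand, Test.Holds, RealExpr.eval, NatExpr.eval, h.numM, h.K_eq]
  exact_mod_cast Iff.rfl

/-- The entries for candidate `k` of service `j` are correct. -/
def CandOK (O : Oracle) (m j k : ℕ) (s : Memory) : Prop :=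
  s.real 1 j k = O.candPrice m j k ∧ s.real 2 j k = O.candProb m j k ∧
    s.real 3 j k = O.candPrice m j k * O.candProb m j k

theorem candPriceP_spec (h : Loaded D s) (hk : s.nat 6 0 0 ≠ 0) : Spec O candPriceP s 2
    fun s' => s'.real 1 = upd (s.real 1) (s.nat 5 0 0) (s.nat 6 0 0)
      (O.candPrice D.m (s.nat 5 0 0) (s.nat 6 0 0)) := by
  refine Spec.ite (T := 1) (fun hb => Spec.setReal ?_) (fun hb => Spec.setReal ?_)
  · have hb' : ¬ s.nat 6 0 0 ≤ 40000 * D.m := by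
      simp [h.numM] at hb
      exact_mod_cast not_le.2 hb
    simp [Oracle.candPrice, hk, hb', h.numM]
  · have hb' : s.nat 6 0 0 ≤ 40000 * D.m := by
      simp [h.numM] at hb
      exact_mod_cast hb
    simp [Oracle.candPrice, hk, hb', h.numM]

theorem candP_spec (h : Loaded D s) : Spec O candP s 5 fun s' => ∃ a b c,
    s'.real 1 = upd (s.real 1) (s.nat 5 0 0) (s.nat 6 0 0) a ∧
    s'.real 2 = upd (s.real 2) (s.nat 5 0 0) (s.nat 6 0 0) b ∧
    s'.real 3 = upd (s.real 3) (s.nat 5 0 0) (s.nat 6 0 0) c ∧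
    a = O.candPrice D.m (s.nat 5 0 0) (s.nat 6 0 0) ∧
    b = O.candProb D.m (s.nat 5 0 0) (s.nat 6 0 0) ∧ c = a * b := by
  refine Spec.seq (T := 4) (T' := 1) (Spec.ite (T := 3) (fun hb => ?_) fun hb => ?_)
  · have hk : s.nat 6 0 0 = 0 := by simpa using hb
    refine (Spec.seq (Spec.setReal (Spec.setReal (Spec.setReal ?_)))).le (by norm_num)
    refine ⟨0, 0, 0, ?_⟩
    simp [hk, Oracle.candPrice, Oracle.candProb]
  · have hk : s.nat 6 0 0 ≠ 0 := by simp at hb; omega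
    refine Spec.seq (T := 2) (T' := 1) ((candPriceP_spec h hk).imp fun s' hs hp =>
      Spec.setReal (Spec.setReal ?_))
    have h1 := hs.1 5 (by decide)
    have h2 := hs.1 6 (by decide)
    have h3 := hs.2 2 (by decide)
    have h4 := hs.2 3 (by decide)
    refine ⟨_, O.candProb D.m (s.nat 5 0 0) (s.nat 6 0 0), _, ?_, ?_, ?_, rfl, rfl, rfl⟩
    · simp [hp, h1, h2]
    · simp [h1, h2, h3, hp, Oracle.candProb, hk]
    · simp [h1, h2, h4, hp, Oracle.candProb, hk]

end PostedPricing

/-! ### Correctness of the tables and of the packing program -/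

namespace PostedPricing

open Memory (Agree)

attribute [local simp] NatExpr.eval RealExpr.eval Test.Holds Test.holds_eq Test.holds_or

variable {O : Oracle} {D : Tables} {s : Memory} {z : ℕ}

theorem tablesP_spec (h : Loaded D s) (hm : D.m ≤ z) (hK : D.K ≤ z) :
    Spec O tablesP s (z * (z * 7 + 4) + 2)
      fun s' => ∀ j < D.m, ∀ k < D.K, CandOK O D.m j k s' := by
  refine (Spec.forLt (n := D.m) (fun j s' => ∀ j' < j, ∀ k < D.K, CandOK O D.m j' k s') hm
    (by decide) (fun s' hs => ?_) (by simp) fun j hj s' hs hsj hI => ?_).imp fun s' _ hI => hI.1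
  · simpa using (h.agree hs (by decide)).numM
  have h' := h.agree hs (by decide)
  refine (Spec.count (n := D.K) (fun k s'' => (∀ j' < j, ∀ k < D.K, CandOK O D.m j' k s'') ∧
    ∀ k' < k, CandOK O D.m j k' s'') hK (by decide) (fun s'' hs' => ?_) ⟨?_, by simp⟩
    fun k hk s'' hs' hsk hI' => ?_).imp fun s'' _ hI' => ?_
  · exact (h'.agree hs' (by decide)).isCand_iff
  · exact fun j' hj' k hk => by simpa [CandOK] using hI j' hj' k hk
  · have h'' := h'.agree hs' (by decide)
    have h5 : s''.nat 5 0 0 = j := by rw [hs'.1 5 (by decide), hsj]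
    refine (candP_spec h'').imp fun s3 hs3 hp => ?_
    obtain ⟨a, b, c, h1, h2, h3, h4⟩ := hp
    rw [h5, hsk] at h1 h2 h3 h4
    have hother : ∀ j' k', ¬(j' = j ∧ k' = k) → CandOK O D.m j' k' s'' →
        CandOK O D.m j' k' (s3.setNat 6 0 0 (k + 1)) := by
      intro j' k' hne hok
      simpa [CandOK, h1, h2, h3, upd_ne _ _ hne] using hok
    refine ⟨fun j' hj' k' hk' => hother j' k' (fun h => hj'.ne h.1) (hI'.1 j' hj' k' hk'),
      fun k' hk' => ?_⟩
    rcases Nat.lt_succ_iff_lt_or_eq.1 hk' with h6 | rfl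
    · exact hother j k' (fun h => h6.ne h.2) (hI'.2 k' h6)
    · simp [CandOK, h1, h2, h3, h4]
  · intro j' hj' k hk
    have : CandOK O D.m j' k s'' := by
      rcases Nat.lt_succ_iff_lt_or_eq.1 hj' with h6 | rfl
      · exact hI'.1.1 j' h6 k hk
      · exact hI'.1.2 k hk
    simpa [CandOK] using this

/-- The memory holds the probabilities and revenues of the candidates. -/
def Filled (D : Tables) (s : Memory) : Prop :=
  ∀ j < D.m, ∀ k < D.K, s.real 2 j k = D.q j k ∧ s.real 3 j k = D.w j k

theorem Filled.agree {A B : List ℕ} {s s' : Memory} (h : Filled D s) (ha : Agree A B s s')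
    (h2 : 2 ∉ B) (h3 : 3 ∉ B) : Filled D s' := by
  intro j hj k hk
  rw [ha.2 2 h2, ha.2 3 h3]
  exact h j hj k hk

/-- The lengths stored in the memory. -/
def Memory.len (s : Memory) : ℕ → ℕ → ℝ := fun r c => s.real 4 r c + 1

@[simp] theorem Memory.len_setNat (s : Memory) (a i k x : ℕ) : (s.setNat a i k x).len = s.len :=
  rfl

/-- The best column found so far is at least as good as the columns in `vis`. -/
def SearchInv (D : Tables) (len : ℕ → ℕ → ℝ) (vis : ℕ → ℕ → ℕ → Prop) (s : Memory) : Prop :=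
  (∀ j k u, vis j k u → D.w j k / D.cost len j k u ≤ s.real 9 0 0) ∧
  -- The value `-1` is the initial one, below every ratio; with it no column is recorded.
  (s.real 9 0 0 = -1 ∨ s.nat 10 0 0 < D.m ∧ s.nat 11 0 0 < D.K ∧
    (s.nat 12 0 0 = D.lft (s.nat 10 0 0) ∨ s.nat 12 0 0 = D.rgt (s.nat 10 0 0)) ∧
    s.real 9 0 0 = D.w (s.nat 10 0 0) (s.nat 11 0 0) /
      D.cost len (s.nat 10 0 0) (s.nat 11 0 0) (s.nat 12 0 0))

theorem SearchInv.mono {len : ℕ → ℕ → ℝ} {vis vis' : ℕ → ℕ → ℕ → Prop} {s : Memory}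
    (h : SearchInv D len vis s) (hv : ∀ j k u, vis' j k u → vis j k u) :
    SearchInv D len vis' s :=
  ⟨fun j k u hu => h.1 j k u (hv j k u hu), h.2⟩

theorem SearchInv.setNat {len : ℕ → ℕ → ℝ} {vis : ℕ → ℕ → ℕ → Prop} {s : Memory}
    (h : SearchInv D len vis s) {a : ℕ} (h10 : 10 ≠ a) (h11 : 11 ≠ a) (h12 : 12 ≠ a) (x : ℕ) :
    SearchInv D len vis (s.setNat a 0 0 x) := by
  simpa [SearchInv, h10, h11, h12] using h

theorem columnP_spec (h : Loaded D s) (hf : Filled D s) {a : ℕ} {e : ℕ → ℕ}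
    (ha : a = 2 ∧ e = D.lft ∨ a = 3 ∧ e = D.rgt) {len : ℕ → ℕ → ℝ} (hlen : s.len = len)
    {vis : ℕ → ℕ → ℕ → Prop} (hI : SearchInv D len vis s) (hj : s.nat 5 0 0 < D.m)
    (hk : s.nat 6 0 0 < D.K) : Spec O (columnP a) s 7 fun s' =>
      SearchInv D len (fun j k u => vis j k u ∨
        (j = s.nat 5 0 0 ∧ k = s.nat 6 0 0 ∧ u = e (s.nat 5 0 0))) s' := by
  have hu : s.nat a (s.nat 5 0 0) 0 = e (s.nat 5 0 0) := by
    rcases ha with ⟨rfl, rfl⟩ | ⟨rfl, rfl⟩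
    · exact h.lft _
    · exact h.rgt _
  have hu' : e (s.nat 5 0 0) = D.lft (s.nat 5 0 0) ∨ e (s.nat 5 0 0) = D.rgt (s.nat 5 0 0) := by
    rcases ha with ⟨rfl, rfl⟩ | ⟨rfl, rfl⟩ <;> simp
  obtain ⟨hq, hw⟩ := hf _ hj _ hk
  refine (Spec.seq (T := 1) (T' := 6) (Spec.setNat (Spec.seq (T := 1) (T' := 5)
    (Spec.setReal (Spec.when (T := 4) (by norm_num) (fun hb => ?_) fun hb => ?_)))))
  · refine (Spec.seq (Spec.setReal (Spec.seq (Spec.setNat (Spec.seq (Spec.setNat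
      (Spec.setNat ?_))))))).le (by norm_num)
    simp [hu, h.own, hq, hw] at hb
    simp only [SearchInv, Tables.cost, ← hlen, Memory.len] at hI ⊢
    simp [hu, h.own, hq, hw, hj, hk, hu']
    rintro j k u (hv | ⟨rfl, rfl, rfl⟩)
    · exact (hI.1 j k u hv).trans hb.le
    · exact le_rfl
  · simp [hu, h.own, hq, hw] at hb
    simp only [SearchInv, Tables.cost, ← hlen, Memory.len] at hI ⊢
    refine ⟨?_, by simpa using hI.2⟩
    rintro j k u (hv | ⟨rfl, rfl, rfl⟩)
    · simpa using hI.1 j k u hv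
    · simpa using hb

theorem searchP_spec (hD : D.Valid) (h : Loaded D s) (hf : Filled D s) (hm : D.m ≤ z)
    (hK : D.K ≤ z) (hm0 : 0 < D.m) (hlen : ∀ r c, 0 ≤ s.len r c) :
    Spec O searchP s (z * (z * 16 + 4) + 3) fun s' => ∃ j k u,
      s'.nat 10 0 0 = j ∧ s'.nat 11 0 0 = k ∧ s'.nat 12 0 0 = u ∧ j < D.m ∧ k < D.K ∧
      (u = D.lft j ∨ u = D.rgt j) ∧
      ∀ j' < D.m, ∀ k' < D.K, ∀ u', u' = D.lft j' ∨ u' = D.rgt j' →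
        D.w j' k' / D.cost s.len j' k' u' ≤ D.w j k / D.cost s.len j k u := by
  obtain ⟨len, hlen'⟩ : ∃ len, s.len = len := ⟨_, rfl⟩
  rw [hlen'] at hlen ⊢
  have hs0 : Agree [] [9] s (s.setReal 9 0 0 (-1)) := ⟨fun _ _ => rfl, fun a ha => by
    rw [Memory.setReal_real_ne _ _ _ (by simpa using ha)]⟩
  have h0 := h.agree hs0 (by simp)
  have hf0 := hf.agree hs0 (by simp) (by simp)
  have hlen0 : (s.setReal 9 0 0 (-1)).len = len := by rw [← hlen']; ext; simp [Memory.len]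
  have hstart : SearchInv D len (fun _ _ _ => False) (s.setReal 9 0 0 (-1)) := by
    simp [SearchInv]
  have hset : Spec O (.setReal 9 (.const 0) (.const 0) (.sub (rc 0) (rc 1))) s 1
      fun s' => s' = s.setReal 9 0 0 (-1) := Spec.setReal (by simp)
  refine (Spec.seqImp (T := 1) (T' := z * (z * 16 + 4) + 2) hset fun s0 _ e => ?_).le (by omega)
  subst e
  refine (Spec.forLt (n := D.m) (T := z * 16 + 2) (fun j s' => SearchInv D len
    (fun j' k' u' => j' < j ∧ k' < D.K ∧ (u' = D.lft j' ∨ u' = D.rgt j')) s') hm (by decide)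
    (fun s' hs => ?_) ?_ fun j hj s' hs hsj hI => ?_).imp fun s' _ hI => ?_
  · simpa using (h0.agree hs (by decide)).numM
  · exact (hstart.mono (by simp)).setNat (by decide) (by decide) (by decide) _
  · have h' := h0.agree hs (by decide)
    have hf' := hf0.agree hs (by decide) (by decide)
    have hlen1 : s'.len = len := by
      rw [← hlen0]; ext; simp only [Memory.len]; rw [hs.2 4 (by decide)]
    refine (Spec.count (n := D.K) (T := 14) (fun k s'' => SearchInv D len
      (fun j' k' u' => (j' < j ∧ k' < D.K ∨ j' = j ∧ k' < k) ∧ (u' = D.lft j' ∨ u' = D.rgt j'))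
      s'') hK (by decide) (fun s'' hs' => (h'.agree hs' (by decide)).isCand_iff) ?_
      fun k hk s'' hs' hsk hI' => ?_).imp fun s'' _ hI' => ?_
    · exact (hI.mono (by simp; tauto)).setNat (by decide) (by decide) (by decide) _
    · have h'' := h'.agree hs' (by decide)
      have hf'' := hf'.agree hs' (by decide) (by decide)
      have h5 : s''.nat 5 0 0 = j := by rw [hs'.1 5 (by decide), hsj]
      have hlen2 : s''.len = len := by
        rw [← hlen1]; ext; simp only [Memory.len]; rw [hs'.2 4 (by decide)]
      refine Spec.seq (T := 7) (T' := 7) ((columnP_spec h'' hf'' (Or.inl ⟨rfl, rfl⟩) hlen2 hI'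
        (by rw [h5]; exact hj) (by rw [hsk]; exact hk)).imp fun s3 hs3 hI3 => ?_)
      have h53 : s3.nat 5 0 0 = j := by rw [hs3.1 5 (by simp [columnP, Program.natW, Program.when]), h5]
      have h63 : s3.nat 6 0 0 = k := by rw [hs3.1 6 (by simp [columnP, Program.natW, Program.when]), hsk]
      have hlen3 : s3.len = len := by
        rw [← hlen2]; ext; simp only [Memory.len]
        rw [hs3.2 4 (by simp [columnP, Program.realW, Program.when])]
      refine (columnP_spec (h''.agree hs3 (by decide)) (hf''.agree hs3 (by decide) (by decide))
        (Or.inr ⟨rfl, rfl⟩) hlen3 hI3 (by rw [h53]; exact hj) (by rw [h63]; exact hk)).imp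
        fun s4 _ hI4 => ?_
      refine (hI4.mono ?_).setNat (by decide) (by decide) (by decide) _
      rw [h5, hsk, h53, h63]
      rintro j' k' u' ⟨h1, h2⟩
      by_cases hv : j' < j ∧ k' < D.K ∨ j' = j ∧ k' < k
      · exact Or.inl (Or.inl ⟨hv, h2⟩)
      · have h3 : j' = j ∧ k' = k := by omega
        obtain ⟨rfl, rfl⟩ := h3
        rcases h2 with h2 | h2
        · exact Or.inl (Or.inr ⟨rfl, rfl, h2⟩)
        · exact Or.inr ⟨rfl, rfl, h2⟩
    · refine (hI'.1.mono ?_).setNat (by decide) (by decide) (by decide) _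
      rintro j' k' u' ⟨h1, h2, h3⟩
      exact ⟨by omega, h3⟩
  · obtain ⟨hI1, hI2⟩ := hI.1
    -- One visited column with a nonnegative ratio shows that the initial value `-1` has been
    -- replaced.
    have hge := hI1 0 0 (D.lft 0) ⟨hm0, hD.K_pos, Or.inl rfl⟩
    have h00 : 0 ≤ D.w 0 0 / D.cost len 0 0 (D.lft 0) :=
      div_nonneg (hD.w_nonneg 0 hm0 0 hD.K_pos) (add_nonneg (mul_nonneg
        (hD.q_nonneg 0 hm0 0 hD.K_pos) (add_nonneg (hlen _ _) (hlen _ _))) (hlen _ _))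
    rcases hI2 with h1 | ⟨h1, h2, h3, h4⟩
    · linarith
    · refine ⟨_, _, _, rfl, rfl, rfl, h1, h2, h3, fun j' hj' k' hk' u' hu' => ?_⟩
      rw [← h4]
      exact hI1 j' k' u' ⟨hj', hk', hu'⟩

/-- The expressions `r` and `x` are evaluated repeatedly, between assignments to the real arrays
`4`, `5` and `6`. The hypotheses make them depend only on memory that stays fixed: the natural
arrays and real array `2`. -/
theorem bumpP_spec {r : NatExpr} {c : ℕ} {x : RealExpr} {i : ℕ} {a : ℝ}
    (hr : ∀ s' : Memory, s'.nat = s.nat → r.eval s' = i)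
    (hx : ∀ s' : Memory, s'.nat = s.nat → s'.real 2 = s.real 2 → x.eval O s' = a) :
    Spec O (bumpP r c x) s 4 fun s' =>
      s'.len = upd s.len i c (s.len i c + s.len i c * (1 / 200 * a)) ∧
      s'.real 5 = upd (s.real 5) i c (s.real 5 i c + a) ∧
      s'.real 6 0 0 = if s.real 6 0 0 < s.real 5 i c + a then s.real 5 i c + a
        else s.real 6 0 0 := by
  have hr0 := hr s rfl
  have hx0 := hx s rfl rfl
  have hlen : ∀ s' : Memory, s'.real 4 = upd (s.real 4) i c
      (s.real 4 i c + (s.real 4 i c + 1) * (1 / 200 * a)) →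
      s'.len = upd s.len i c (s.len i c + s.len i c * (1 / 200 * a)) := by
    intro s' h
    ext i' c'
    simp only [Memory.len, h, upd]
    split_ifs <;> ring
  have hset : Spec O (.setReal 4 r (.const c) (.add (.get 4 r (.const c))
      (.mul (.add (.get 4 r (.const c)) (rc 1)) (.mul (.div (rc 1) (rc 200)) x)))) s 1 fun s' =>
      s' = s.setReal 4 i c (s.real 4 i c + (s.real 4 i c + 1) * (1 / 200 * a)) :=
    Spec.setReal (by simp [hr0, hx0])
  refine Spec.seqImp (T := 1) (T' := 3) hset fun s1 _ e => ?_
  have hr1 : r.eval s1 = i := hr _ (by rw [e]; rfl)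
  have hx1 : x.eval O s1 = a := hx _ (by rw [e]; rfl) (by rw [e]; simp)
  have e4 : s1.real 4 = upd (s.real 4) i c (s.real 4 i c + (s.real 4 i c + 1) * (1 / 200 * a)) := by
    simp [e]
  have e5 : s1.real 5 = s.real 5 := by simp [e]
  have e6 : s1.real 6 = s.real 6 := by simp [e]
  have hset2 : Spec O (.setReal 5 r (.const c) (.add (.get 5 r (.const c)) x)) s1 1 fun s' =>
      s' = s1.setReal 5 i c (s.real 5 i c + a) :=
    Spec.setReal (by simp [hr1, hx1, e5])
  refine Spec.seqImp (T := 1) (T' := 2) hset2 fun s2 _ e' => ?_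
  have hr2 : r.eval s2 = i := hr _ (by rw [e', e]; rfl)
  have f4 : s2.real 4 = s1.real 4 := by simp [e']
  have f5 : s2.real 5 = upd (s.real 5) i c (s.real 5 i c + a) := by simp [e', e5]
  have f6 : s2.real 6 = s.real 6 := by simp [e', e6]
  refine Spec.when (T := 1) le_rfl (fun hb => Spec.setReal ?_) fun hb => ?_
  · simp [hr2, f5, f6] at hb
    refine ⟨hlen _ (by simp [f4, e4]), by simp [f5], ?_⟩
    simp [hr2, f5, hb]
  · simp [hr2, f5, f6] at hb
    refine ⟨hlen _ (by simp [f4, e4]), by simp [f5], ?_⟩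
    simp [f6, not_lt.2 hb]

/-- The state of the packing algorithm in the memory. -/
def Packed (D : Tables) (t : ℕ) (s : Memory) : Prop :=
  D.PackInv t s.len (s.real 5) (s.real 6 0 0) (s.real 7) (s.real 8)

theorem packStepP_spec (hD : D.Valid) (h : Loaded D s) (hf : Filled D s) (hm : D.m ≤ z)
    (hK : D.K ≤ z) (hm0 : 0 < D.m) {t : ℕ} (hI : Packed D t s) :
    Spec O packStepP s (z * (z * 16 + 4) + 17) fun s' => Packed D (t + 1) s' := by
  refine (Spec.seqImp (T := z * (z * 16 + 4) + 3) (T' := 14) (searchP_spec hD h hf hm hK hm0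
    fun r c => zero_le_one.trans (hI.rows.one_le r c)) fun s1 a1 hp => ?_).le (by omega)
  obtain ⟨j, k, u, hj', hk', hu', hj, hk, hu, hmax⟩ := hp
  have h1 := h.agree a1 (by decide)
  obtain ⟨hq1, hw1⟩ := (hf.agree a1 (by decide) (by decide)) j hj k hk
  have hlen1 : s1.len = s.len := by
    ext; simp only [Memory.len]; rw [a1.2 4 (by decide)]
  refine Spec.seqImp (T := 4) (T' := 10) (bumpP_spec (i := D.own j) (a := D.q j k)
    (fun s' e => by simp [e, hj', h1.own]) (fun s' e e' => by simp [e, e', hj', hk', hq1]))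
    fun s2 a2 hp2 => ?_
  have n2 : s2.nat = s1.nat := funext fun a => a2.1 a (by simp [bumpP, Program.natW, Program.when])
  have r2 : s2.real 2 = s1.real 2 := a2.2 2 (by decide)
  refine Spec.seqImp (T := 4) (T' := 6) (bumpP_spec (i := u) (a := D.q j k)
    (fun s' e => by simp [e, n2, hu']) (fun s' e e' => by simp [e, e', n2, r2, hj', hk', hq1]))
    fun s3 a3 hp3 => ?_
  have n3 : s3.nat = s1.nat :=
    (funext fun a => a3.1 a (by simp [bumpP, Program.natW, Program.when])).trans n2
  refine Spec.seqImp (T := 4) (T' := 2) (bumpP_spec (i := j) (a := 1)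
    (fun s' e => by simp [e, n3, hj']) (fun s' e e' => by simp))
    fun s4 a4 hp4 => ?_
  have n4 : s4.nat = s1.nat :=
    (funext fun a => a4.1 a (by simp [bumpP, Program.natW, Program.when])).trans n3
  have r4 : ∀ a, a ≠ 4 → a ≠ 5 → a ≠ 6 → s4.real a = s1.real a := fun a h4 h5 h6 => by
    have hmem : ∀ r c x, a ∉ (bumpP r c x).realW := by
      simp [bumpP, Program.realW, Program.when, h4, h5, h6]
    rw [a4.2 a (hmem _ _ _), a3.2 a (hmem _ _ _), a2.2 a (hmem _ _ _)]
  refine Spec.seq (T := 1) (T' := 1) (Spec.setReal (Spec.setReal ?_))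
  have hstep := hI.step hD hj hk hu hmax (len₁ := s2.len) (len₂ := s3.len) (len₃ := s4.len)
    (load₁ := s2.real 5) (load₂ := s3.real 5) (load₃ := s4.real 5) (M₁ := s2.real 6 0 0)
    (M₂ := s3.real 6 0 0) (M₃ := s4.real 6 0 0) (by rw [hp2.1, hlen1]) hp3.1 hp4.1
    (by rw [hp2.2.1, a1.2 5 (by decide)]) hp3.2.1 hp4.2.1
    (by rw [hp2.2.2, a1.2 5 (by decide), a1.2 6 (by decide)]) hp3.2.2 hp4.2.2
  unfold Packed
  convert hstep using 1
  · ext; simp [Memory.len]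
  · simp
  · simp
  · simp [n4, hj', hk', r4, hw1]
    rw [a1.2 7 (by decide)]
  · simp [n4, hj', hk', r4, hq1]
    rw [a1.2 8 (by decide)]

theorem packP_spec (hD : D.Valid) (h : Loaded D s) (hf : Filled D s) (hm : D.m ≤ z)
    (hK : D.K ≤ z) {y : ℕ} (hy : 40000 * (D.n + D.V + D.m) * D.m ≤ y) (h0 : Packed D 0 s) :
    Spec O packP s (y * (z * (z * 16 + 4) + 19) + 2)
      fun s' => Packed D (40000 * (D.n + D.V + D.m) * D.m) s' := by
  refine (Spec.count (n := 40000 * (D.n + D.V + D.m) * D.m) (T := z * (z * 16 + 4) + 17)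
    (fun t s' => Packed D t s') hy
    (by decide) (fun s' hs => ?_) ?_ fun t ht s' hs hst hI => ?_).imp fun s' _ hI => hI.1
  · have h' := h.agree hs (by decide)
    simp [h'.numM, h'.numN, h'.numV]
    exact_mod_cast Iff.rfl
  · simpa [Packed] using h0
  · have hm0 : 0 < D.m := by
      by_contra hm0
      have : D.m = 0 := by omega
      simp [this] at ht
    refine (packStepP_spec hD (h.agree hs (by decide)) (hf.agree hs (by decide) (by decide)) hm hK
      hm0 hI).imp fun s'' _ hp => ?_
    simpa [Packed] using hp

end PostedPricing

/-! ### Correctness of peeling, derandomization and the membership test -/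

namespace PostedPricing

open Memory (Agree)

attribute [local simp] NatExpr.eval RealExpr.eval Test.Holds Test.holds_eq Test.holds_or

variable {O : Oracle} {D : Tables} {s : Memory} {z : ℕ}

/-- The vertices that were not peeled off yet. -/
def remaining (D : Tables) (ord : ℕ → ℕ → ℕ) : Finset ℕ :=
  (Finset.range D.V).filter fun u => ord u 0 = 0

theorem degreeP_spec (hD : D.Valid) (h : Loaded D s) (hm : D.m ≤ z) :
    Spec O degreeP s (z * 4 + 3) fun s' =>
      s'.real 11 0 0 = D.degree (s.real 8) (remaining D (s.nat 14)) (s.nat 8 0 0) := by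
  refine (Spec.seq (T := 1) (T' := z * 4 + 2) (Spec.setReal ?_)).le (by omega)
  set s0 := s.setReal 11 (NatExpr.eval s (.const 0)) (NatExpr.eval s (.const 0))
    (RealExpr.eval O s (rc 0)) with hs0
  have h0 : Loaded D s0 :=
    h.agree (A := []) (B := [11]) ⟨fun _ _ => rfl, fun a ha => by
      rw [hs0, Memory.setReal_real_ne _ _ _ (by simpa using ha)]⟩ (by simp)
  set P : ℕ → Prop := fun j => (D.lft j ∈ remaining D (s.nat 14) ∧
    D.rgt j ∈ remaining D (s.nat 14)) ∧ (D.lft j = s.nat 8 0 0 ∨ D.rgt j = s.nat 8 0 0) with hP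
  have hdec : DecidablePred P := fun j => by rw [hP]; infer_instance
  refine (Spec.forLt (n := D.m) (T := 2) (fun k s' => s'.real 11 0 0 =
    ∑ j ∈ Finset.range k, if P j then s.real 8 j 0 else 0) hm (by decide) (fun s' hs => ?_) ?_
    fun j hj s' hs hsj hI => ?_).imp fun s' _ hI => ?_
  · simpa using (h0.agree hs (by decide)).numM
  · simp [hs0]
  · have h' := h0.agree hs (by decide)
    have n14 : s'.nat 14 = s.nat 14 := hs.1 14 (by decide)
    have n8 : s'.nat 8 = s.nat 8 := hs.1 8 (by decide)
    have r8 : s'.real 8 = s.real 8 := by rw [hs.2 8 (by decide)]; simp [hs0]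
    have hl := hD.lft_lt j hj
    have hr := hD.rgt_lt j hj
    refine Spec.when (T := 1) le_rfl (fun hb => Spec.setReal ?_) fun hb => ?_
    · simp [hsj, h'.lft, h'.rgt, n14, n8] at hb
      have hPj : P j := by simpa [hP, remaining, hl, hr] using hb
      simp only [Finset.sum_range_succ, if_pos hPj]
      simp [hsj, r8, hI]
    · simp [hsj, h'.lft, h'.rgt, n14, n8] at hb
      have hPj : ¬ P j := by
        simpa [hP, remaining, hl, hr] using hb
      simp only [Finset.sum_range_succ, if_neg hPj]
      simp [hI]
  · rw [hI.1, Tables.degree, Finset.sum_filter]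
    exact Finset.sum_congr rfl fun j _ => by congr

/-- The state of the peeling in the memory. -/
def Peeled (D : Tables) (t : ℕ) (s : Memory) : Prop :=
  D.PeelInv (s.real 8) (s.real 6 0 0) t (s.nat 14)

theorem peelStepP_spec (hD : D.Valid) (h : Loaded D s) (hm : D.m ≤ z) (hV : D.V ≤ z) {t T : ℕ}
    (hp : Packed D T s) (ht : t < D.V) (hst : s.nat 7 0 0 = t) (hI : Peeled D t s) :
    Spec O peelStepP s (z * (z * 4 + 8) + 3) fun s' => Peeled D (t + 1) s' := by
  let Good : ℕ → Prop := fun u => u < D.V ∧ s.nat 14 u 0 = 0 ∧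
    D.degree (s.real 8) (remaining D (s.nat 14)) u ≤ 2 * s.real 6 0 0
  have hex : ∃ u < D.V, Good u := by
    have hne : (remaining D (s.nat 14)).Nonempty := by
      rw [← Finset.card_pos]
      have := hI.card
      unfold remaining
      omega
    obtain ⟨u, hu, hdeg⟩ := hp.exists_degree_le hD hne
    have hu' := Finset.mem_filter.1 hu
    exact ⟨u, Finset.mem_range.1 hu'.1, Finset.mem_range.1 hu'.1, hu'.2, hdeg⟩
  -- Variable `17` keeps the last good vertex seen. The invariant claims nothing before the first
  -- one, so old contents are harmless, and `hex` guarantees that one is found.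
  refine Spec.seqImp (T := z * (z * 4 + 8) + 2) (T' := 1) (Spec.forLt (n := D.V) (T := z * 4 + 6)
    (fun u s' => (∃ u' < u, Good u') → Good (s'.nat 17 0 0)) hV (by decide)
    (fun s' hs => ?_) (by simp) fun u hu s' hs hsu hI' => ?_) fun s' hs hG => ?_
  · simpa using (h.agree hs (by decide)).numV
  · have h' := h.agree hs (by decide)
    have n14 : s'.nat 14 = s.nat 14 := hs.1 14 (by decide)
    have r8 : s'.real 8 = s.real 8 := hs.2 8 (by decide)
    have r6 : s'.real 6 = s.real 6 := hs.2 6 (by decide)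
    have hskip : ∀ s'' : Memory, s''.nat 17 = s'.nat 17 → ¬ Good u → (∃ u' < u + 1, Good u') →
        Good ((s''.setNat 8 0 0 (u + 1)).nat 17 0 0) := by
      rintro s'' e hng ⟨u', hu', hg⟩
      rcases Nat.lt_succ_iff_lt_or_eq.1 hu' with h1 | rfl
      · simpa [e] using hI' ⟨u', h1, hg⟩
      · exact absurd hg hng
    refine Spec.when (T := z * 4 + 5) (by omega) (fun hb => ?_) fun hb => ?_
    · refine Spec.seqImp (T := z * 4 + 3) (T' := 2) (degreeP_spec hD h' hm) fun s1 a1 hd => ?_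
      have n8 : s1.nat 8 0 0 = u := by rw [a1.1 8 (by decide), hsu]
      have r61 : s1.real 6 = s.real 6 := by rw [a1.2 6 (by decide), r6]
      rw [hsu, n14, r8] at hd
      simp [hsu, n14] at hb
      refine Spec.when (T := 1) le_rfl (fun hb2 => Spec.setNat ?_) fun hb2 => ?_
      · simp [hd, r61] at hb2
        intro _
        simpa [n8, Good] using ⟨hu, hb, hb2⟩
      · simp [hd, r61] at hb2
        exact hskip _ (a1.1 17 (by decide)) fun hg => absurd hg.2.2 (not_le.2 hb2)
    · simp [hsu, n14] at hb
      exact hskip _ rfl fun hg => hb hg.2.1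
  · have hg := hG.1 hex
    have n14 : s'.nat 14 = s.nat 14 := hs.1 14 (by decide)
    have n7 : s'.nat 7 0 0 = t := by rw [hs.1 7 (by decide), hst]
    have r8 : s'.real 8 = s.real 8 := hs.2 8 (by decide)
    have r6 : s'.real 6 = s.real 6 := hs.2 6 (by decide)
    refine Spec.setNat ?_
    have hstep := hI.step hD hg.1 hg.2.1 hg.2.2
    simpa [Peeled, n14, n7, r8, r6] using hstep

theorem peelP_spec (hD : D.Valid) (h : Loaded D s) (hm : D.m ≤ z) (hV : D.V ≤ z) {T : ℕ}
    (hp : Packed D T s) (h0 : s.nat 14 = fun _ _ => 0) :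
    Spec O peelP s (z * (z * (z * 4 + 8) + 5) + 2) fun s' => Peeled D D.V s' := by
  refine (Spec.forLt (n := D.V) (T := z * (z * 4 + 8) + 3) (fun t s' => Peeled D t s') hV
    (by decide) (fun s' hs => ?_) ?_ fun t ht s' hs hst hI => ?_).imp fun s' _ hI => hI.1
  · simpa using (h.agree hs (by decide)).numV
  · simpa [Peeled, h0] using Tables.PeelInv.init D (s.real 8) (s.real 6 0 0)
  · have hp' : Packed D T s' := by
      unfold Packed Memory.len
      rw [hs.2 4 (by decide), hs.2 5 (by decide), hs.2 6 (by decide), hs.2 7 (by decide),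
        hs.2 8 (by decide)]
      exact hp
    refine (peelStepP_spec hD (h.agree hs (by decide)) hm hV hp' ht hst hI).imp
      fun s'' _ hp => ?_
    simpa [Peeled] using hp

theorem firstP_spec (h : Loaded D s) (hm : D.m ≤ z) :
    Spec O firstP s (z * 4 + 2) fun s' => ∀ j < D.m, s'.nat 15 j 0 = D.first (s.nat 14) j := by
  refine (Spec.forLt (n := D.m) (T := 2) (fun j s' => ∀ j' < j, s'.nat 15 j' 0 =
    D.first (s.nat 14) j') hm (by decide) (fun s' hs => ?_) (by simp)
    fun j hj s' hs hsj hI => ?_).imp fun s' _ hI => hI.1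
  · simpa using (h.agree hs (by decide)).numM
  · have h' := h.agree hs (by decide)
    have n14 : s'.nat 14 = s.nat 14 := hs.1 14 (by decide)
    have hstep : ∀ x, x = D.first (s.nat 14) j → ∀ j' < j + 1,
        upd (s'.nat 15) j 0 x j' 0 = D.first (s.nat 14) j' := by
      rintro x rfl j' hj'
      rcases Nat.lt_succ_iff_lt_or_eq.1 hj' with h1 | rfl
      · rw [upd_ne _ _ fun h => h1.ne h.1]; exact hI j' h1
      · exact upd_self _ _ _ _
    refine Spec.ite (T := 1) (fun hb => Spec.setNat ?_) (fun hb => Spec.setNat ?_)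
    · simp [hsj, n14, h'.lft, h'.rgt] at hb
      simpa [hsj, h'.lft] using hstep (D.lft j) (by simp [Tables.first, hb])
    · simp [hsj, n14, h'.lft, h'.rgt] at hb
      simpa [hsj, h'.rgt] using hstep (D.rgt j) (by simp [Tables.first, not_lt.2 hb])

theorem scaleP_spec (h : Loaded D s) (hm : D.m ≤ z) :
    Spec O scaleP s (z * 4 + 2) fun s' => ∀ j < D.m,
      s'.real 12 j 0 = 1 / (5 * s.real 6 0 0) * s.real 7 j 0 ∧
      s'.real 13 j 0 = 1 / (5 * s.real 6 0 0) * s.real 8 j 0 := by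
  refine (Spec.forLt (n := D.m) (T := 2) (fun j s' => ∀ j' < j,
      s'.real 12 j' 0 = 1 / (5 * s.real 6 0 0) * s.real 7 j' 0 ∧
      s'.real 13 j' 0 = 1 / (5 * s.real 6 0 0) * s.real 8 j' 0) hm (by decide)
    (fun s' hs => ?_) (by simp) fun j hj s' hs hsj hI => ?_).imp fun s' _ hI => hI.1
  · simpa using (h.agree hs (by decide)).numM
  · have r6 : s'.real 6 = s.real 6 := hs.2 6 (by decide)
    have r7 : s'.real 7 = s.real 7 := hs.2 7 (by decide)
    have r8 : s'.real 8 = s.real 8 := hs.2 8 (by decide)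
    refine Spec.seq (T := 1) (T' := 1) (Spec.setReal (Spec.setReal ?_))
    intro j' hj'
    rcases Nat.lt_succ_iff_lt_or_eq.1 hj' with h1 | rfl
    · simpa [hsj, upd, h1.ne] using hI j' h1
    · simp [hsj, r6, r7, r8]

/-- Two services compete for an agent or a first end point. -/
def Tables.Rival (D : Tables) (G : ℕ → ℕ) (j k : ℕ) : Prop := D.own k = D.own j ∨ G k = G j

instance (D : Tables) (G : ℕ → ℕ) (j k : ℕ) : Decidable (D.Rival G j k) :=
  inferInstanceAs (Decidable (_ ∨ _))

theorem boundP_spec (h : Loaded D s) (hm : D.m ≤ z) {G : ℕ → ℕ}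
    (hG : ∀ j < D.m, s.nat 15 j 0 = G j) : Spec O boundP s (z * (z * 4 + 6) + 3) fun s' =>
      s'.real 14 0 0 = Tables.bound D.m (D.Rival G) (s.real 12) (s.real 13) := by
  let f : ℕ → ℕ → ℝ := fun j k => if k ≠ j ∧ D.Rival G j k then 1 - s.real 13 k 0 else 1
  refine (Spec.seq (T := 1) (T' := z * (z * 4 + 6) + 2) (Spec.setReal ?_)).le (by omega)
  set s0 := s.setReal 14 (NatExpr.eval s (.const 0)) (NatExpr.eval s (.const 0))
    (RealExpr.eval O s (rc 0)) with hs0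
  have h0 : Loaded D s0 :=
    h.agree (A := []) (B := [14]) ⟨fun _ _ => rfl, fun a ha => by
      rw [hs0, Memory.setReal_real_ne _ _ _ (by simpa using ha)]⟩ (by simp)
  refine (Spec.forLt (n := D.m) (T := z * 4 + 4) (fun j s' => s'.real 14 0 0 =
    ∑ j ∈ Finset.range j, s.real 12 j 0 * ∏ k ∈ Finset.range D.m, f j k) hm (by decide)
    (fun s' hs => ?_) ?_ fun j hj s' hs hsj hI => ?_).imp fun s' _ hI => hI.1
  · simpa using (h0.agree hs (by decide)).numM
  · simp [hs0]
  refine (Spec.seq (T := 1) (T' := z * 4 + 3) (Spec.setReal ?_)).le (by omega)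
  set s1 := s'.setReal 15 (NatExpr.eval s' (.const 0)) (NatExpr.eval s' (.const 0))
    (RealExpr.eval O s' (rc 1)) with hs1
  have h1 : Loaded D s1 :=
    (h0.agree hs (by decide)).agree (A := []) (B := [15]) ⟨fun _ _ => rfl, fun a ha => by
      rw [hs1, Memory.setReal_real_ne _ _ _ (by simpa using ha)]⟩ (by simp)
  have n8 : s1.nat 8 0 0 = j := hsj
  have n15 : s1.nat 15 = s.nat 15 := hs.1 15 (by decide)
  have r12 : s1.real 12 = s.real 12 := by simp [hs1, hs.2 12 (by decide), hs0]
  have r13 : s1.real 13 = s.real 13 := by simp [hs1, hs.2 13 (by decide), hs0]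
  refine Spec.seqImp (T := z * 4 + 2) (T' := 1) (Spec.forLt (n := D.m) (T := 2)
    (fun k s'' => s''.real 15 0 0 = ∏ k ∈ Finset.range k, f j k) hm (by decide)
    (fun s'' hs' => ?_) (by simp [hs1]) fun k hk s'' hs' hsk hI' => ?_) fun s'' hs' hP => ?_
  · simpa using (h1.agree hs' (by decide)).numM
  · have h2 := h1.agree hs' (by decide)
    have n8' : s''.nat 8 0 0 = j := by rw [hs'.1 8 (by decide), n8]
    have n15' : s''.nat 15 = s.nat 15 := by rw [hs'.1 15 (by decide), n15]
    have r13' : s''.real 13 = s.real 13 := by rw [hs'.2 13 (by decide), r13]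
    refine Spec.when (T := 1) le_rfl (fun hb => Spec.setReal ?_) fun hb => ?_
    · simp [hsk, n8', n15', h2.own, hG k hk, hG j hj] at hb
      have hf : f j k = 1 - s.real 13 k 0 := if_pos hb
      simp [Finset.prod_range_succ, hf, hI', r13', hsk]
    · simp [hsk, n8', n15', h2.own, hG k hk, hG j hj] at hb
      have hf : f j k = 1 := if_neg fun ⟨h3, h4⟩ => by
        have := hb h3
        unfold Tables.Rival at h4
        tauto
      simp [Finset.prod_range_succ, hf, hI']
  · have n8' : s''.nat 8 0 0 = j := by rw [hs'.1 8 (by decide), n8]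
    have r12' : s''.real 12 = s.real 12 := by rw [hs'.2 12 (by decide), r12]
    have r14' : s''.real 14 0 0 = s'.real 14 0 0 := by rw [hs'.2 14 (by decide)]; simp [hs1]
    refine Spec.setReal ?_
    simp [n8', r12', r14', hP.1, hI, Finset.sum_range_succ]

/-- The choices for the services before `j` are made. -/
structure Chosen (D : Tables) (P : ℕ → ℕ → ℝ) (rb qb : ℕ → ℝ) (G : ℕ → ℕ) (X : ℝ) (j : ℕ)
    (s : Memory) : Prop where
  lt : ∀ i < j, s.nat 18 i 0 < D.K
  price : ∀ i < j, s.real 0 i 0 = P i (s.nat 18 i 0)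
  rev : ∀ i < j, s.real 12 i 0 = D.w i (s.nat 18 i 0)
  prob : ∀ i < j, s.real 13 i 0 = D.q i (s.nat 18 i 0)
  rev' : ∀ i < D.m, j ≤ i → s.real 12 i 0 = rb i
  prob' : ∀ i < D.m, j ≤ i → s.real 13 i 0 = qb i
  le : X ≤ Tables.bound D.m (D.Rival G) (s.real 12) (s.real 13)

theorem fixP_spec {j k : ℕ} (hj : j < D.m) (hsj : s.nat 5 0 0 = j) (hsk : s.nat 11 0 0 = k)
    (hf : Filled D s) (hk : k < D.K) : Spec O fixP s 4 fun s' =>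
      s'.nat 18 = upd (s.nat 18) j 0 k ∧ s'.real 0 = upd (s.real 0) j 0 (s.real 1 j k) ∧
      s'.real 12 = upd (s.real 12) j 0 (D.w j k) ∧ s'.real 13 = upd (s.real 13) j 0 (D.q j k) := by
  obtain ⟨hq, hw⟩ := hf j hj k hk
  refine (Spec.seq (Spec.setReal (Spec.seq (Spec.setReal (Spec.seq (Spec.setReal
    (Spec.setNat ?_))))))).le (by norm_num)
  simp [hsj, hsk, hq, hw]

theorem tryP_spec (h : Loaded D s) (hm : D.m ≤ z) {G : ℕ → ℕ}
    (hG : ∀ j < D.m, s.nat 15 j 0 = G j) {j k : ℕ} (hj : j < D.m) (hsj : s.nat 5 0 0 = j)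
    (hsk : s.nat 6 0 0 = k) (hf : Filled D s) (hk : k < D.K) :
    Spec O tryP s (z * (z * 4 + 6) + 8) fun s' => ∃ X,
      X = Tables.bound D.m (D.Rival G) (upd (s.real 12) j 0 (D.w j k))
        (upd (s.real 13) j 0 (D.q j k)) ∧
      s'.real 12 = upd (s.real 12) j 0 (D.w j k) ∧
      s'.real 13 = upd (s.real 13) j 0 (D.q j k) ∧
      -- Candidate `0` is accepted unconditionally; this overwrites the best value left over from an
      -- earlier search.
      if k = 0 ∨ s.real 9 0 0 < X then s'.real 9 0 0 = X ∧ s'.nat 11 0 0 = k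
        else s'.real 9 0 0 = s.real 9 0 0 ∧ s'.nat 11 0 0 = s.nat 11 0 0 := by
  obtain ⟨hq, hw⟩ := hf j hj k hk
  have hset : Spec O (.setReal 12 (nv 5) (.const 0) (.get 3 (nv 5) (nv 6))) s 1
      fun s' => s' = s.setReal 12 j 0 (D.w j k) := Spec.setReal (by simp [hsj, hsk, hw])
  refine (Spec.seqImp (T := 1) (T' := z * (z * 4 + 6) + 7) hset fun s1 a1 e1 => ?_).le (by omega)
  have hset2 : Spec O (.setReal 13 (nv 5) (.const 0) (.get 2 (nv 5) (nv 6))) s1 1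
      fun s' => s' = s1.setReal 13 j 0 (D.q j k) := Spec.setReal (by simp [e1, hsj, hsk, hq])
  refine (Spec.seqImp (T := 1) (T' := z * (z * 4 + 6) + 6) hset2 fun s2 a2 e2 => ?_).le (by omega)
  have h2 : Loaded D s2 := (h.agree a1 (by decide)).agree a2 (by decide)
  have n2 : s2.nat = s.nat := by rw [e2, e1]; rfl
  have r12 : s2.real 12 = upd (s.real 12) j 0 (D.w j k) := by simp [e2, e1]
  have r13 : s2.real 13 = upd (s.real 13) j 0 (D.q j k) := by simp [e2, e1]
  have r9 : s2.real 9 = s.real 9 := by simp [e2, e1]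
  refine Spec.seqImp (T := z * (z * 4 + 6) + 3) (T' := 3)
    (boundP_spec h2 hm (by rw [n2]; exact hG)) fun s3 a3 hb => ?_
  rw [r12, r13] at hb
  have n6 : s3.nat 6 0 0 = k := by rw [a3.1 6 (by decide), n2, hsk]
  have n11 : s3.nat 11 = s.nat 11 := by rw [a3.1 11 (by decide), n2]
  have r9' : s3.real 9 = s.real 9 := by rw [a3.2 9 (by decide), r9]
  have r12' : s3.real 12 = upd (s.real 12) j 0 (D.w j k) := by rw [a3.2 12 (by decide), r12]
  have r13' : s3.real 13 = upd (s.real 13) j 0 (D.q j k) := by rw [a3.2 13 (by decide), r13]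
  refine Spec.when (T := 2) (by norm_num) (fun hc => Spec.seq (T := 1) (T' := 1)
    (Spec.setReal (Spec.setNat ?_))) fun hc => ?_
  · simp [n6, r9'] at hc
    refine ⟨s3.real 14 0 0, hb, ?_⟩
    simp [r12', r13', hc, n6]
  · simp [n6, r9'] at hc
    refine ⟨s3.real 14 0 0, hb, ?_⟩
    simp [r12', r13', hc, r9', n11]

theorem upd_upd {α : Type*} (f : ℕ → ℕ → α) (i k : ℕ) (x y : α) :
    upd (upd f i k x) i k y = upd f i k y := by
  ext i' k'
  simp only [upd]
  split_ifs <;> rfl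

/-- The method of conditional expectations: averages are replaced by candidates, one service at a
time, and the bound never falls below `X`. -/
theorem chooseP_spec (hD : D.Valid) (h : Loaded D s) (hf : Filled D s) (hm : D.m ≤ z)
    (hK : D.K ≤ z) {G : ℕ → ℕ} (hG : ∀ j < D.m, s.nat 15 j 0 = G j) {T : ℕ} (hp : Packed D T s)
    {X : ℝ} (h0 : Chosen D (s.real 1) (fun j => 1 / (5 * s.real 6 0 0) * s.real 7 j 0)
      (fun j => 1 / (5 * s.real 6 0 0) * s.real 8 j 0) G X 0 s) :
    Spec O chooseP s (z * (z * (z * (z * 4 + 6) + 10) + 8) + 2) fun s' =>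
      Chosen D (s.real 1) (fun j => 1 / (5 * s.real 6 0 0) * s.real 7 j 0)
        (fun j => 1 / (5 * s.real 6 0 0) * s.real 8 j 0) G X D.m s' := by
  obtain ⟨c, hc⟩ : ∃ c, 1 / (5 * s.real 6 0 0) = c := ⟨_, rfl⟩
  have hM := hp.rows.max_nonneg
  have hc0 : 0 ≤ c := by rw [← hc]; positivity
  -- If the maximal load is `0`, then `c = 1 / 0 = 0` by convention.
  have hc1 : c * s.real 6 0 0 ≤ 1 := by
    rcases hM.eq_or_lt with h1 | h1
    · rw [← h1]; simp
    · rw [← hc]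
      have : 1 / (5 * s.real 6 0 0) * s.real 6 0 0 = 1 / 5 := by field_simp
      rw [this]; norm_num
  rw [hc] at h0 ⊢
  refine (Spec.forLt (n := D.m) (T := z * (z * (z * 4 + 6) + 10) + 6) (fun j s' =>
    Chosen D (s.real 1) (fun j => c * s.real 7 j 0) (fun j => c * s.real 8 j 0) G X j s') hm
    (by decide) (fun s' hs => ?_) ?_ fun j hj s' hs hsj hI => ?_).imp fun s' _ hI => hI.1
  · simpa using (h.agree hs (by decide)).numM
  · exact ⟨by simp, by simp, by simp, by simp, by simpa using h0.rev', by simpa using h0.prob',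
      by simpa using h0.le⟩
  have h' := h.agree hs (by decide)
  have hf' := hf.agree hs (by decide) (by decide)
  have hG' : ∀ j < D.m, s'.nat 15 j 0 = G j := by rw [hs.1 15 (by decide)]; exact hG
  let F : ℕ → ℝ := fun k => Tables.bound D.m (D.Rival G) (upd (s'.real 12) j 0 (D.w j k))
    (upd (s'.real 13) j 0 (D.q j k))
  refine Spec.seqImp (T := z * (z * (z * 4 + 6) + 10) + 2) (T' := 4) (Spec.count (n := D.K)
    -- The trials overwrite entry `j` only: after any further update of that entry, the arrays agree
    -- with those before the search.
    (T := z * (z * 4 + 6) + 8) (fun k s'' => (∀ x, upd (s''.real 12) j 0 x = upd (s'.real 12) j 0 x)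
      ∧ (∀ x, upd (s''.real 13) j 0 x = upd (s'.real 13) j 0 x) ∧
      (k = 0 ∨ s''.nat 11 0 0 < D.K ∧ s''.real 9 0 0 = F (s''.nat 11 0 0)) ∧
      ∀ k' < k, F k' ≤ s''.real 9 0 0) hK (by decide)
    (fun s'' hs' => (h'.agree hs' (by decide)).isCand_iff) (by simp)
    fun k hk s'' hs' hsk hI' => ?_) fun s'' hs' hI' => ?_
  · have h'' := h'.agree hs' (by decide)
    have hf'' := hf'.agree hs' (by decide) (by decide)
    have h5 : s''.nat 5 0 0 = j := by rw [hs'.1 5 (by decide), hsj]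
    have hG'' : ∀ j < D.m, s''.nat 15 j 0 = G j := by rw [hs'.1 15 (by decide)]; exact hG'
    refine (tryP_spec h'' hm hG'' hj h5 hsk hf'' hk).imp fun s3 _ hY => ?_
    obtain ⟨Y, hY, h12, h13, hif⟩ := hY
    rw [hI'.1, hI'.2.1] at hY
    have hYF : Y = F k := hY
    refine ⟨fun x => ?_, fun x => ?_, Or.inr ?_, fun k' hk' => ?_⟩
    · simp [h12, upd_upd, hI'.1]
    · simp [h13, upd_upd, hI'.2.1]
    · split_ifs at hif with h4
      · simp [hif.1, hif.2, hk, hYF]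
      · push Not at h4
        simpa [hif.1, hif.2] using hI'.2.2.1.resolve_left h4.1
    · split_ifs at hif with h4
      · simp only [Memory.setNat_real, hif.1]
        rcases Nat.lt_succ_iff_lt_or_eq.1 hk' with h6 | rfl
        · rcases h4 with h4 | h4
          · omega
          · exact (hI'.2.2.2 k' h6).trans h4.le
        · exact hYF.ge
      · push Not at h4
        simp only [Memory.setNat_real, hif.1]
        rcases Nat.lt_succ_iff_lt_or_eq.1 hk' with h6 | rfl
        · exact hI'.2.2.2 k' h6
        · exact hYF ▸ h4.2
  · obtain ⟨⟨i1, i2, i3, i4⟩, -⟩ := hI'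
    obtain ⟨i5, i6⟩ := i3.resolve_left hD.K_pos.ne'
    have h5 : s''.nat 5 0 0 = j := by rw [hs'.1 5 (by decide), hsj]
    have r0 : s''.real 0 = s'.real 0 := hs'.2 0 (by decide)
    have r1 : s''.real 1 = s.real 1 := by rw [hs'.2 1 (by decide), hs.2 1 (by decide)]
    have n18 : s''.nat 18 = s'.nat 18 := hs'.1 18 (by decide)
    refine (fixP_spec hj h5 rfl (hf'.agree hs' (by decide) (by decide)) i5).imp
      fun s3 _ hp3 => ?_
    obtain ⟨e18, e0, e12, e13⟩ := hp3
    rw [i1] at e12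
    rw [i2] at e13
    rw [n18] at e18
    rw [r0, r1] at e0
    have hne : ∀ {i}, i ≠ j → ¬(i = j ∧ 0 = 0) := fun h h' => h h'.1
    -- Before the search, entry `j` held the scaled average; by `PackInv.bound_le` the best
    -- candidate is no worse.
    have hbest : X ≤ F (s''.nat 11 0 0) := by
      refine hI.le.trans ?_
      refine hp.bound_le hD (D.Rival G) hc0 hc1 hj (hI.rev' j hj le_rfl) (hI.prob' j hj le_rfl)
        fun k hk => ?_
      exact (i4 k hk).trans_eq i6
    refine ⟨fun i hi => ?_, fun i hi => ?_, fun i hi => ?_, fun i hi => ?_, fun i hi hij => ?_,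
      fun i hi hij => ?_, ?_⟩
    · rcases Nat.lt_succ_iff_lt_or_eq.1 hi with h6 | rfl
      · simpa [e18, upd_ne _ _ (hne h6.ne)] using hI.lt i h6
      · simpa [e18] using i5
    · rcases Nat.lt_succ_iff_lt_or_eq.1 hi with h6 | rfl
      · simpa [e18, e0, upd_ne _ _ (hne h6.ne)] using hI.price i h6
      · simp [e18, e0]
    · rcases Nat.lt_succ_iff_lt_or_eq.1 hi with h6 | rfl
      · simpa [e18, e12, upd_ne _ _ (hne h6.ne)] using hI.rev i h6
      · simp [e18, e12]
    · rcases Nat.lt_succ_iff_lt_or_eq.1 hi with h6 | rfl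
      · simpa [e18, e13, upd_ne _ _ (hne h6.ne)] using hI.prob i h6
      · simp [e18, e13]
    · simpa [e12, upd_ne _ _ (hne (by omega : i ≠ j))] using hI.rev' i hi (by omega)
    · simpa [e13, upd_ne _ _ (hne (by omega : i ≠ j))] using hI.prob' i hi (by omega)
    · simpa [e12, e13] using hbest

/-- Service `a` cannot be in the given set, because it is not for sale or because of `b`. -/
def Conflict (D : Tables) (G act A : ℕ → ℕ) (a b : ℕ) : Prop :=
  A a = 1 ∧ (act a = 0 ∨ (A b = 1 ∧ b ≠ a) ∧ D.Rival G a b)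

/-- The answer is correct for the pairs of services in `vis`. -/
def CheckInv (C vis : ℕ → ℕ → Prop) (s : Memory) : Prop :=
  (s.nat 16 0 0 = 1 ∧ ∀ a b, vis a b → ¬ C a b) ∨ (s.nat 16 0 0 = 0 ∧ ∃ a b, vis a b ∧ C a b)

theorem CheckInv.congr {C vis vis' : ℕ → ℕ → Prop} {s s' : Memory} (h : CheckInv C vis s)
    (hv : ∀ a b, vis a b ↔ vis' a b) (hs : s'.nat 16 = s.nat 16) : CheckInv C vis' s' := by
  obtain rfl : vis = vis' := by ext a b; exact hv a b
  simpa [CheckInv, hs] using h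

theorem checkP_spec (h : Loaded D s) (hm : D.m ≤ z) {G : ℕ → ℕ}
    (hG : ∀ j < D.m, s.nat 15 j 0 = G j) :
    Spec O checkP s (z * (z * 4 + 4) + 4) fun s' =>
      (s'.nat 0 0 0 = 1 ∧ ∀ a < D.m, ∀ b < D.m,
        ¬ Conflict D G (fun j => s.nat 18 j 0) (fun j => s.nat 4 j 0) a b) ∨
      (s'.nat 0 0 0 = 0 ∧ ∃ a < D.m, ∃ b < D.m,
        Conflict D G (fun j => s.nat 18 j 0) (fun j => s.nat 4 j 0) a b) := by
  obtain ⟨C, hC⟩ : ∃ C, Conflict D G (fun j => s.nat 18 j 0) (fun j => s.nat 4 j 0) = C :=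
    ⟨_, rfl⟩
  rw [hC]
  have hset : Spec O (.setNat 16 (.const 0) (.const 0) (.const 1)) s 1
      fun s' => s' = s.setNat 16 0 0 1 := Spec.setNat (by simp)
  refine (Spec.seqImp (T := 1) (T' := z * (z * 4 + 4) + 3) hset fun s0 a0 e0 => ?_).le (by omega)
  have h0 := h.agree a0 (by decide)
  refine Spec.seqImp (T := z * (z * 4 + 4) + 2) (T' := 1) (Spec.forLt (n := D.m) (T := z * 4 + 2)
    (fun j s' => CheckInv C (fun a b => a < j ∧ b < D.m) s') hm (by decide)
    (fun s' hs => by simpa using (h0.agree hs (by decide)).numM) ?_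
    fun j hj s' hs hsj hI => ?_) fun s' _ hI => ?_
  · left
    simp [e0]
  · have h' := h0.agree hs (by decide)
    refine (Spec.forLt (n := D.m) (T := 2) (fun k s'' => CheckInv C
      (fun a b => a < j ∧ b < D.m ∨ a = j ∧ b < k) s'') hm (by decide)
      (fun s'' hs' => by simpa using (h'.agree hs' (by decide)).numM) ?_
      fun k hk s'' hs' hsk hI' => ?_).imp fun s'' _ hI' => ?_
    · exact hI.congr (by simp) (by simp)
    · have h'' := h'.agree hs' (by decide)
      have h5 : s''.nat 5 0 0 = j := by rw [hs'.1 5 (by decide), hsj]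
      have hn : ∀ a, a ∉ [16, 5, 6] → s''.nat a = s.nat a := by
        intro a ha
        simp only [List.mem_cons, List.not_mem_nil, or_false, not_or] at ha
        rw [hs'.1 a (by simp [Program.natW, Program.when, ha]),
          hs.1 a (by simp [Program.natW, Program.when, Program.forLt, Program.count, ha]), e0,
          Memory.setNat_nat_ne _ _ _ ha.1]
      have n4 := hn 4 (by decide)
      have n15 := hn 15 (by decide)
      have n18 := hn 18 (by decide)
      have hvis : ∀ a b, (a < j ∧ b < D.m ∨ a = j ∧ b < k + 1) ↔
          ((a < j ∧ b < D.m ∨ a = j ∧ b < k) ∨ a = j ∧ b = k) := by intro a b; omega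
      refine Spec.when (T := 1) le_rfl (fun hb => Spec.setNat ?_) fun hb => ?_
      · simp [h5, hsk, h''.own, n4, n15, n18, hG j hj, hG k hk] at hb
        have hCjk : C j k := by
          rw [← hC]
          exact hb
        right
        exact ⟨by simp, j, k, (hvis j k).2 (Or.inr ⟨rfl, rfl⟩), hCjk⟩
      · simp [h5, hsk, h''.own, n4, n15, n18, hG j hj, hG k hk] at hb
        have hCjk : ¬ C j k := by
          rw [← hC]
          rintro ⟨h6, h7⟩
          obtain ⟨h8, h9⟩ := hb h6
          rcases h7 with h7 | ⟨⟨h7, h10⟩, h11⟩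
          · exact h8 h7
          · have := h9 h7 h10
            unfold Tables.Rival at h11
            tauto
        rcases hI' with ⟨h6, h7⟩ | ⟨h6, a, b, h7, h8⟩
        · left
          refine ⟨by simpa using h6, fun a b hab => ?_⟩
          rcases (hvis a b).1 hab with hab | ⟨rfl, rfl⟩
          · exact h7 a b hab
          · exact hCjk
        · right
          exact ⟨by simpa using h6, a, b, (hvis a b).2 (Or.inl h7), h8⟩
    · exact hI'.1.congr (by intro a b; omega) (by simp)
  · refine Spec.setNat ?_
    rcases hI.1 with ⟨h6, h7⟩ | ⟨h6, a, b, h7, h8⟩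
    · left
      exact ⟨by simpa using h6, fun a ha b hb => h7 a b ⟨ha, hb⟩⟩
    · right
      exact ⟨by simpa using h6, a, h7.1, b, h7.2, h8⟩

end PostedPricing

/-! ### The whole program on an instance, and the theorem -/

namespace PostedPricing

open Memory (Agree)

variable {O : Oracle} {D : Tables} {s : Memory} {z : ℕ}

theorem Tables.bound_congr {m : ℕ} (rival : ℕ → ℕ → Prop) [∀ j k, Decidable (rival j k)]
    {r q r' q' : ℕ → ℕ → ℝ} (hr : ∀ j < m, r j 0 = r' j 0) (hq : ∀ j < m, q j 0 = q' j 0) :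
    bound m rival r q = bound m rival r' q' := by
  refine Finset.sum_congr rfl fun j hj => ?_
  rw [hr j (Finset.mem_range.1 hj)]
  congr 1
  exact Finset.prod_congr rfl fun k hk => by rw [hq k (Finset.mem_range.1 hk)]

/-- The memory holds suitable prices and the data of a restricted system. -/
structure Priced (O : Oracle) (D : Tables) (s : Memory) : Prop where
  loaded : Loaded D s
  inj : ∀ u < D.V, ∀ v < D.V, s.nat 14 u 0 = s.nat 14 v 0 → u = v
  first : ∀ j < D.m, s.nat 15 j 0 = D.first (s.nat 14) j
  price : ∀ j < D.m, s.real 0 j 0 = O.candPrice D.m j (s.nat 18 j 0)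
  le : 3 / 32 * D.opt ≤ Tables.bound D.m (D.Rival (D.first (s.nat 14)))
    (fun j _ => D.w j (s.nat 18 j 0)) (fun j _ => D.q j (s.nat 18 j 0))

/-- The number of steps that are needed to compute the prices, for tables of size at most `z`
and `y` iterations of the packing algorithm. -/
def pricesTime (z y : ℕ) : ℕ :=
  (z * (z * 7 + 4) + 2) + ((y * (z * (z * 16 + 4) + 19) + 2) + ((z * (z * (z * 4 + 8) + 5) + 2) +
    ((z * 4 + 2) + ((z * 4 + 2) + (z * (z * (z * (z * 4 + 6) + 10) + 8) + 2)))))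

theorem pricesP_spec (hD : D.Valid) (h : Loaded D s)
    (hw : ∀ j k, D.w j k = O.candPrice D.m j k * O.candProb D.m j k)
    (hq : ∀ j k, D.q j k = O.candProb D.m j k) (hr0 : s.real = fun _ _ _ => 0)
    (h14 : s.nat 14 = fun _ _ => 0) (hm : D.m ≤ z) (hK : D.K ≤ z) (hV : D.V ≤ z) {y : ℕ}
    (hy : 40000 * (D.n + D.V + D.m) * D.m ≤ y) :
    Spec O pricesP s (pricesTime z y) fun s' => Priced O D s' := by
  refine Spec.seqImp (tablesP_spec h hm hK) fun s1 a1 hc1 => ?_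
  have h1 := h.agree a1 (by decide)
  have hf1 : Filled D s1 := fun j hj k hk => by
    obtain ⟨-, h2, h3⟩ := hc1 j hj k hk
    exact ⟨by rw [h2, hq], by rw [h3, hw]⟩
  have hp0 : Packed D 0 s1 := by
    have e : ∀ a, a ∉ tablesP.realW → s1.real a = fun _ _ => 0 := fun a ha => by
      rw [a1.2 a ha, hr0]
    have e4 := e 4 (by decide)
    unfold Packed Memory.len
    rw [e4, e 5 (by decide), e 6 (by decide), e 7 (by decide), e 8 (by decide)]
    simpa using Tables.PackInv.init D
  refine Spec.seqImp (packP_spec hD h1 hf1 hm hK hy hp0) fun s2 a2 hp2 => ?_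
  have h2 := h1.agree a2 (by decide)
  have hf2 := hf1.agree a2 (by decide) (by decide)
  have e14 : s2.nat 14 = fun _ _ => 0 := by rw [a2.1 14 (by decide), a1.1 14 (by decide), h14]
  refine Spec.seqImp (peelP_spec hD h2 hm hV hp2 e14) fun s3 a3 hp3 => ?_
  have h3 := h2.agree a3 (by decide)
  refine Spec.seqImp (firstP_spec h3 hm) fun s4 a4 hp4 => ?_
  have h4 := h3.agree a4 (by decide)
  refine Spec.seqImp (scaleP_spec h4 hm) fun s5 a5 hp5 => ?_
  have h5 := h4.agree a5 (by decide)
  have er2 : ∀ a, a ∉ peelP.realW → a ∉ firstP.realW → a ∉ scaleP.realW →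
      s5.real a = s2.real a := fun a b3 b4 b5 => by rw [a5.2 a b5, a4.2 a b4, a3.2 a b3]
  have er4 : ∀ a, a ∉ scaleP.realW → s5.real a = s4.real a := fun a b5 => a5.2 a b5
  have f6 := er2 6 (by decide) (by decide) (by decide)
  have f7 := er2 7 (by decide) (by decide) (by decide)
  have f8 := er2 8 (by decide) (by decide) (by decide)
  have hf5 : Filled D s5 := ((hf2.agree a3 (by decide) (by decide)).agree a4 (by decide)
    (by decide)).agree a5 (by decide) (by decide)
  have hp : Packed D (40000 * (D.n + D.V + D.m) * D.m) s5 := by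
    unfold Packed Memory.len
    rw [er2 4 (by decide) (by decide) (by decide), er2 5 (by decide) (by decide) (by decide), f6,
      f7, f8]
    exact hp2
  have g14 : s5.nat 14 = s3.nat 14 := by rw [a5.1 14 (by decide), a4.1 14 (by decide)]
  have hG : ∀ j < D.m, s5.nat 15 j 0 = D.first (s5.nat 14) j := by
    rw [a5.1 15 (by decide), g14]
    exact hp4
  have hpeel : D.PeelInv (s5.real 8) (s5.real 6 0 0) D.V (s5.nat 14) := by
    rw [g14, er4 8 (by decide), er4 6 (by decide), a4.2 8 (by decide), a4.2 6 (by decide)]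
    exact hp3
  have hr : ∀ j < D.m, s5.real 12 j 0 = 1 / (5 * s5.real 6 0 0) * s5.real 7 j 0 := fun j hj => by
    rw [er4 6 (by decide), er4 7 (by decide)]
    exact (hp5 j hj).1
  have hqr : ∀ j < D.m, s5.real 13 j 0 = 1 / (5 * s5.real 6 0 0) * s5.real 8 j 0 := fun j hj => by
    rw [er4 6 (by decide), er4 8 (by decide)]
    exact (hp5 j hj).2
  -- The guarantee holds for the scaled averages; choosing the candidates preserves it.
  have hX : 3 / 32 * D.opt ≤ Tables.bound D.m (D.Rival (D.first (s5.nat 14))) (s5.real 12)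
      (s5.real 13) := hp.le_bound hD le_rfl hpeel hr hqr
  refine (chooseP_spec hD h5 hf5 hm hK hG hp ⟨by simp, by simp, by simp, by simp,
    fun i hi _ => hr i hi, fun i hi _ => hqr i hi, hX⟩).imp fun s6 a6 hc => ?_
  have k14 : s6.nat 14 = s5.nat 14 := a6.1 14 (by decide)
  refine ⟨h5.agree a6 (by decide), ?_, ?_, fun j hj => ?_, ?_⟩
  · rw [k14]
    exact fun u hu v hv huv => hpeel.inj u hu v hv huv (hpeel.pos hu)
  · rw [k14, a6.1 15 (by decide)]
    exact hG
  · rw [hc.price j hj, er2 1 (by decide) (by decide) (by decide), a2.2 1 (by decide)]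
    exact (hc1 j hj _ (hc.lt j hj)).1
  · rw [k14, ← Tables.bound_congr _ hc.rev hc.prob]
    exact hc.le

namespace GraphInstance

variable {I : GraphInstance}

/-- The tables for an instance with an oracle. -/
noncomputable def tables (I : GraphInstance) (O : Oracle) : Tables where
  m := I.numServices
  n := I.numAgents
  V := I.numVertices
  K := 40000 * I.numServices + 2
  own := table fun j => (I.owner j : ℕ)
  lft := table fun j => (I.left j : ℕ)
  rgt := table fun j => (I.right j : ℕ)
  w j k := O.candPrice I.numServices j k * O.candProb I.numServices j k
  q := O.candProb I.numServices
  opt := I.optRevenue.toReal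

theorem table_val {n : ℕ} (f : Fin n → ℕ) (j : Fin n) : table f j = f j := by
  simp [table]

theorem table_of_lt {n : ℕ} (f : Fin n → ℕ) {j : ℕ} (hj : j < n) : table f j = f ⟨j, hj⟩ := by
  simp [table, hj]

theorem tables_valid (hO : O.Correct I) : (I.tables O).Valid where
  own_lt j hj := by
    simp only [tables] at hj ⊢
    rw [table_of_lt _ hj]; exact Fin.is_lt _
  lft_lt j hj := by
    simp only [tables] at hj ⊢
    rw [table_of_lt _ hj]; exact Fin.is_lt _
  rgt_lt j hj := by
    simp only [tables] at hj ⊢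
    rw [table_of_lt _ hj]; exact Fin.is_lt _
  ne j hj := by
    simp only [tables] at hj ⊢
    rw [table_of_lt _ hj, table_of_lt _ hj]
    exact fun h => (I.adj _).ne (Fin.ext h)
  K_pos := by simp [tables]
  w_nonneg j hj k _ :=
    mul_nonneg (candPrice_nonneg hO ⟨j, hj⟩ k) (candProb_nonneg hO ⟨j, hj⟩ k)
  q_nonneg j hj k _ := candProb_nonneg hO ⟨j, hj⟩ k
  q_le_one j hj k _ := candProb_le_one hO ⟨j, hj⟩ k
  w_zero j _ := by simp [tables, Oracle.candPrice]
  q_zero j _ := by simp [tables, Oracle.candProb]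
  opt_nonneg := ENNReal.toReal_nonneg
  dual ρ len hρ hlen h := by
    have hdual := optRevenue_le_of_cand hO hρ (l := fun i => len i 0) (μ := fun u => len u 1)
      (ν := fun j => len j 2) (fun _ => hlen _ _) (fun _ => hlen _ _) (fun _ => hlen _ _) ?_
    · have h0 : 0 ≤ (201 / 200) ^ 2 * ρ * (I.tables O).total len := by
        have : 0 ≤ (I.tables O).total len := add_nonneg (add_nonneg
          (Finset.sum_nonneg fun _ _ => hlen _ _) (Finset.sum_nonneg fun _ _ => hlen _ _))
          (Finset.sum_nonneg fun _ _ => hlen _ _)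
        positivity
      refine ENNReal.toReal_le_of_le_ofReal h0 (hdual.trans_eq ?_)
      simp only [Tables.total, tables, Finset.sum_range]
    · intro j k hk u hu
      have hu' : (u : ℕ) = (I.tables O).lft j ∨ (u : ℕ) = (I.tables O).rgt j := by
        simp only [tables, table_val]
        rcases Sym2.mem_iff.1 hu with rfl | rfl
        · exact Or.inl rfl
        · exact Or.inr rfl
      have := h j j.2 k (by simp only [tables]; omega) u hu'
      simpa only [Tables.cost, tables, table_val] using this

theorem loaded_input (S : Finset (Fin I.numServices)) : Loaded (I.tables O) (I.input S) :=
  ⟨by simp [input, tables], by simp [input, tables], by simp [input, tables],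
    by simp [input, tables], by simp [input, tables], by simp [input, tables], rfl⟩

theorem withArray_input (S : Finset (Fin I.numServices)) :
    (I.input ∅).withArray 4 ((I.input S).nat 4) = I.input S := by
  simp only [Memory.withArray, input, Memory.mk.injEq, and_true]
  funext a i k
  by_cases ha : a = 4
  · simp [ha]
  · rw [if_neg ha]
    rcases a with _ | _ | _ | _ | _ | a <;> first | rfl | exact absurd rfl ha

/-- The order of the vertices in the memory. -/
def order (I : GraphInstance) (s : Memory) (u : Fin I.numVertices) : ℕ := s.nat 14 u 0

/-- The restricted system in the memory. -/
def system (I : GraphInstance) (s : Memory) : Finset (Fin I.numServices) → Prop :=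
  I.partitionSystem (fun j => s.nat 18 j 0 ≠ 0) (I.order s)

theorem first_eq_firstEnd (s : Memory) (j : Fin I.numServices) :
    (I.tables O).first (s.nat 14) j = I.firstEnd (I.order s) j := by
  simp only [Tables.first, firstEnd, tables, table_val, order]
  exact (apply_ite Fin.val _ _ _).symm

theorem rival_iff (s : Memory) (j k : Fin I.numServices) :
    (I.tables O).Rival ((I.tables O).first (s.nat 14)) j k ↔
      I.owner k = I.owner j ∨ I.firstEnd (I.order s) k = I.firstEnd (I.order s) j := by
  rw [Tables.Rival, first_eq_firstEnd, first_eq_firstEnd, Fin.val_inj]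
  simp only [tables, table_val, Fin.val_inj]

theorem order_injective (h : Priced O (I.tables O) s) : (I.order s).Injective :=
  fun u v huv => Fin.ext (h.inj u u.2 v v.2 huv)

/-- The active services are those with a nonzero candidate. For them `bound` is exactly the sum in
`ofReal_sum_le_oblRevenue`, and the inactive ones contribute `0`. -/
theorem isApproxOPM_of_priced (hI : I.optRevenue ≠ ⊤) (hO : O.Correct I)
    (h : Priced O (I.tables O) s) {p : Fin I.numServices → ℝ≥0}
    (hp : ∀ j : Fin I.numServices, (p j : ℝ) = s.real 0 j 0) :
    I.IsApproxOPM p (I.system s) (32 / 3) := by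
  refine isApproxOPM_of_oblRevenue (isRestriction_partitionSystem I _ (order_injective h)) ?_
  have hprice : ∀ j : Fin I.numServices, (p j : ℝ) =
      O.candPrice I.numServices j (s.nat 18 j 0) := fun j => (hp j).trans (h.price j j.2)
  have hrev := I.ofReal_sum_le_oblRevenue (act := fun j => s.nat 18 j 0 ≠ 0) (ord := I.order s)
    (p := p) (q := fun j => O.candProb I.numServices j (s.nat 18 j 0))
    (fun j hj => by simp only [candProb_eq hO j hj, hprice])
    (fun j hj => by simp only [not_not] at hj; simp [hj, Oracle.candProb])
  have hle := h.le
  have hsum : Tables.bound (I.tables O).m ((I.tables O).Rival ((I.tables O).first (s.nat 14)))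
      (fun j _ => (I.tables O).w j (s.nat 18 j 0)) (fun j _ => (I.tables O).q j (s.nat 18 j 0)) =
      ∑ j : Fin I.numServices, p j * O.candProb I.numServices j (s.nat 18 j 0) *
        ∏ k ∈ I.rivals (I.order s) j, (1 - O.candProb I.numServices k (s.nat 18 k 0)) := by
    have e : ∀ f : ℕ → ℝ, ∑ j ∈ Finset.range (I.tables O).m, f j =
        ∑ j : Fin I.numServices, f j := fun f => Finset.sum_range f
    have e' : ∀ f : ℕ → ℝ, ∏ j ∈ Finset.range (I.tables O).m, f j =
        ∏ j : Fin I.numServices, f j := fun f => Finset.prod_range f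
    rw [Tables.bound, e]
    refine Finset.sum_congr rfl fun j _ => ?_
    rw [e', rivals, Finset.prod_filter, hprice]
    congr 1
    refine Finset.prod_congr rfl fun k _ => ?_
    simp only [rival_iff, ne_eq, Fin.val_inj]
    rfl
  rw [hsum] at hle
  calc I.optRevenue = ENNReal.ofReal (32 / 3 * (3 / 32 * (I.tables O).opt)) := by
        rw [← mul_assoc]
        norm_num
        exact (ENNReal.ofReal_toReal hI).symm
    _ = 32 / 3 * ENNReal.ofReal (3 / 32 * (I.tables O).opt) := by
        rw [ENNReal.ofReal_mul (by norm_num), ENNReal.ofReal_div_of_pos (by norm_num)]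
        norm_num
    _ ≤ 32 / 3 * I.oblRevenue p (I.system s) :=
        mul_le_mul_right ((ENNReal.ofReal_le_ofReal hle).trans hrev) _

/-- Membership is a condition on pairs of services, so a double loop decides it; the pair `(a, a)`
takes care of inactive services. -/
theorem system_iff (s : Memory) (S : Finset (Fin I.numServices)) :
    I.system s S ↔ ∀ a < (I.tables O).m, ∀ b < (I.tables O).m,
      ¬ Conflict (I.tables O) ((I.tables O).first (s.nat 14)) (fun j => s.nat 18 j 0)
        (fun j => (I.input S).nat 4 j 0) a b := by
  have hA : ∀ j : Fin I.numServices, (I.input S).nat 4 j 0 = 1 ↔ j ∈ S := fun j => by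
    simp only [input, ne_eq, not_true_eq_false, if_false, table_val]
    split_ifs with h <;> simp [h]
  have key : ∀ a b : Fin I.numServices, Conflict (I.tables O) ((I.tables O).first (s.nat 14))
      (fun j => s.nat 18 j 0) (fun j => (I.input S).nat 4 j 0) a b ↔
      a ∈ S ∧ (s.nat 18 a 0 = 0 ∨ (b ∈ S ∧ b ≠ a) ∧
        (I.owner b = I.owner a ∨ I.firstEnd (I.order s) b = I.firstEnd (I.order s) a)) :=
    fun a b => by simp only [Conflict, hA, rival_iff, ne_eq, Fin.val_inj]
  have hall : (∀ a < (I.tables O).m, ∀ b < (I.tables O).m,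
      ¬ Conflict (I.tables O) ((I.tables O).first (s.nat 14)) (fun j => s.nat 18 j 0)
        (fun j => (I.input S).nat 4 j 0) a b) ↔ ∀ a b : Fin I.numServices,
      ¬ Conflict (I.tables O) ((I.tables O).first (s.nat 14)) (fun j => s.nat 18 j 0)
        (fun j => (I.input S).nat 4 j 0) a b :=
    ⟨fun h a b => h a a.2 b b.2, fun h a ha b hb => h ⟨a, ha⟩ ⟨b, hb⟩⟩
  rw [hall]
  simp only [key]
  constructor
  · rintro ⟨h1, h2, h3⟩ a b ⟨ha, h4 | ⟨⟨hb, h5⟩, h6 | h6⟩⟩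
    · exact h1 a ha h4
    · exact h5 (h2 hb ha h6)
    · exact h5 (h3 hb ha h6)
  · intro h
    refine ⟨fun a ha h0 => h a a ⟨ha, Or.inl h0⟩, fun b hb a ha hab => ?_, fun b hb a ha hab => ?_⟩
    · by_contra hne
      exact h a b ⟨ha, Or.inr ⟨⟨hb, hne⟩, Or.inl hab⟩⟩
    · by_contra hne
      exact h a b ⟨ha, Or.inr ⟨⟨hb, hne⟩, Or.inr hab⟩⟩

/-- The number of steps of the whole program. -/
def opmTime (z y : ℕ) : ℕ := pricesTime z y + (z * (z * 4 + 4) + 4)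

/-- Prices and system are read off from one run on the empty set, so that they cannot depend on the
queried set. -/
theorem computes_opmProgram (hI : I.optRevenue ≠ ⊤) (hO : O.Correct I) :
    ∃ (p : Fin I.numServices → ℝ≥0) (R : Finset (Fin I.numServices) → Prop),
      I.IsApproxOPM p R (32 / 3) ∧ I.Computes O opmProgram
        (opmTime (40000 * I.size + 2) (40000 * I.size * I.size)) p R := by
  have hD := tables_valid hO
  have hm : (I.tables O).m ≤ 40000 * I.size + 2 := by simp only [tables, size]; omega
  have hy : 40000 * ((I.tables O).n + (I.tables O).V + (I.tables O).m) * (I.tables O).m ≤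
      40000 * I.size * I.size := by
    have h1 : (I.tables O).n + (I.tables O).V + (I.tables O).m ≤ I.size := by
      simp only [tables, size]; omega
    have h2 : (I.tables O).m ≤ I.size := by simp only [tables, size]; omega
    exact Nat.mul_le_mul (Nat.mul_le_mul_left _ h1) h2
  obtain ⟨s, t, hrun, ht, hs⟩ := pricesP_spec (O := O) hD (loaded_input ∅) (fun _ _ => rfl)
    (fun _ _ => rfl) rfl (by funext i k; simp [input]) hm
    (by simp only [tables, size]; omega) (by simp only [tables, size]; omega) hy
  have hnonneg : ∀ j : Fin I.numServices, 0 ≤ s.real 0 j 0 := fun j => by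
    rw [hs.price j j.2]; exact candPrice_nonneg hO j _
  refine ⟨fun j => ⟨s.real 0 j 0, hnonneg j⟩, I.system s,
    isApproxOPM_of_priced hI hO hs fun _ => rfl, fun S => ?_⟩
  -- The run for the empty set becomes a run for `S` by exchanging array `4`, which `pricesP` does
  -- not use.
  have hrun' := hrun.withArray pricesP_avoids ((I.input S).nat 4)
  rw [withArray_input] at hrun'
  set s1 := s.withArray 4 ((I.input S).nat 4) with hs1
  have hn : ∀ a, a ≠ 4 → s1.nat a = s.nat a := fun a ha => by simp [hs1, Memory.withArray, ha]
  have h4 : s1.nat 4 = (I.input S).nat 4 := by simp [hs1, Memory.withArray]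
  have hl : Loaded (I.tables O) s1 := hs.loaded.agree (A := [4]) (B := [])
    ⟨fun a ha => hn a (by simpa using ha), fun _ _ => rfl⟩ (by decide)
  obtain ⟨s2, t2, hrun2, ht2, hs2⟩ := checkP_spec (O := O) hl hm
    (G := (I.tables O).first (s.nat 14)) (by rw [hn 15 (by decide)]; exact hs.first)
  rw [h4, hn 18 (by decide)] at hs2
  refine ⟨s2, _, .seq hrun' hrun2, Nat.add_le_add ht ht2, fun j => ?_, ?_⟩
  · rw [hrun2.agree.2 0 (by decide)]
    rfl
  · rw [system_iff (O := O)]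
    rcases hs2 with ⟨e, hno⟩ | ⟨e, a, ha, b, hb, hc⟩
    · exact ⟨fun _ => e, fun h => absurd hno h⟩
    · exact ⟨fun h => absurd hc (h a ha b hb), fun _ => e⟩

end GraphInstance

end PostedPricing

theorem mainTheorem12 :
    (∀ I : PostedPricing.GraphInstance, I.optRevenue ≠ ⊤ →
      ∃ (p : Fin I.numServices → ℝ≥0) (R : Finset (Fin I.numServices) → Prop),
        I.IsApproxOPM p R (32 / 3)) ∧
    (∃ (P : PostedPricing.Program) (T : Polynomial ℕ),
      ∀ I : PostedPricing.GraphInstance, I.optRevenue ≠ ⊤ →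
        ∀ O : PostedPricing.Oracle, O.Correct I →
          ∃ (p : Fin I.numServices → ℝ≥0) (R : Finset (Fin I.numServices) → Prop),
            I.IsApproxOPM p R (32 / 3) ∧ I.Computes O P (T.eval I.size) p R) := by
  refine ⟨fun I hI => ?_, PostedPricing.opmProgram, ?_⟩
  · obtain ⟨O, hO⟩ := PostedPricing.GraphInstance.exists_correct_oracle hI
    obtain ⟨p, R, h, -⟩ := PostedPricing.GraphInstance.computes_opmProgram hI hO
    exact ⟨p, R, h⟩
  -- The tables have size at most `40000 * x + 2`, the number of candidates per service, and packing
  -- takes at most `40000 * x * x` iterations, for instances of size `x`.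
  · obtain ⟨T, hT⟩ : ∃ T : Polynomial ℕ, ∀ x, T.eval x =
        PostedPricing.GraphInstance.opmTime (40000 * x + 2) (40000 * x * x) := by
      let z : Polynomial ℕ := Polynomial.C 40000 * Polynomial.X + Polynomial.C 2
      let y : Polynomial ℕ := Polynomial.C 40000 * Polynomial.X * Polynomial.X
      let c : ℕ → Polynomial ℕ := fun n => Polynomial.C n
      refine ⟨(z * (z * c 7 + c 4) + c 2) + ((y * (z * (z * c 16 + c 4) + c 19) + c 2) +
        ((z * (z * (z * c 4 + c 8) + c 5) + c 2) + ((z * c 4 + c 2) + ((z * c 4 + c 2) +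
        (z * (z * (z * (z * c 4 + c 6) + c 10) + c 8) + c 2))))) + (z * (z * c 4 + c 4) + c 4),
        fun x => ?_⟩
      simp only [z, y, c, PostedPricing.GraphInstance.opmTime, PostedPricing.pricesTime,
        Polynomial.eval_add, Polynomial.eval_mul, Polynomial.eval_C, Polynomial.eval_X]
    refine ⟨T, fun I hI O hO => ?_⟩
    rw [hT]
    exact PostedPricing.GraphInstance.computes_opmProgram hI hO
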